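/- **Theorem 3.1.** Let $\Lambda=(-1,1)$, $1<\alpha<2$, $0\le p\le 1$, and let $c\ge 0$ be a constant. Let $\mu,\nu\in[\alpha-2,0]$ be the exponents determined by $\mu+\nu=\alpha-2$ and $p\sin(\pi\mu)=(1-p)\sin(\pi\nu)$, and put $C_{\alpha,p}=\dfrac{\sin\pi\mu+\sin\pi\nu}{\sin\pi\alpha}$. For $v\in L^1(\Lambda)$ let $$\mathcal I_p^{2-\alpha}v(x)=\frac{C_{\alpha,p}}{\Gamma(2-\alpha)}\Big(p\int_{-1}^x\frac{v(y)}{(x-y)^{\alpha-1}}\,dy+(1-p)\int_x^1\frac{v(y)}{(y-x)^{\alpha-1}}\,dy\Big),\qquad \mathcal D_p^{\alpha-1}v=\frac{d}{dx}\mathcal I_p^{2-\alpha}v,$$ the derivative being taken in the weak sense. Let $$H_{RL}^{\alpha-1}(\Lambda)=\{v\in L^1(\Lambda):\ \mathcal I_p^{2-\alpha}v\in L^2(\Lambda),\ \mathcal D_p^{\alpha-1}v\in L^2(\Lambda)\},\qquad \|v\|_{H_{RL}^{\alpha-1}(\Lambda)}^2=\|\mathcal I_p^{2-\alpha}v\|_{L^2(\Lambda)}^2+\|\mathcal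 D_p^{\alpha-1}v\|_{L^2(\Lambda)}^2,$$ and let $H_{RL}^{\alpha-1,0}(\Lambda)$ be the set of all $v\in H_{RL}^{\alpha-1}(\Lambda)$ with $\mathcal I_p^{2-\alpha}v(\pm1)=0$, where $\mathcal I_p^{2-\alpha}v\in H^1(\Lambda)$ is evaluated at $\pm1$ through its continuous representative on $[-1,1]$. Let $H^{-1}(\Lambda)$ be the dual of $H^1_0(\Lambda)$, with the dual norm for the full $H^1$ norm on $H_0^1(\Lambda)$. Then there is a constant $C>0$, depending only on $\alpha$, $p$ and $c$, such that for every $f\in H^{-1}(\Lambda)$ there is exactly one $u\in H_{RL}^{\alpha-1,0}(\Lambda)$ with $$c\int_\Lambda u\;\mathcal I_p^{2-\alpha}v\,dx+\int_\Lambda \mathcal D_p^{\alpha-1}u\;\mathcal D_p^{\alpha-1}v\,dx=\langle f,\mathcal I_p^{2-\alpha}v\rangle\qquad\text{for all } v\in H_{RL}^{\alpha-1,0}(\Lambda),$$ and this $u$ satisfies $\|u\|_{H_{RL}^{\alpha-1}(\Lambda)}\le C\,\|f\|_{H^{-1}(\Lambda)}$. -/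

import Mathlib

open MeasureTheory Set
open scoped ContDiff ENNReal

namespace TwoSidedRL

noncomputable section

/-- The left Riemann-Liouville fractional integral of order `σ` on an interval starting at `a`. -/
def leftFracInt (a σ : ℝ) (v : ℝ → ℝ) (x : ℝ) : ℝ :=
  1 / Real.Gamma σ * ∫ y in a..x, v y / (x - y) ^ (1 - σ)

/-- The right Riemann-Liouville fractional integral of order `σ` on an interval ending at `b`. -/
def rightFracInt (b σ : ℝ) (v : ℝ → ℝ) (x : ℝ) : ℝ :=
  1 / Real.Gamma σ * ∫ y in x..b, v y / (y - x) ^ (1 - σ)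

/-- The normalizing constant `C_{α,p} = (sin πμ + sin πν) / sin πα`. -/
def fracConst (α μ ν : ℝ) : ℝ :=
  (Real.sin (Real.pi * μ) + Real.sin (Real.pi * ν)) / Real.sin (Real.pi * α)

/-- The two-sided fractional integral `I_p^ρ` on `(-1, 1)`. -/
def twoSidedFracInt (α p μ ν ρ : ℝ) (v : ℝ → ℝ) (x : ℝ) : ℝ :=
  fracConst α μ ν * (p * leftFracInt (-1) ρ v x + (1 - p) * rightFracInt 1 ρ v x)

/-- `μ, ν` are the exponents in `[α - 2, 0]` belonging to `(α, p)`. -/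
def AdmissibleExponents (α p μ ν : ℝ) : Prop :=
  α - 2 ≤ μ ∧ μ ≤ 0 ∧ α - 2 ≤ ν ∧ ν ≤ 0 ∧ μ + ν = α - 2 ∧
    p * Real.sin (Real.pi * μ) = (1 - p) * Real.sin (Real.pi * ν)

/-- Admissible exponents exist for all `1 < α < 2` and `0 ≤ p ≤ 1`. -/
theorem exists_admissibleExponents {α p : ℝ} (h1 : 1 < α) (h2 : α < 2) (hp0 : 0 ≤ p)
    (hp1 : p ≤ 1) : ∃ μ ν : ℝ, AdmissibleExponents α p μ ν := by
  have hs : Real.sin (Real.pi * (α - 2)) ≤ 0 :=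
    Real.sin_nonpos_of_nonpos_of_neg_pi_le (by nlinarith [Real.pi_pos])
      (by nlinarith [Real.pi_pos])
  have hcont : ContinuousOn (fun t : ℝ => p * Real.sin (Real.pi * t) -
      (1 - p) * Real.sin (Real.pi * (α - 2 - t))) (Icc (α - 2) 0) := by fun_prop
  obtain ⟨μ, hμ, he⟩ := intermediate_value_Icc (by linarith : α - 2 ≤ (0 : ℝ)) hcont
    (show (0 : ℝ) ∈ _ by
      constructor
      · simp only [sub_self, mul_zero, Real.sin_zero, sub_zero]
        nlinarith
      · simp only [sub_zero, mul_zero, Real.sin_zero]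
        nlinarith)
  exact ⟨μ, α - 2 - μ, hμ.1, hμ.2, by linarith [hμ.2], by linarith [hμ.1], by ring,
    sub_eq_zero.mp he⟩

/-- The interval `Λ = (-1, 1)`. -/
abbrev Lam : Set ℝ := Ioo (-1) 1

/-- Lebesgue measure on `Λ`. -/
abbrev lamMeasure : Measure ℝ := volume.restrict Lam

/-- `g` is a weak (distributional) derivative of `w` on `Λ`. -/
def HasWeakDeriv (w g : ℝ → ℝ) : Prop :=
  ∀ φ : ℝ → ℝ, ContDiff ℝ ∞ φ → HasCompactSupport φ → tsupport φ ⊆ Lam →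
    ∫ x in Lam, w x * deriv φ x = -∫ x in Lam, g x * φ x

/-- `w` belongs to `H¹(Λ)`: both `w` and its weak derivative are square integrable on `Λ`. -/
def MemH1 (w : ℝ → ℝ) : Prop :=
  MemLp w 2 lamMeasure ∧ ∃ g : ℝ → ℝ, MemLp g 2 lamMeasure ∧ HasWeakDeriv w g

open Classical in
/-- The square integrable weak derivative of `w` on `Λ` (almost everywhere unique), with the
value `0` if there is none. -/
def weakDeriv (w : ℝ → ℝ) : ℝ → ℝ :=
  if h : ∃ g : ℝ → ℝ, MemLp g 2 lamMeasure ∧ HasWeakDeriv w g then h.choose else 0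

/-- The boundary values of `w` at `±1`, taken through the representative of `w` that is
continuous on `[-1, 1]`, vanish. -/
def ZeroBoundary (w : ℝ → ℝ) : Prop :=
  ∃ r : ℝ → ℝ, ContinuousOn r (Icc (-1) 1) ∧ w =ᵐ[lamMeasure] r ∧ r (-1) = 0 ∧ r 1 = 0

theorem memLp_weakDeriv {w : ℝ → ℝ} (h : MemH1 w) : MemLp (weakDeriv w) 2 lamMeasure := by
  rw [weakDeriv, dif_pos h.2]
  exact h.2.choose_spec.1

theorem hasWeakDeriv_weakDeriv {w : ℝ → ℝ} (h : MemH1 w) : HasWeakDeriv w (weakDeriv w) := by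
  rw [weakDeriv, dif_pos h.2]
  exact h.2.choose_spec.2

/-- Square integrable weak derivatives are unique up to null sets. -/
theorem HasWeakDeriv.ae_unique {w g h : ℝ → ℝ} (hg : MemLp g 2 lamMeasure)
    (hh : MemLp h 2 lamMeasure) (hwg : HasWeakDeriv w g) (hwh : HasWeakDeriv w h) :
    g =ᵐ[lamMeasure] h := by
  have ig : Integrable g lamMeasure := hg.integrable (by norm_num)
  have ih : Integrable h lamMeasure := hh.integrable (by norm_num)
  have key := IsOpen.ae_eq_zero_of_integral_contDiff_smul_eq_zero (μ := lamMeasure)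
    (f := fun x => g x - h x) (isOpen_Ioo (a := (-1 : ℝ)) (b := 1))
    ((ig.sub ih).locallyIntegrable.locallyIntegrableOn _) (by
      intro φ hφ hc hs
      obtain ⟨K, hK⟩ := hφ.continuous.bounded_above_of_compact_support hc
      have e1 : Integrable (fun x => g x * φ x) lamMeasure :=
        ig.mul_bdd hφ.continuous.aestronglyMeasurable (Filter.Eventually.of_forall hK)
      have e2 : Integrable (fun x => h x * φ x) lamMeasure :=
        ih.mul_bdd hφ.continuous.aestronglyMeasurable (Filter.Eventually.of_forall hK)
      have e3 := (hwg φ hφ hc hs).symm.trans (hwh φ hφ hc hs)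
      have e4 : ∫ x in Lam, φ x • (g x - h x) = ∫ x in Lam, (g x * φ x - h x * φ x) := by
        congr 1
        funext x
        simp only [smul_eq_mul]
        ring
      rw [e4, integral_sub e1 e2]
      linarith)
  filter_upwards [key, ae_restrict_mem measurableSet_Ioo] with x hx hxm
  exact sub_eq_zero.mp (hx hxm)

theorem HasWeakDeriv.congr {w g w' g' : ℝ → ℝ} (h : HasWeakDeriv w g)
    (hw : w =ᵐ[lamMeasure] w') (hg : g =ᵐ[lamMeasure] g') : HasWeakDeriv w' g' := by
  intro φ h1 h2 h3
  have e1 : ∫ x in Lam, w' x * deriv φ x = ∫ x in Lam, w x * deriv φ x :=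
    integral_congr_ae (by filter_upwards [hw] with x hx; rw [hx])
  have e2 : ∫ x in Lam, g' x * φ x = ∫ x in Lam, g x * φ x :=
    integral_congr_ae (by filter_upwards [hg] with x hx; rw [hx])
  rw [e1, e2]
  exact h φ h1 h2 h3

theorem HasWeakDeriv.add {w g w' g' : ℝ → ℝ} (mw : MemLp w 2 lamMeasure)
    (mg : MemLp g 2 lamMeasure) (mw' : MemLp w' 2 lamMeasure) (mg' : MemLp g' 2 lamMeasure)
    (h : HasWeakDeriv w g) (h' : HasWeakDeriv w' g') :
    HasWeakDeriv (fun x => w x + w' x) (fun x => g x + g' x) := by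
  intro φ h1 h2 h3
  obtain ⟨K, hK⟩ := h1.continuous.bounded_above_of_compact_support h2
  have hd : Continuous (deriv φ) := h1.continuous_deriv (by simp)
  obtain ⟨K', hK'⟩ := hd.bounded_above_of_compact_support h2.deriv
  have i1 {f : ℝ → ℝ} (hf : MemLp f 2 lamMeasure) :
      Integrable (fun x => f x * φ x) lamMeasure :=
    (hf.integrable (by norm_num)).mul_bdd h1.continuous.aestronglyMeasurable
      (Filter.Eventually.of_forall hK)
  have i2 {f : ℝ → ℝ} (hf : MemLp f 2 lamMeasure) :
      Integrable (fun x => f x * deriv φ x) lamMeasure :=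
    (hf.integrable (by norm_num)).mul_bdd hd.aestronglyMeasurable
      (Filter.Eventually.of_forall hK')
  simp only [add_mul]
  rw [integral_add (i2 mw) (i2 mw'), integral_add (i1 mg) (i1 mg'), h φ h1 h2 h3,
    h' φ h1 h2 h3]
  ring

theorem HasWeakDeriv.const_mul {w g : ℝ → ℝ} (a : ℝ) (h : HasWeakDeriv w g) :
    HasWeakDeriv (fun x => a * w x) (fun x => a * g x) := by
  intro φ h1 h2 h3
  simp only [mul_assoc]
  rw [integral_const_mul, integral_const_mul, h φ h1 h2 h3]
  ring

/-- The Hilbert space `H¹₀(Λ)` with its `H¹` inner product, realized as the space of pairs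
`(w, w')` in `L²(Λ) × L²(Λ)` such that `w'` is the weak derivative of `w` and the continuous
representative of `w` vanishes at `±1`. -/
def H10 : Submodule ℝ (WithLp 2 (Lp ℝ 2 lamMeasure × Lp ℝ 2 lamMeasure)) where
  carrier := {z | HasWeakDeriv z.fst z.snd ∧ ZeroBoundary z.fst}
  zero_mem' := by
    have h0 : ((0 : Lp ℝ 2 lamMeasure) : ℝ → ℝ) =ᵐ[lamMeasure] fun _ => (0 : ℝ) :=
      Lp.coeFn_zero ℝ 2 lamMeasure
    refine ⟨HasWeakDeriv.congr (w := fun _ => 0) (g := fun _ => 0) ?_ h0.symm h0.symm,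
      fun _ => 0, continuousOn_const, h0, rfl, rfl⟩
    intro φ _ _ _
    simp
  add_mem' := by
    rintro z y ⟨hz, r, hr, hzr, h1, h2⟩ ⟨hy, s, hs, hys, h3, h4⟩
    have e1 : ((z + y).fst : ℝ → ℝ) =ᵐ[lamMeasure] fun x => z.fst x + y.fst x :=
      Lp.coeFn_add z.fst y.fst
    have e2 : ((z + y).snd : ℝ → ℝ) =ᵐ[lamMeasure] fun x => z.snd x + y.snd x :=
      Lp.coeFn_add z.snd y.snd
    refine ⟨(HasWeakDeriv.add (Lp.memLp _) (Lp.memLp _) (Lp.memLp _) (Lp.memLp _) hz hy).congr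
      e1.symm e2.symm, fun x => r x + s x, hr.add hs, ?_, by simp [h1, h3], by simp [h2, h4]⟩
    filter_upwards [e1, hzr, hys] with x a b c
    rw [a, b, c]
  smul_mem' := by
    rintro a z ⟨hz, r, hr, hzr, h1, h2⟩
    have e1 : ((a • z).fst : ℝ → ℝ) =ᵐ[lamMeasure] fun x => a * z.fst x :=
      Lp.coeFn_smul a z.fst
    have e2 : ((a • z).snd : ℝ → ℝ) =ᵐ[lamMeasure] fun x => a * z.snd x :=
      Lp.coeFn_smul a z.snd
    refine ⟨(hz.const_mul a).congr e1.symm e2.symm, fun x => a * r x,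
      continuousOn_const.mul hr, ?_, by simp [h1], by simp [h2]⟩
    filter_upwards [e1, hzr] with x b c
    rw [b, c]

/-- `H⁻¹(Λ)`, the dual space of `H¹₀(Λ)`, with the dual norm. -/
abbrev Hneg1 : Type := StrongDual ℝ H10

/-- A function in `H¹(Λ)` with zero boundary values, as an element of `H¹₀(Λ)`. -/
def toH10 (w : ℝ → ℝ) (hw : MemH1 w) (hb : ZeroBoundary w) : H10 :=
  ⟨WithLp.toLp 2 (hw.1.toLp w, (memLp_weakDeriv hw).toLp (weakDeriv w)), by
    obtain ⟨r, hr, hwr, h1, h2⟩ := hb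
    exact ⟨(hasWeakDeriv_weakDeriv hw).congr hw.1.coeFn_toLp.symm
      (memLp_weakDeriv hw).coeFn_toLp.symm, r, hr, hw.1.coeFn_toLp.trans hwr, h1, h2⟩⟩

/-- The two-sided Riemann-Liouville derivative `D_p^{α-1} = d/dx I_p^{2-α}` (for `1 < α < 2`),
with the derivative in the weak sense. -/
def twoSidedFracDeriv (α p μ ν : ℝ) (v : ℝ → ℝ) : ℝ → ℝ :=
  weakDeriv (twoSidedFracInt α p μ ν (2 - α) v)

/-- `v ∈ H_RL^{α-1}(Λ)`, for `v ∈ L¹(Λ)`: both `I_p^{2-α} v` and its weak derivative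
`D_p^{α-1} v` are in `L²(Λ)`. -/
def MemHRL (α p μ ν : ℝ) (v : Lp ℝ 1 lamMeasure) : Prop :=
  MemH1 (twoSidedFracInt α p μ ν (2 - α) v)

/-- The norm of `H_RL^{α-1}(Λ)`. -/
def normHRL (α p μ ν : ℝ) (v : Lp ℝ 1 lamMeasure) : ℝ :=
  Real.sqrt ((eLpNorm (twoSidedFracInt α p μ ν (2 - α) v) 2 lamMeasure).toReal ^ 2 +
    (eLpNorm (twoSidedFracDeriv α p μ ν v) 2 lamMeasure).toReal ^ 2)

/-- `v ∈ H_RL^{α-1,0}(Λ)`: moreover `I_p^{2-α} v (±1) = 0`. -/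
def MemHRL0 (α p μ ν : ℝ) (v : Lp ℝ 1 lamMeasure) : Prop :=
  MemHRL α p μ ν v ∧ ZeroBoundary (twoSidedFracInt α p μ ν (2 - α) v)

/-- The bilinear form `A(u, v) = c (u, I_p^{2-α} v) + (D_p^{α-1} u, D_p^{α-1} v)`. -/
def bilinA (α p μ ν c : ℝ) (u v : Lp ℝ 1 lamMeasure) : ℝ :=
  c * (∫ x in Lam, u x * twoSidedFracInt α p μ ν (2 - α) v x) +
    ∫ x in Lam, twoSidedFracDeriv α p μ ν u x * twoSidedFracDeriv α p μ ν v x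

/-- The integrals in the bilinear form converge absolutely. -/
theorem integrable_bilinA {α p μ ν : ℝ} {u v : Lp ℝ 1 lamMeasure}
    (hu : MemHRL0 α p μ ν u) (hv : MemHRL0 α p μ ν v) :
    Integrable (fun x => u x * twoSidedFracInt α p μ ν (2 - α) v x) lamMeasure ∧
    Integrable (fun x => twoSidedFracDeriv α p μ ν u x * twoSidedFracDeriv α p μ ν v x)
      lamMeasure := by
  refine ⟨?_, (memLp_weakDeriv hu.1).integrable_mul (memLp_weakDeriv hv.1)⟩
  obtain ⟨r, hr, hvr, -, -⟩ := hv.2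
  obtain ⟨K, hK⟩ := isCompact_Icc.exists_bound_of_continuousOn hr
  refine ((memLp_one_iff_integrable).1 (Lp.memLp u)).mul_bdd (c := K)
    hv.1.1.aestronglyMeasurable ?_
  filter_upwards [hvr, ae_restrict_mem measurableSet_Ioo] with x hx hxm
  rw [hx]
  exact hK x (Ioo_subset_Icc_self hxm)

/-- `u` is a solution of the weak problem with homogeneous fractional Dirichlet boundary
conditions: `u ∈ H_RL^{α-1,0}(Λ)` and `A(u, v) = ⟨f, I_p^{2-α} v⟩` for all
`v ∈ H_RL^{α-1,0}(Λ)`. -/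
def IsWeakSolution (α p μ ν c : ℝ) (f : Hneg1) (u : Lp ℝ 1 lamMeasure) : Prop :=
  MemHRL0 α p μ ν u ∧ ∀ (v : Lp ℝ 1 lamMeasure) (hv : MemHRL0 α p μ ν v),
    bilinA α p μ ν c u v = f (toH10 (twoSidedFracInt α p μ ν (2 - α) v) hv.1 hv.2)

end

end TwoSidedRL

/-!
Up to a positive constant, `I_p^{2-α}` is convolution over `(-1, 1)` with the two-sided Abel kernel
`p t₊ ^ (σ - 1) + (1 - p) t₋ ^ (σ - 1)`, where `σ = 2 - α`. Once this convolution `I` is inverted, with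
a bound `‖u‖_{L¹} ≤ M ‖(I u)'‖_{L²}`, on all primitives of functions in `L²`, the theorem reduces to
Lax-Milgram: a function in `H¹` with zero boundary values is the primitive of a mean-zero `L²`
function (`ae_eq_prim_of_hasWeakDeriv`), so `g ↦ V g` with `I V g = ∫_{-1}^x g` parametrizes
`H_RL^{α-1,0}` by the mean-zero functions in `L²` (`exists_fracInt_inverse`). In this parametrization
the form is `c ∫ (V g) (I V k) + ⟪g, k⟫`. It is bounded by the bound on `V`, and coercive because
`∫ u I u ≥ 0`: the symmetrized kernel is a positive multiple of the autocorrelation of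
`t₊ ^ (σ / 2 - 1)` (`integral_mul_abelOp_nonneg`).

The inversion rests on the Jacobi weight `ω = (1 - x) ^ μ (1 + x) ^ ν`. Its image under `I` is
constant (`abelOp_jacWeight`): the two halves are hypergeometric integrals whose derivatives a Möbius
substitution turns into Beta integrals, and these cancel by the reflection formula for the Gamma
function and the relation `p sin πμ = (1 - p) sin πν`. As `[I, x]` is `σ` times integration up to a
constant (`abelOp_id_mul`), `I (ω q)` is a polynomial `T q` for every polynomial `q`, of the same degree
and with the leading coefficient multiplied by `K ∏_{k<n} (1 - σ / (k + 1))`, which is at least of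
order `1 / n` (`exists_polyOp`). In particular `T` is bijective on polynomials.

The bound needs no spectral analysis of `T`. Let `T'` belong to the reflected kernel and the weight
`ω' = (1 - x) ^ ν (1 + x) ^ μ`; it is adjoint to `T` for the pairings with weights `ω` and `ω'`. Let `J`
be the Jacobi differential operator for `ω'`. Then `T' (1 + J) T - c` is symmetric for the weight
`ω` and triangular, and its diagonal is nonnegative for a small `c > 0`. A symmetric triangular operator is
diagonal in the basis of orthogonal polynomials, so it is positive semidefinite
(`Triangular.nonneg_of_symm`). This says
`c ∫ ω q² ≤ ∫ ω' (T q)² + ∫ (1 - x²) ω' ((T q)')²` (`exists_polyOp_bound`), and since `μ, ν > -1` it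
implies the `L¹` bound for `u = ω q` when `T q` vanishes at `-1`. Density of polynomials in `L²` extends
solvability and bound to all primitives (`exists_abelOp_eq_prim`), and injectivity of `I` on `L¹`
follows by duality, as the range of the adjoint contains all polynomials (`abelOp_injective`).
-/

namespace TwoSidedRL

noncomputable section

/-! ### The two-sided Abel kernel -/

/-- The truncated power `t₊ ^ s`. For `s ≠ 0` it vanishes on `t ≤ 0`, because `0 ^ s = 0`. -/
def posPow (s t : ℝ) : ℝ := max t 0 ^ s

/-- The two-sided Abel kernel `p t₊ ^ (σ - 1) + (1 - p) t₋ ^ (σ - 1)`. -/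
def abelKer (p σ t : ℝ) : ℝ := p * posPow (σ - 1) t + (1 - p) * posPow (σ - 1) (-t)

/-- Convolution with the two-sided Abel kernel over `Λ`, that is `I_p^σ` without its
normalizing constant. -/
def abelOp (p σ : ℝ) (v : ℝ → ℝ) (x : ℝ) : ℝ := ∫ y in Lam, abelKer p σ (x - y) * v y

lemma posPow_nonneg (s t : ℝ) : 0 ≤ posPow s t := Real.rpow_nonneg (le_max_right _ _) _

lemma posPow_of_pos {s t : ℝ} (ht : 0 < t) : posPow s t = t ^ s := by
  rw [posPow, max_eq_left ht.le]

lemma posPow_of_nonpos {s t : ℝ} (hs : s ≠ 0) (ht : t ≤ 0) : posPow s t = 0 := by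
  rw [posPow, max_eq_right ht, Real.zero_rpow hs]

@[fun_prop]
lemma measurable_posPow (s : ℝ) : Measurable (posPow s) := by
  unfold posPow
  fun_prop

@[fun_prop]
lemma measurable_abelKer (p σ : ℝ) : Measurable (abelKer p σ) := by
  unfold abelKer
  fun_prop

lemma abelKer_nonneg {p : ℝ} (hp0 : 0 ≤ p) (hp1 : p ≤ 1) (σ t : ℝ) : 0 ≤ abelKer p σ t :=
  add_nonneg (mul_nonneg hp0 (posPow_nonneg _ _))
    (mul_nonneg (by linarith) (posPow_nonneg _ _))

lemma abelKer_reflect (p σ x y : ℝ) : abelKer (1 - p) σ (x - y) = abelKer p σ (y - x) := by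
  simp only [abelKer, neg_sub]
  ring

lemma integrableOn_posPow {s : ℝ} (hs : -1 < s) (hs' : s ≠ 0) (a b : ℝ) :
    IntegrableOn (posPow s) (Ioc a b) := by
  have h1 : IntegrableOn (posPow s) (Ioc 0 (max b 0)) := by
    refine ((intervalIntegrable_iff_integrableOn_Ioc_of_le (le_max_right b 0)).1
      (intervalIntegral.intervalIntegrable_rpow' hs)).congr_fun (fun t ht => ?_) measurableSet_Ioc
    exact (posPow_of_pos ht.1).symm
  have h2 : IntegrableOn (posPow s) (Ioc (min a 0) 0) := by
    refine integrableOn_zero.congr_fun (fun t ht => ?_) measurableSet_Ioc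
    exact (posPow_of_nonpos hs' ht.2).symm
  refine (h2.union h1).mono_set fun t ht => ?_
  rcases le_or_gt t 0 with h | h
  · exact Or.inl ⟨lt_of_le_of_lt (min_le_left _ _) ht.1, h⟩
  · exact Or.inr ⟨h, ht.2.trans (le_max_left _ _)⟩

lemma integrableOn_abelKer {σ : ℝ} (hσ0 : 0 < σ) (hσ1 : σ < 1) (p a b : ℝ) :
    IntegrableOn (abelKer p σ) (Ioc a b) := by
  have h1 (a b : ℝ) := integrableOn_posPow (s := σ - 1) (by linarith) (by linarith) a b
  have h2 : IntegrableOn (fun t => posPow (σ - 1) (-t)) (Ioc a b) := by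
    rcases le_total a b with hab | hab
    · have := (intervalIntegrable_iff_integrableOn_Ioc_of_le (neg_le_neg hab)).2 (h1 (-b) (-a))
      have := (IntervalIntegrable.comp_sub_left this 0).symm
      simp only [zero_sub, neg_neg] at this
      exact (intervalIntegrable_iff_integrableOn_Ioc_of_le hab).1 this
    · simp [Ioc_eq_empty_of_le hab]
  exact ((h1 a b).const_mul p).add (h2.const_mul (1 - p))

/-- The mass of the Abel kernel over all differences of points of `Λ`. -/
def abelMass (p σ : ℝ) : ℝ := ∫ t in Ioc (-2) 2, abelKer p σ t

lemma integrable_abelKer_sub {σ : ℝ} (hσ0 : 0 < σ) (hσ1 : σ < 1) (p y : ℝ) :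
    Integrable (fun x => abelKer p σ (x - y)) lamMeasure := by
  have h := integrableOn_abelKer hσ0 hσ1 p (-1 - y) (1 - y)
  have := ((intervalIntegrable_iff_integrableOn_Ioc_of_le (by linarith)).2 h).comp_sub_right y
  rw [sub_add_cancel, sub_add_cancel] at this
  exact ((intervalIntegrable_iff_integrableOn_Ioc_of_le (by norm_num)).1 this).mono_set
    Ioo_subset_Ioc_self

lemma integral_abelKer_sub_le {σ p : ℝ} (hσ0 : 0 < σ) (hσ1 : σ < 1) (hp0 : 0 ≤ p) (hp1 : p ≤ 1)
    {y : ℝ} (hy : y ∈ Lam) : ∫ x in Lam, abelKer p σ (x - y) ≤ abelMass p σ := by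
  rw [← integral_Ioc_eq_integral_Ioo, ← intervalIntegral.integral_of_le (by norm_num),
    intervalIntegral.integral_comp_sub_right (fun t => abelKer p σ t),
    intervalIntegral.integral_of_le (by linarith)]
  refine setIntegral_mono_set (integrableOn_abelKer hσ0 hσ1 p _ _)
    (Filter.Eventually.of_forall fun t => abelKer_nonneg hp0 hp1 σ t) ?_
  exact (Ioc_subset_Ioc (by linarith [hy.2]) (by linarith [hy.1])).eventuallyLE

/-! ### The Abel operator on integrable functions -/

lemma aestronglyMeasurable_abelKer_mul (p σ : ℝ) {v : ℝ → ℝ}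
    (hv : AEStronglyMeasurable v lamMeasure) :
    AEStronglyMeasurable (fun z : ℝ × ℝ => abelKer p σ (z.1 - z.2) * v z.2)
      (lamMeasure.prod lamMeasure) := by
  refine AEStronglyMeasurable.mul ?_ hv.comp_snd
  exact ((measurable_abelKer p σ).comp
    (measurable_fst.sub measurable_snd)).aestronglyMeasurable

lemma integrable_prod_abelKer_mul {σ p : ℝ} (hσ0 : 0 < σ) (hσ1 : σ < 1) (hp0 : 0 ≤ p)
    (hp1 : p ≤ 1) {v : ℝ → ℝ} (hv : Integrable v lamMeasure) :
    Integrable (fun z : ℝ × ℝ => abelKer p σ (z.1 - z.2) * v z.2)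
      (lamMeasure.prod lamMeasure) := by
  rw [integrable_prod_iff' (aestronglyMeasurable_abelKer_mul p σ hv.1)]
  refine ⟨Filter.Eventually.of_forall fun y =>
    (integrable_abelKer_sub hσ0 hσ1 p y).mul_const (v y), ?_⟩
  refine (hv.norm.const_mul (abelMass p σ)).mono'
    ((aestronglyMeasurable_abelKer_mul p σ hv.1).norm.prod_swap.integral_prod_right') ?_
  filter_upwards [ae_restrict_mem measurableSet_Ioo] with y hy
  simp only [norm_mul, Real.norm_of_nonneg (abelKer_nonneg hp0 hp1 σ _)]
  rw [integral_mul_const, Real.norm_of_nonneg (mul_nonneg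
    (integral_nonneg fun _ => abelKer_nonneg hp0 hp1 _ _) (norm_nonneg _))]
  exact mul_le_mul_of_nonneg_right (integral_abelKer_sub_le hσ0 hσ1 hp0 hp1 hy) (norm_nonneg _)

lemma ae_integrable_abelKer_mul {σ p : ℝ} (hσ0 : 0 < σ) (hσ1 : σ < 1) (hp0 : 0 ≤ p)
    (hp1 : p ≤ 1) {v : ℝ → ℝ} (hv : Integrable v lamMeasure) :
    ∀ᵐ x ∂lamMeasure, Integrable (fun y => abelKer p σ (x - y) * v y) lamMeasure :=
  (integrable_prod_abelKer_mul hσ0 hσ1 hp0 hp1 hv).prod_right_ae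

lemma integrable_abelOp {σ p : ℝ} (hσ0 : 0 < σ) (hσ1 : σ < 1) (hp0 : 0 ≤ p)
    (hp1 : p ≤ 1) {v : ℝ → ℝ} (hv : Integrable v lamMeasure) :
    Integrable (abelOp p σ v) lamMeasure :=
  (integrable_prod_abelKer_mul hσ0 hσ1 hp0 hp1 hv).integral_prod_left

lemma abelOp_congr (p σ : ℝ) {v w : ℝ → ℝ} (h : v =ᵐ[lamMeasure] w) :
    abelOp p σ v = abelOp p σ w := by
  funext x
  exact integral_congr_ae (by filter_upwards [h] with y hy; rw [hy])

lemma abelOp_const_mul (p σ a : ℝ) (v : ℝ → ℝ) (x : ℝ) :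
    abelOp p σ (fun y => a * v y) x = a * abelOp p σ v x := by
  rw [abelOp, abelOp, ← integral_const_mul]
  congr 1
  funext y
  ring

lemma abelOp_add {σ p : ℝ} (hσ0 : 0 < σ) (hσ1 : σ < 1) (hp0 : 0 ≤ p) (hp1 : p ≤ 1)
    {v w : ℝ → ℝ} (hv : Integrable v lamMeasure) (hw : Integrable w lamMeasure) :
    abelOp p σ (fun y => v y + w y) =ᵐ[lamMeasure] fun x => abelOp p σ v x + abelOp p σ w x := by
  filter_upwards [ae_integrable_abelKer_mul hσ0 hσ1 hp0 hp1 hv,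
    ae_integrable_abelKer_mul hσ0 hσ1 hp0 hp1 hw] with x h1 h2
  simp only [abelOp, mul_add]
  exact integral_add h1 h2

lemma integral_norm_abelOp_le {σ p : ℝ} (hσ0 : 0 < σ) (hσ1 : σ < 1) (hp0 : 0 ≤ p)
    (hp1 : p ≤ 1) {v : ℝ → ℝ} (hv : Integrable v lamMeasure) :
    ∫ x in Lam, ‖abelOp p σ v x‖ ≤ abelMass p σ * ∫ y in Lam, ‖v y‖ := by
  have hi := (integrable_prod_abelKer_mul hσ0 hσ1 hp0 hp1 hv).norm
  calc ∫ x in Lam, ‖abelOp p σ v x‖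
      ≤ ∫ x in Lam, ∫ y in Lam, ‖abelKer p σ (x - y) * v y‖ :=
        integral_mono (integrable_abelOp hσ0 hσ1 hp0 hp1 hv).norm hi.integral_prod_left
          fun x => norm_integral_le_integral_norm _
    _ = ∫ y in Lam, ∫ x in Lam, ‖abelKer p σ (x - y) * v y‖ := integral_integral_swap hi
    _ ≤ ∫ y in Lam, abelMass p σ * ‖v y‖ := by
        refine integral_mono_ae hi.integral_prod_right (hv.norm.const_mul _) ?_
        filter_upwards [ae_restrict_mem measurableSet_Ioo] with y hy
        simp only [norm_mul, Real.norm_of_nonneg (abelKer_nonneg hp0 hp1 σ _)]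
        rw [integral_mul_const]
        exact mul_le_mul_of_nonneg_right (integral_abelKer_sub_le hσ0 hσ1 hp0 hp1 hy)
          (norm_nonneg _)
    _ = _ := integral_const_mul _ _

lemma integral_Lam_posPow_mul_sub {σ : ℝ} (hσ1 : σ < 1) (v : ℝ → ℝ) {x : ℝ} (hx : x ∈ Lam) :
    ∫ y in Lam, posPow (σ - 1) (x - y) * v y = ∫ y in (-1)..x, v y / (x - y) ^ (1 - σ) := by
  rw [intervalIntegral.integral_of_le hx.1.le, integral_Ioc_eq_integral_Ioo,
    ← integral_indicator measurableSet_Ioo, ← integral_indicator measurableSet_Ioo]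
  congr 1
  funext y
  by_cases h1 : y ∈ Ioo (-1) x
  · rw [indicator_of_mem h1, indicator_of_mem (show y ∈ Lam from ⟨h1.1, h1.2.trans hx.2⟩),
      posPow_of_pos (sub_pos.2 h1.2), div_eq_mul_inv, ← Real.rpow_neg (sub_pos.2 h1.2).le, neg_sub,
      mul_comm]
  · rw [indicator_of_notMem h1]
    by_cases h2 : y ∈ Lam
    · have : x ≤ y := by
        by_contra h
        exact h1 ⟨h2.1, not_le.1 h⟩
      rw [indicator_of_mem h2, posPow_of_nonpos (by linarith) (by linarith), zero_mul]
    · rw [indicator_of_notMem h2]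

lemma integral_Lam_posPow_mul_neg_sub {σ : ℝ} (hσ1 : σ < 1) (v : ℝ → ℝ) {x : ℝ} (hx : x ∈ Lam) :
    ∫ y in Lam, posPow (σ - 1) (-(x - y)) * v y = ∫ y in x..1, v y / (y - x) ^ (1 - σ) := by
  simp only [neg_sub]
  rw [intervalIntegral.integral_of_le hx.2.le, integral_Ioc_eq_integral_Ioo,
    ← integral_indicator measurableSet_Ioo, ← integral_indicator measurableSet_Ioo]
  congr 1
  funext y
  by_cases h1 : y ∈ Ioo x 1
  · rw [indicator_of_mem h1, indicator_of_mem (show y ∈ Lam from ⟨hx.1.trans h1.1, h1.2⟩),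
      posPow_of_pos (sub_pos.2 h1.1), div_eq_mul_inv, ← Real.rpow_neg (sub_pos.2 h1.1).le, neg_sub,
      mul_comm]
  · rw [indicator_of_notMem h1]
    by_cases h2 : y ∈ Lam
    · have : y ≤ x := by
        by_contra h
        exact h1 ⟨not_le.1 h, h2.2⟩
      rw [indicator_of_mem h2, posPow_of_nonpos (by linarith) (by linarith), zero_mul]
    · rw [indicator_of_notMem h2]

lemma ae_integrable_posPow_mul {σ : ℝ} (hσ0 : 0 < σ) (hσ1 : σ < 1) {v : ℝ → ℝ}
    (hv : Integrable v lamMeasure) : ∀ᵐ x ∂lamMeasure,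
      Integrable (fun y => posPow (σ - 1) (x - y) * v y) lamMeasure ∧
      Integrable (fun y => posPow (σ - 1) (-(x - y)) * v y) lamMeasure := by
  filter_upwards [ae_integrable_abelKer_mul (p := 1) hσ0 hσ1 (by norm_num) le_rfl hv,
    ae_integrable_abelKer_mul (p := 0) hσ0 hσ1 le_rfl (by norm_num) hv] with x h1 h2
  simp only [abelKer, sub_self, zero_mul, add_zero, one_mul, sub_zero, zero_add] at h1 h2
  exact ⟨h1, h2⟩

/-- The two-sided fractional integral of an integrable function is the normalized convolution
with the Abel kernel. -/
lemma twoSidedFracInt_ae_eq {σ : ℝ} (hσ0 : 0 < σ) (hσ1 : σ < 1) (α p μ ν : ℝ) {v : ℝ → ℝ}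
    (hv : Integrable v lamMeasure) :
    twoSidedFracInt α p μ ν σ v =ᵐ[lamMeasure]
      fun x => fracConst α μ ν / Real.Gamma σ * abelOp p σ v x := by
  filter_upwards [ae_integrable_posPow_mul hσ0 hσ1 hv, ae_restrict_mem measurableSet_Ioo]
    with x h hx
  have : abelOp p σ v x = p * (∫ y in Lam, posPow (σ - 1) (x - y) * v y) +
      (1 - p) * ∫ y in Lam, posPow (σ - 1) (-(x - y)) * v y := by
    rw [← integral_const_mul, ← integral_const_mul,
      ← integral_add (h.1.const_mul p) (h.2.const_mul (1 - p)), abelOp]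
    congr 1
    funext y
    rw [abelKer]
    ring
  rw [this, integral_Lam_posPow_mul_sub hσ1 v hx, integral_Lam_posPow_mul_neg_sub hσ1 v hx,
    twoSidedFracInt, leftFracInt, rightFracInt]
  ring

/-- Reflecting the kernel gives the adjoint of the Abel operator, for test functions whose
absolute value has an essentially bounded image. -/
lemma integral_abelOp_mul {σ p M : ℝ} (hp0 : 0 ≤ p) (hp1 : p ≤ 1) {u z : ℝ → ℝ}
    (hu : Integrable u lamMeasure) (hz : AEStronglyMeasurable z lamMeasure)
    (hzi : ∀ᵐ y ∂lamMeasure, Integrable (fun x => abelKer (1 - p) σ (y - x) * z x) lamMeasure)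
    (hzM : ∀ᵐ y ∂lamMeasure, abelOp (1 - p) σ (fun x => ‖z x‖) y ≤ M) :
    ∫ x in Lam, abelOp p σ u x * z x = ∫ y in Lam, u y * abelOp (1 - p) σ z y := by
  have hm : AEStronglyMeasurable (fun q : ℝ × ℝ => abelKer p σ (q.1 - q.2) * u q.2 * z q.1)
      (lamMeasure.prod lamMeasure) :=
    (aestronglyMeasurable_abelKer_mul p σ hu.1).mul hz.comp_fst
  have hint : Integrable (fun q : ℝ × ℝ => abelKer p σ (q.1 - q.2) * u q.2 * z q.1)
      (lamMeasure.prod lamMeasure) := by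
    rw [integrable_prod_iff' hm]
    constructor
    · filter_upwards [hzi] with y hy
      refine (hy.const_mul (u y)).congr (Filter.Eventually.of_forall fun x => ?_)
      simp only [abelKer_reflect]
      ring
    · refine (hu.norm.const_mul M).mono' hm.norm.prod_swap.integral_prod_right' ?_
      filter_upwards [hzM] with y hy
      rw [Real.norm_of_nonneg (integral_nonneg fun _ => norm_nonneg _)]
      calc ∫ x in Lam, ‖abelKer p σ (x - y) * u y * z x‖
          = ∫ x in Lam, ‖u y‖ * (abelKer (1 - p) σ (y - x) * ‖z x‖) := by
            congr 1
            funext x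
            rw [norm_mul, norm_mul, Real.norm_of_nonneg (abelKer_nonneg hp0 hp1 σ _),
              abelKer_reflect]
            ring
        _ = ‖u y‖ * abelOp (1 - p) σ (fun x => ‖z x‖) y := integral_const_mul _ _
        _ ≤ M * ‖u y‖ := by
            rw [mul_comm]
            exact mul_le_mul_of_nonneg_right hy (norm_nonneg _)
  calc ∫ x in Lam, abelOp p σ u x * z x
      = ∫ x in Lam, ∫ y in Lam, abelKer p σ (x - y) * u y * z x := by
        congr 1
        funext x
        rw [integral_mul_const, abelOp]
    _ = ∫ y in Lam, ∫ x in Lam, abelKer p σ (x - y) * u y * z x := integral_integral_swap hint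
    _ = _ := by
        congr 1
        funext y
        rw [abelOp, ← integral_const_mul]
        congr 1
        funext x
        rw [abelKer_reflect]
        ring

/-! ### Multiplication by the variable -/

lemma hasDerivAt_posPow {s t : ℝ} (hs : s ≠ 0) (hs1 : s ≠ 1) (ht : t ≠ 0) :
    HasDerivAt (posPow s) (s * posPow (s - 1) t) t := by
  rcases lt_or_gt_of_ne ht with h | h
  · rw [posPow_of_nonpos (sub_ne_zero.2 hs1) h.le, mul_zero]
    refine (hasDerivAt_const t (0 : ℝ)).congr_of_eventuallyEq ?_
    filter_upwards [eventually_lt_nhds h] with a ha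
    exact posPow_of_nonpos hs ha.le
  · rw [posPow_of_pos h]
    refine (Real.hasDerivAt_rpow_const (Or.inl h.ne')).congr_of_eventuallyEq ?_
    filter_upwards [eventually_gt_nhds h] with a ha
    exact posPow_of_pos ha

lemma continuous_posPow {s : ℝ} (hs : 0 < s) : Continuous (posPow s) :=
  (continuous_id.max continuous_const).rpow_const fun _ => Or.inr hs.le

lemma self_mul_abelKer {σ : ℝ} (hσ0 : 0 < σ) (hσ1 : σ < 1) (p t : ℝ) :
    t * abelKer p σ t = p * posPow σ t - (1 - p) * posPow σ (-t) := by
  have h1 : σ - 1 ≠ 0 := by linarith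
  have key {a : ℝ} (ha : 0 < a) : a * a ^ (σ - 1) = a ^ σ := by
    rw [Real.rpow_sub_one ha.ne']
    field_simp
  unfold abelKer
  rcases lt_trichotomy t 0 with h | rfl | h
  · rw [posPow_of_nonpos h1 h.le, posPow_of_nonpos hσ0.ne' h.le, posPow_of_pos (neg_pos.2 h),
      posPow_of_pos (neg_pos.2 h), ← key (neg_pos.2 h)]
    ring
  · rw [neg_zero, posPow_of_nonpos hσ0.ne' le_rfl]
    ring
  · rw [posPow_of_nonpos h1 (neg_nonpos.2 h.le), posPow_of_nonpos hσ0.ne' (neg_nonpos.2 h.le),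
      posPow_of_pos h, posPow_of_pos h, ← key h]
    ring

lemma continuous_self_mul_abelKer {σ : ℝ} (hσ0 : 0 < σ) (hσ1 : σ < 1) (p : ℝ) :
    Continuous fun t => t * abelKer p σ t := by
  simp only [self_mul_abelKer hσ0 hσ1]
  have := continuous_posPow hσ0
  fun_prop

/-- The product of the variable with the Abel kernel is an antiderivative of `σ` times the
kernel. -/
lemma intervalIntegral_abelKer {σ : ℝ} (hσ0 : 0 < σ) (hσ1 : σ < 1) (p : ℝ) {a b : ℝ}
    (hab : a ≤ b) :
    σ * ∫ t in a..b, abelKer p σ t = b * abelKer p σ b - a * abelKer p σ a := by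
  rw [← intervalIntegral.integral_const_mul]
  refine integral_eq_of_hasDerivAt_off_countable (fun t => t * abelKer p σ t) _
    (s := {0}) (countable_singleton _) (continuous_self_mul_abelKer hσ0 hσ1 p).continuousOn
    (fun t ht => ?_)
    ((intervalIntegrable_iff_integrableOn_Ioc_of_le hab).2
      ((integrableOn_abelKer hσ0 hσ1 p a b).const_mul σ))
  have ht0 : t ≠ 0 := ht.2
  simp only [self_mul_abelKer hσ0 hσ1]
  have h1 := hasDerivAt_posPow hσ0.ne' hσ1.ne ht0
  have h2 := (hasDerivAt_posPow hσ0.ne' hσ1.ne (neg_ne_zero.2 ht0)).scomp t (hasDerivAt_neg t)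
  refine ((h1.const_mul p).sub (h2.const_mul (1 - p))).congr_deriv ?_
  simp only [smul_eq_mul, abelKer]
  ring

/-- Commuting the Abel operator with multiplication by the variable costs `σ` times an
integration. -/
lemma abelOp_id_mul {σ p : ℝ} (hσ0 : 0 < σ) (hσ1 : σ < 1) (hp0 : 0 ≤ p) (hp1 : p ≤ 1)
    {v : ℝ → ℝ} (hv : Integrable v lamMeasure) :
    ∃ C : ℝ, ∀ᵐ x ∂lamMeasure, abelOp p σ (fun y => y * v y) x =
      x * abelOp p σ v x - σ * (∫ ξ in (-1)..x, abelOp p σ v ξ) + C := by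
  refine ⟨-∫ y in Lam, (-1 - y) * abelKer p σ (-1 - y) * v y, ?_⟩
  have hb (x : ℝ) : Integrable (fun y => (x - y) * abelKer p σ (x - y) * v y) lamMeasure := by
    have hc : Continuous fun y => (x - y) * abelKer p σ (x - y) :=
      (continuous_self_mul_abelKer hσ0 hσ1 p).comp (continuous_const.sub continuous_id)
    obtain ⟨K, hK⟩ := isCompact_Icc.exists_bound_of_continuousOn
      (hc.continuousOn (s := Icc (-1 : ℝ) 1))
    refine hv.bdd_mul hc.aestronglyMeasurable (c := K) ?_
    filter_upwards [ae_restrict_mem measurableSet_Ioo] with y hy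
    exact hK y (Ioo_subset_Icc_self hy)
  filter_upwards [ae_integrable_abelKer_mul hσ0 hσ1 hp0 hp1 hv, ae_restrict_mem measurableSet_Ioo]
    with x hx hxL
  have e1 : abelOp p σ (fun y => y * v y) x =
      x * abelOp p σ v x - ∫ y in Lam, (x - y) * abelKer p σ (x - y) * v y := by
    rw [abelOp, abelOp, ← integral_const_mul, ← integral_sub (hx.const_mul x) (hb x)]
    congr 1
    funext y
    ring
  have e2 : σ * (∫ ξ in (-1)..x, abelOp p σ v ξ) =
      ∫ y in Lam, ((x - y) * abelKer p σ (x - y) * v y -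
        (-1 - y) * abelKer p σ (-1 - y) * v y) := by
    have hsub : Ioc (-1) x ⊆ Lam := fun t ht => ⟨ht.1, ht.2.trans_lt hxL.2⟩
    have hi : Integrable (fun z : ℝ × ℝ => abelKer p σ (z.1 - z.2) * v z.2)
        ((volume.restrict (Ioc (-1) x)).prod lamMeasure) :=
      (integrable_prod_abelKer_mul hσ0 hσ1 hp0 hp1 hv).mono_measure
        (Measure.prod_mono (Measure.restrict_mono hsub le_rfl) le_rfl)
    rw [intervalIntegral.integral_of_le hxL.1.le]
    simp only [abelOp]
    rw [integral_integral_swap hi, ← integral_const_mul]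
    congr 1
    funext y
    rw [integral_mul_const, ← intervalIntegral.integral_of_le hxL.1.le,
      intervalIntegral.integral_comp_sub_right (fun t => abelKer p σ t), ← mul_assoc,
      intervalIntegral_abelKer hσ0 hσ1 p (by linarith [hxL.1])]
    ring
  rw [e1, e2, integral_sub (hb x) (hb (-1))]
  ring

end

end TwoSidedRL

namespace TwoSidedRL

noncomputable section

/-! ### The Jacobi weight and its image under the Abel operator -/

/-- The relations between the order `σ`, the skewness `p` and the Jacobi exponents `μ, ν`. They
are symmetric under reflecting the interval, which exchanges `p` with `1 - p` and `μ` with `ν`. -/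
structure AbelParams (p σ μ ν : ℝ) : Prop where
  σ_pos : 0 < σ
  σ_lt_one : σ < 1
  p_nonneg : 0 ≤ p
  p_le_one : p ≤ 1
  μ_nonpos : μ ≤ 0
  ν_nonpos : ν ≤ 0
  add_eq : μ + ν = -σ
  sin_eq : p * Real.sin (Real.pi * μ) = (1 - p) * Real.sin (Real.pi * ν)

namespace AbelParams

variable {p σ μ ν : ℝ}

lemma symm (h : AbelParams p σ μ ν) : AbelParams (1 - p) σ ν μ where
  σ_pos := h.σ_pos
  σ_lt_one := h.σ_lt_one
  p_nonneg := by linarith [h.p_le_one]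
  p_le_one := by linarith [h.p_nonneg]
  μ_nonpos := h.ν_nonpos
  ν_nonpos := h.μ_nonpos
  add_eq := by linarith [h.add_eq]
  sin_eq := by rw [sub_sub_cancel, h.sin_eq]

lemma neg_one_lt_left (h : AbelParams p σ μ ν) : -1 < μ := by
  linarith [h.add_eq, h.ν_nonpos, h.σ_lt_one]

lemma neg_one_lt_right (h : AbelParams p σ μ ν) : -1 < ν := h.symm.neg_one_lt_left

lemma sin_neg {t : ℝ} (h1 : -1 < t) (h2 : t < 0) : Real.sin (Real.pi * t) < 0 :=
  Real.sin_neg_of_neg_of_neg_pi_lt (by nlinarith [Real.pi_pos]) (by nlinarith [Real.pi_pos])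

lemma eq_one_of_left_eq_zero (h : AbelParams p σ μ ν) (h0 : μ = 0) : p = 1 := by
  have h1 := h.sin_eq
  have h2 := sin_neg h.neg_one_lt_right (by linarith [h.add_eq, h.σ_pos])
  rw [h0, mul_zero, Real.sin_zero, mul_zero, eq_comm, mul_eq_zero] at h1
  rcases h1 with h1 | h1
  · linarith
  · exact absurd h1 h2.ne

lemma Gamma_mul_Gamma_mul_sin {t : ℝ} (h1 : -1 < t) (h2 : t < 0) :
    Real.Gamma (t + 1) * Real.Gamma (1 - t) * Real.sin (Real.pi * t) = t * Real.pi := by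
  have h3 := Real.Gamma_mul_Gamma_one_sub (-t)
  have h4 := Real.Gamma_add_one (s := -t) (by linarith)
  have h5 := sin_neg h1 h2
  rw [sub_neg_eq_add, mul_neg, Real.sin_neg] at h3
  rw [show 1 - t = -t + 1 by ring, h4, show t + 1 = 1 + t by ring]
  calc Real.Gamma (1 + t) * (-t * Real.Gamma (-t)) * Real.sin (Real.pi * t)
      = -t * (Real.Gamma (-t) * Real.Gamma (1 + t)) * Real.sin (Real.pi * t) := by ring
    _ = t * Real.pi := by
        rw [h3, mul_assoc, div_neg, neg_mul, neg_mul, div_mul_cancel₀ _ h5.ne]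
        ring

/-- The relation between `p` and the exponents in terms of Beta functions, by Euler's reflection
formula. -/
lemma beta_eq (h : AbelParams p σ μ ν) :
    p * μ * ProbabilityTheory.beta (ν + 1) σ = (1 - p) * ν * ProbabilityTheory.beta (μ + 1) σ := by
  rcases h.μ_nonpos.eq_or_lt with h0 | hμ
  · rw [h0, h.eq_one_of_left_eq_zero h0]
    ring
  rcases h.ν_nonpos.eq_or_lt with h0 | hν
  · have := h.symm.eq_one_of_left_eq_zero h0
    rw [h0, show p = 0 by linarith]
    ring
  have e1 := Gamma_mul_Gamma_mul_sin h.neg_one_lt_left hμ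
  have e2 := Gamma_mul_Gamma_mul_sin h.neg_one_lt_right hν
  have g1 : 0 < Real.Gamma (1 - μ) := Real.Gamma_pos_of_pos (by linarith)
  have g2 : 0 < Real.Gamma (1 - ν) := Real.Gamma_pos_of_pos (by linarith)
  have s1 := sin_neg h.neg_one_lt_left hμ
  have s2 := sin_neg h.neg_one_lt_right hν
  rw [ProbabilityTheory.beta, ProbabilityTheory.beta, show ν + 1 + σ = 1 - μ by linarith [h.add_eq],
    show μ + 1 + σ = 1 - ν by linarith [h.add_eq]]
  have key : p * μ * (Real.Gamma (ν + 1) * Real.Gamma (1 - ν)) =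
      (1 - p) * ν * (Real.Gamma (μ + 1) * Real.Gamma (1 - μ)) := by
    refine mul_right_cancel₀ (mul_ne_zero s1.ne s2.ne) ?_
    calc p * μ * (Real.Gamma (ν + 1) * Real.Gamma (1 - ν)) *
          (Real.sin (Real.pi * μ) * Real.sin (Real.pi * ν))
        = p * Real.sin (Real.pi * μ) * μ *
          (Real.Gamma (ν + 1) * Real.Gamma (1 - ν) * Real.sin (Real.pi * ν)) := by ring
      _ = (1 - p) * ν * (Real.Gamma (μ + 1) * Real.Gamma (1 - μ) * Real.sin (Real.pi * μ)) *
          Real.sin (Real.pi * ν) := by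
          rw [e1, e2, h.sin_eq]
          ring
      _ = _ := by ring
  field_simp
  linear_combination Real.Gamma σ * key

end AbelParams

/-- The Jacobi weight `(1 - x) ^ μ (1 + x) ^ ν`. -/
def jacWeight (μ ν x : ℝ) : ℝ := (1 - x) ^ μ * (1 + x) ^ ν

lemma beta_intervalIntegrable {a b : ℝ} (ha : -1 < a) (hb : -1 < b) :
    IntervalIntegrable (fun s : ℝ => (1 - s) ^ a * s ^ b) volume 0 1 := by
  have h := Complex.betaIntegral_convergent (u := ((b + 1 : ℝ) : ℂ)) (v := ((a + 1 : ℝ) : ℂ))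
    (by rw [Complex.ofReal_re]; linarith) (by rw [Complex.ofReal_re]; linarith)
  rw [intervalIntegrable_iff_integrableOn_Ioc_of_le zero_le_one] at h ⊢
  refine IntegrableOn.congr_fun (Integrable.re h) (fun x hx => ?_) measurableSet_Ioc
  have e1 : ((b + 1 : ℝ) : ℂ) - 1 = (b : ℝ) := by push_cast; ring
  have e2 : ((a + 1 : ℝ) : ℂ) - 1 = (a : ℝ) := by push_cast; ring
  have e3 : (1 : ℂ) - (x : ℂ) = ((1 - x : ℝ) : ℂ) := by push_cast; ring
  simp only [e1, e2, e3]
  rw [← Complex.ofReal_cpow hx.1.le, ← Complex.ofReal_cpow (by linarith [hx.2]),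
    ← Complex.ofReal_mul]
  rw [RCLike.re_to_complex, Complex.ofReal_re, mul_comm]

lemma beta_integral {a b : ℝ} (ha : -1 < a) (hb : -1 < b) :
    ∫ s in (0 : ℝ)..1, (1 - s) ^ a * s ^ b = ProbabilityTheory.beta (b + 1) (a + 1) := by
  rw [ProbabilityTheory.beta_eq_betaIntegralReal _ _ (by linarith) (by linarith),
    Complex.betaIntegral]
  have : ∀ s ∈ uIcc (0 : ℝ) 1, (s : ℂ) ^ (((b + 1 : ℝ) : ℂ) - 1) *
      (1 - (s : ℂ)) ^ (((a + 1 : ℝ) : ℂ) - 1) = (((1 - s) ^ a * s ^ b : ℝ) : ℂ) := by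
    intro x hx
    rw [uIcc_of_le zero_le_one] at hx
    have e1 : ((b + 1 : ℝ) : ℂ) - 1 = (b : ℝ) := by push_cast; ring
    have e2 : ((a + 1 : ℝ) : ℂ) - 1 = (a : ℝ) := by push_cast; ring
    have e3 : (1 : ℂ) - (x : ℂ) = ((1 - x : ℝ) : ℂ) := by push_cast; ring
    rw [e1, e2, e3, ← Complex.ofReal_cpow hx.1, ← Complex.ofReal_cpow (by linarith [hx.2]),
      ← Complex.ofReal_mul, mul_comm]
  rw [intervalIntegral.integral_congr this, intervalIntegral.integral_ofReal, Complex.ofReal_re]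

lemma intervalIntegrable_beta_mul_rpow {a b : ℝ} (ha : -1 < a) (hb : -1 < b) (c : ℝ) {q : ℝ}
    (hq : 1 < q) :
    IntervalIntegrable (fun s : ℝ => (1 - s) ^ a * s ^ b * (q - s) ^ c) volume 0 1 := by
  refine (beta_intervalIntegrable ha hb).mul_continuousOn ?_
  refine (continuousOn_const.sub continuousOn_id).rpow_const fun s hs => Or.inl ?_
  rw [uIcc_of_le zero_le_one] at hs
  exact (show 0 < q - s by linarith [hs.2]).ne'

/-- The Möbius substitution `s = q v / (v + q - 1)`: when the exponents of `1 - s`, `s` and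
`q - s` add up to `-2`, the hypergeometric integral reduces to a Beta integral. -/
lemma integral_beta_mul_rpow {a b c q : ℝ} (ha : -1 < a) (hb : -1 < b) (habc : a + b + c = -2)
    (hq : 1 < q) :
    ∫ s in (0 : ℝ)..1, (1 - s) ^ a * s ^ b * (q - s) ^ c =
      q ^ (b + c + 1) * (q - 1) ^ (a + c + 1) * ProbabilityTheory.beta (b + 1) (a + 1) := by
  have hq0 : 0 < q := by linarith
  have hq1 : 0 < q - 1 := by linarith
  set φ : ℝ → ℝ := fun v => q * v / (v + (q - 1)) with hφ
  have hden {v : ℝ} (hv : v ∈ Icc (0 : ℝ) 1) : 0 < v + (q - 1) := by linarith [hv.1]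
  have hcont : ContinuousOn φ (Icc 0 1) :=
    ContinuousOn.div (by fun_prop) (by fun_prop) fun v hv => (hden hv).ne'
  have hmaps : φ '' Icc 0 1 ⊆ Icc 0 1 := by
    rintro _ ⟨v, hv, rfl⟩
    refine ⟨div_nonneg (mul_nonneg hq0.le hv.1) (hden hv).le, (div_le_one (hden hv)).2 ?_⟩
    nlinarith [hv.2]
  have hmaps' : φ '' Ioo 0 1 ⊆ Ioo 0 1 := by
    rintro _ ⟨v, hv, rfl⟩
    have := hden (Ioo_subset_Icc_self hv)
    refine ⟨div_pos (mul_pos hq0 hv.1) this, (div_lt_one this).2 ?_⟩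
    nlinarith [hv.2]
  have key : ∀ v ∈ Ioo (0 : ℝ) 1, (1 - φ v) ^ a * φ v ^ b * (q - φ v) ^ c *
      (q * (q - 1) / (v + (q - 1)) ^ 2) =
      q ^ (b + c + 1) * (q - 1) ^ (a + c + 1) * ((1 - v) ^ a * v ^ b) := by
    intro v hv
    have hd := hden (Ioo_subset_Icc_self hv)
    have e1 : 1 - φ v = (q - 1) * (1 - v) / (v + (q - 1)) := by
      rw [hφ]; field_simp; ring
    have e2 : q - φ v = q * (q - 1) / (v + (q - 1)) := by
      rw [hφ]; field_simp; ring
    rw [e1, e2, hφ]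
    have hv1 : 0 < 1 - v := by linarith [hv.2]
    have e3 : (v + (q - 1)) ^ a * (v + (q - 1)) ^ b * (v + (q - 1)) ^ c *
        (v + (q - 1)) ^ 2 = 1 := by
      rw [← Real.rpow_add hd, ← Real.rpow_add hd, habc, Real.rpow_neg hd.le]
      norm_num
      field_simp
    have hda := (Real.rpow_pos_of_pos hd a).ne'
    have hdb := (Real.rpow_pos_of_pos hd b).ne'
    have hdc := (Real.rpow_pos_of_pos hd c).ne'
    rw [Real.div_rpow (by positivity) hd.le, Real.div_rpow (by nlinarith [hv.1]) hd.le,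
      Real.div_rpow (by positivity) hd.le, Real.mul_rpow hq1.le hv1.le,
      Real.mul_rpow hq0.le hv.1.le, Real.mul_rpow hq0.le hq1.le, Real.rpow_add_one hq0.ne',
      Real.rpow_add_one hq1.ne', Real.rpow_add hq0, Real.rpow_add hq1]
    calc _ = (q - 1) ^ a * (1 - v) ^ a * (q ^ b * v ^ b) * (q ^ c * (q - 1) ^ c) *
          (q * (q - 1)) / ((v + (q - 1)) ^ a * (v + (q - 1)) ^ b * (v + (q - 1)) ^ c *
        (v + (q - 1)) ^ 2) := by field_simp
      _ = _ := by
        rw [e3]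
        ring
  have hg1 : IntegrableOn (fun s : ℝ => (1 - s) ^ a * s ^ b * (q - s) ^ c) (Icc 0 1) := by
    rw [integrableOn_Icc_iff_integrableOn_Ioc]
    exact (intervalIntegrable_iff_integrableOn_Ioc_of_le zero_le_one).1
      (intervalIntegrable_beta_mul_rpow ha hb c hq)
  have hbeta : IntegrableOn (fun v : ℝ => (1 - v) ^ a * v ^ b) (Ioo 0 1) :=
    ((intervalIntegrable_iff_integrableOn_Ioc_of_le zero_le_one).1
      (beta_intervalIntegrable ha hb)).mono_set Ioo_subset_Ioc_self
  have hsub := intervalIntegral.integral_comp_mul_deriv''' (a := 0) (b := 1) (f := φ)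
    (f' := fun v => q * (q - 1) / (v + (q - 1)) ^ 2)
    (g := fun s => (1 - s) ^ a * s ^ b * (q - s) ^ c)
    (by rwa [uIcc_of_le zero_le_one])
    (by
      intro v hv
      rw [min_eq_left zero_le_one, max_eq_right zero_le_one] at hv
      have hd := hden (Ioo_subset_Icc_self hv)
      refine HasDerivAt.hasDerivWithinAt ?_
      refine (((hasDerivAt_id v).const_mul q).div ((hasDerivAt_id v).add_const (q - 1))
        hd.ne').congr_deriv ?_
      simp only [id]
      congr 1
      ring)
    (by
      rw [min_eq_left zero_le_one, max_eq_right zero_le_one]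
      refine ContinuousOn.mono ?_ hmaps'
      refine ContinuousOn.mul (ContinuousOn.mul ?_ ?_) ?_
      · exact (continuousOn_const.sub continuousOn_id).rpow_const fun s hs => Or.inl
          (show 0 < 1 - s by linarith [hs.2]).ne'
      · exact continuousOn_id.rpow_const fun s hs => Or.inl hs.1.ne'
      · exact (continuousOn_const.sub continuousOn_id).rpow_const fun s hs => Or.inl
          (show 0 < q - s by linarith [hs.2]).ne')
    (by
      rw [uIcc_of_le zero_le_one]
      exact hg1.mono_set hmaps)
    (by
      rw [uIcc_of_le zero_le_one, integrableOn_Icc_iff_integrableOn_Ioo]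
      exact IntegrableOn.congr_fun (hbeta.const_mul _) (fun v hv => (key v hv).symm) measurableSet_Ioo)
  have h0 : φ 0 = 0 := by simp [hφ]
  have h1 : φ 1 = 1 := by
    rw [hφ]
    field_simp
    ring
  rw [h0, h1] at hsub
  rw [← hsub, ← beta_integral ha hb, ← intervalIntegral.integral_const_mul,
    intervalIntegral.integral_of_le zero_le_one, intervalIntegral.integral_of_le zero_le_one,
    integral_Ioc_eq_integral_Ioo, integral_Ioc_eq_integral_Ioo]
  exact setIntegral_congr_fun measurableSet_Ioo key

/-- When the exponents add up to `-1`, differentiation in `q` lowers their sum to `-2`, so that the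
derivative of the hypergeometric integral is elementary. -/
lemma hasDerivAt_integral_beta_mul_rpow {a b c q : ℝ} (ha : -1 < a) (hb : -1 < b)
    (hc : c ≤ 1) (habc : a + b + c = -1) (hq : 1 < q) :
    HasDerivAt (fun q : ℝ => ∫ s in (0 : ℝ)..1, (1 - s) ^ a * s ^ b * (q - s) ^ c)
      (c * (q ^ (b + c) * (q - 1) ^ (a + c) * ProbabilityTheory.beta (b + 1) (a + 1))) q := by
  have hI := beta_intervalIntegrable ha hb
  have hr : 0 < (q - 1) / 2 := by linarith
  have hmem {t s : ℝ} (ht : t ∈ Metric.ball q ((q - 1) / 2)) (hs : s ∈ Ioc (0 : ℝ) 1) :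
      (q - 1) / 2 < t - s := by
    rw [Metric.mem_ball, Real.dist_eq, abs_lt] at ht
    linarith [ht.1, hs.2]
  have hmeas (a b c t : ℝ) : Measurable fun s : ℝ => (1 - s) ^ a * s ^ b * (t - s) ^ c := by
    fun_prop
  have := (intervalIntegral.hasDerivAt_integral_of_dominated_loc_of_deriv_le
    (μ := volume) (a := 0) (b := 1)
    (F := fun q s : ℝ => (1 - s) ^ a * s ^ b * (q - s) ^ c)
    (F' := fun q s : ℝ => c * ((1 - s) ^ a * s ^ b * (q - s) ^ (c - 1)))
    (bound := fun s => |c| * ((1 - s) ^ a * s ^ b * ((q - 1) / 2) ^ (c - 1)))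
    (Metric.ball_mem_nhds q hr)
    (Filter.Eventually.of_forall fun t => (hmeas a b c t).aestronglyMeasurable)
    (intervalIntegrable_beta_mul_rpow ha hb c hq)
    ((hmeas a b (c - 1) q).const_mul c).aestronglyMeasurable
    (Filter.Eventually.of_forall fun s hs t ht => by
      rw [uIoc_of_le zero_le_one] at hs
      have h1 := hmem ht hs
      have hn : 0 ≤ (1 - s) ^ a * s ^ b :=
        mul_nonneg (Real.rpow_nonneg (by linarith [hs.2]) _) (Real.rpow_nonneg hs.1.le _)
      rw [norm_mul, norm_mul, Real.norm_eq_abs c, Real.norm_of_nonneg hn,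
        Real.norm_of_nonneg (Real.rpow_nonneg (by linarith) _)]
      exact mul_le_mul_of_nonneg_left (mul_le_mul_of_nonneg_left
        (Real.rpow_le_rpow_of_nonpos hr h1.le (sub_nonpos.2 hc)) hn) (abs_nonneg c))
    ((hI.mul_const _).const_mul _)
    (Filter.Eventually.of_forall fun s hs t ht => by
      rw [uIoc_of_le zero_le_one] at hs
      have h1 := hmem ht hs
      have h2 := (((hasDerivAt_id t).sub_const s).rpow_const (p := c)
        (Or.inl (by simp only [id]; linarith))).const_mul ((1 - s) ^ a * s ^ b)
      refine h2.congr_deriv ?_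
      simp only [id]
      ring)).2
  refine this.congr_deriv ?_
  rw [intervalIntegral.integral_const_mul,
    integral_beta_mul_rpow (c := c - 1) ha hb (by linarith) hq]
  ring_nf

/-- The left half of the Abel operator on the Jacobi weight, as a hypergeometric integral. -/
lemma integral_posPow_mul_jacWeight {σ μ ν : ℝ} (hσ0 : 0 < σ) (hσ1 : σ < 1) (hν : -1 < ν)
    (hadd : μ + ν = -σ) {x : ℝ} (hx : x ∈ Lam) :
    IntegrableOn (fun y => posPow (σ - 1) (x - y) * jacWeight μ ν y) Lam ∧
    ∫ y in Lam, posPow (σ - 1) (x - y) * jacWeight μ ν y =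
      ∫ s in (0 : ℝ)..1, (1 - s) ^ (σ - 1) * s ^ ν * (2 / (1 + x) - s) ^ μ := by
  have ha : 0 < 1 + x := by linarith [hx.1]
  have hq : 1 < 2 / (1 + x) := (one_lt_div ha).2 (by linarith [hx.2])
  have key : ∀ s ∈ Ioo (0 : ℝ) 1, (1 - s) ^ (σ - 1) * s ^ ν * (2 / (1 + x) - s) ^ μ =
      (1 + x) * (posPow (σ - 1) (x - ((1 + x) * s + -1)) *
        jacWeight μ ν ((1 + x) * s + -1)) := by
    intro s hs
    have h1 : 0 < 1 - s := by linarith [hs.2]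
    have h2 : 0 < 2 / (1 + x) - s := by linarith
    have e1 : x - ((1 + x) * s + -1) = (1 + x) * (1 - s) := by ring
    have e2 : 1 - ((1 + x) * s + -1) = (1 + x) * (2 / (1 + x) - s) := by field_simp; ring
    have e3 : 1 + ((1 + x) * s + -1) = (1 + x) * s := by ring
    rw [jacWeight, e1, e2, e3, posPow_of_pos (mul_pos ha h1), Real.mul_rpow ha.le h1.le,
      Real.mul_rpow ha.le h2.le, Real.mul_rpow ha.le hs.1.le]
    have e4 : (1 + x) * (1 + x) ^ (σ - 1) * (1 + x) ^ μ * (1 + x) ^ ν = 1 := by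
      rw [← Real.rpow_one_add' ha.le (by linarith), ← Real.rpow_add ha, ← Real.rpow_add ha,
        show 1 + (σ - 1) + μ + ν = 0 by linarith, Real.rpow_zero]
    linear_combination (-(1 - s) ^ (σ - 1) * s ^ ν * (2 / (1 + x) - s) ^ μ) * e4
  have hG := intervalIntegrable_beta_mul_rpow (a := σ - 1) (by linarith) hν μ hq
  have hlim : (1 + x) * 0 + -1 = -1 ∧ (1 + x) * 1 + -1 = x := ⟨by ring, by ring⟩
  have hout : ∀ y ∈ Lam \ Ioo (-1) x, posPow (σ - 1) (x - y) * jacWeight μ ν y = 0 := by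
    rintro y ⟨hy1, hy2⟩
    have : x ≤ y := by
      by_contra h
      exact hy2 ⟨hy1.1, not_le.1 h⟩
    rw [posPow_of_nonpos (by linarith) (by linarith), zero_mul]
  have hsub : Ioo (-1) x ⊆ Lam := Ioo_subset_Ioo_right hx.2.le
  constructor
  · have h1 : IntervalIntegrable (fun y => posPow (σ - 1) (x - y) * jacWeight μ ν y)
        volume (-1) x := by
      have h2 : IntervalIntegrable (fun s => posPow (σ - 1) (x - ((1 + x) * s + -1)) *
        jacWeight μ ν ((1 + x) * s + -1)) volume 0 1 := by
        rw [intervalIntegrable_iff_integrableOn_Ioo_of_le zero_le_one] at hG ⊢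
        refine IntegrableOn.congr_fun (hG.const_mul (1 + x)⁻¹) (fun s hs => ?_) measurableSet_Ioo
        simp only [key s hs]
        field_simp
      have h3 : IntervalIntegrable (fun t => posPow (σ - 1) (x - (t + -1)) *
          jacWeight μ ν (t + -1)) volume 0 (1 + x) := by
        rw [← IntervalIntegrable.comp_mul_left_iff ha.ne', zero_div, div_self ha.ne']
        exact h2
      have h4 := h3.comp_add_right 1
      simpa using h4
    refine ((intervalIntegrable_iff_integrableOn_Ioo_of_le hx.1.le).1 h1).of_forall_sdiff_eq_zero
      measurableSet_Ioo hout
  · rw [setIntegral_eq_of_subset_of_forall_sdiff_eq_zero measurableSet_Ioo hsub hout,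
      ← integral_Ioc_eq_integral_Ioo, ← intervalIntegral.integral_of_le hx.1.le]
    have h1 := intervalIntegral.mul_integral_comp_mul_add (a := 0) (b := 1)
      (f := fun y => posPow (σ - 1) (x - y) * jacWeight μ ν y) (c := 1 + x) (d := -1)
    rw [hlim.1, hlim.2] at h1
    rw [← h1, ← intervalIntegral.integral_const_mul,
      intervalIntegral.integral_of_le zero_le_one, intervalIntegral.integral_of_le zero_le_one,
      integral_Ioc_eq_integral_Ioo, integral_Ioc_eq_integral_Ioo]
    exact setIntegral_congr_fun measurableSet_Ioo fun s hs => (key s hs).symm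

lemma jacWeight_neg (μ ν y : ℝ) : jacWeight μ ν (-y) = jacWeight ν μ y := by
  rw [jacWeight, jacWeight, sub_neg_eq_add, ← sub_eq_add_neg, mul_comm]

lemma jacWeight_pos {μ ν x : ℝ} (hx : x ∈ Lam) : 0 < jacWeight μ ν x :=
  mul_pos (Real.rpow_pos_of_pos (by linarith [hx.2]) _)
    (Real.rpow_pos_of_pos (by linarith [hx.1]) _)

lemma integrableOn_Lam_comp_neg {f : ℝ → ℝ} (hf : IntegrableOn f Lam) :
    IntegrableOn (fun y => f (-y)) Lam := by
  have h1 := (intervalIntegrable_iff_integrableOn_Ioo_of_le (by norm_num)).2 hf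
  have h2 := (IntervalIntegrable.comp_sub_left h1 0).symm
  simp only [zero_sub, neg_neg] at h2
  exact (intervalIntegrable_iff_integrableOn_Ioo_of_le (by norm_num)).1 h2

lemma integral_Lam_comp_neg (f : ℝ → ℝ) : ∫ y in Lam, f (-y) = ∫ y in Lam, f y := by
  rw [← integral_Ioc_eq_integral_Ioo, ← integral_Ioc_eq_integral_Ioo,
    ← intervalIntegral.integral_of_le (by norm_num),
    ← intervalIntegral.integral_of_le (by norm_num), intervalIntegral.integral_comp_neg, neg_neg]

lemma integral_posPow_neg_mul_jacWeight {σ μ ν : ℝ} (hσ0 : 0 < σ) (hσ1 : σ < 1) (hμ : -1 < μ)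
    (hadd : μ + ν = -σ) {x : ℝ} (hx : x ∈ Lam) :
    IntegrableOn (fun y => posPow (σ - 1) (-(x - y)) * jacWeight μ ν y) Lam ∧
    ∫ y in Lam, posPow (σ - 1) (-(x - y)) * jacWeight μ ν y =
      ∫ s in (0 : ℝ)..1, (1 - s) ^ (σ - 1) * s ^ μ * (2 / (1 - x) - s) ^ ν := by
  have hx' : -x ∈ Lam := ⟨by linarith [hx.2], by linarith [hx.1]⟩
  have h := integral_posPow_mul_jacWeight (μ := ν) (ν := μ) hσ0 hσ1 hμ (by linarith) hx'
  have e (y : ℝ) : posPow (σ - 1) (-(x - y)) * jacWeight μ ν y =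
      posPow (σ - 1) (-x - -y) * jacWeight ν μ (-y) := by
    rw [jacWeight_neg, neg_sub, neg_sub_neg]
  simp only [e]
  refine ⟨integrableOn_Lam_comp_neg h.1, ?_⟩
  rw [integral_Lam_comp_neg (fun y => posPow (σ - 1) (-x - y) * jacWeight ν μ y), h.2,
    ← sub_eq_add_neg]

lemma integral_beta_mul_rpow_pos {a b c q : ℝ} (ha : -1 < a) (hb : -1 < b) (hq : 1 < q) :
    0 < ∫ s in (0 : ℝ)..1, (1 - s) ^ a * s ^ b * (q - s) ^ c := by
  refine intervalIntegral.intervalIntegral_pos_of_pos_on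
    (intervalIntegrable_beta_mul_rpow ha hb c hq) (fun s hs => ?_) zero_lt_one
  exact mul_pos (mul_pos (Real.rpow_pos_of_pos (by linarith [hs.2]) _)
    (Real.rpow_pos_of_pos hs.1 _)) (Real.rpow_pos_of_pos (by linarith [hs.2]) _)

/-- The factors of the derivative of the left half, at `a = 1 + x` and `b = 1 - x`, collapse to a
product that is symmetric under reflection. -/
lemma two_div_rpow_mul {σ μ ν a b : ℝ} (ha : 0 < a) (hb : 0 < b) (hab : a + b = 2)
    (hadd : μ + ν = -σ) :
    (2 / a) ^ (ν + μ) * (2 / a - 1) ^ (σ - 1 + μ) * (2 / a ^ 2) =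
      2 ^ (1 - σ) * a ^ (-1 - μ) * b ^ (-1 - ν) := by
  have e1 : 2 / a - 1 = b / a := by
    field_simp
    linarith
  have e2 : a ^ (-1 - μ) * a ^ (-σ) * a ^ (-1 - ν) * a ^ 2 = 1 := by
    rw [← Real.rpow_add ha, ← Real.rpow_add ha, show -1 - μ + -σ + (-1 - ν) = -2 by linarith,
      Real.rpow_neg ha.le]
    norm_num
    field_simp
  have h1 := (Real.rpow_pos_of_pos ha (-1 - μ)).ne'
  have h2 := (Real.rpow_pos_of_pos ha (-σ)).ne'
  have h3 := (Real.rpow_pos_of_pos ha (-1 - ν)).ne'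
  rw [e1, show σ - 1 + μ = -1 - ν by linarith, show ν + μ = -σ by linarith,
    Real.div_rpow (by norm_num) ha.le, Real.div_rpow hb.le ha.le,
    show (1 : ℝ) - σ = -σ + 1 by ring, Real.rpow_add_one (by norm_num)]
  field_simp
  linear_combination -e2

/-- The Jacobi weight belonging to `p` and `σ` is mapped to a positive constant: the derivatives
of the two halves are Beta integrals that cancel by the choice of the exponents. -/
lemma abelOp_jacWeight {p σ μ ν : ℝ} (h : AbelParams p σ μ ν) :
    ∃ K : ℝ, 0 < K ∧ ∀ x ∈ Lam,
      Integrable (fun y => abelKer p σ (x - y) * jacWeight μ ν y) lamMeasure ∧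
      abelOp p σ (jacWeight μ ν) x = K := by
  set L : ℝ → ℝ := fun q => ∫ s in (0 : ℝ)..1, (1 - s) ^ (σ - 1) * s ^ ν * (q - s) ^ μ with hL
  set R : ℝ → ℝ := fun q => ∫ s in (0 : ℝ)..1, (1 - s) ^ (σ - 1) * s ^ μ * (q - s) ^ ν with hR
  have hσ : -1 < σ - 1 := by linarith [h.σ_pos]
  have hval : ∀ x ∈ Lam,
      Integrable (fun y => abelKer p σ (x - y) * jacWeight μ ν y) lamMeasure ∧
      abelOp p σ (jacWeight μ ν) x = p * L (2 / (1 + x)) + (1 - p) * R (2 / (1 - x)) := by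
    intro x hx
    obtain ⟨i1, e1⟩ := integral_posPow_mul_jacWeight h.σ_pos h.σ_lt_one h.neg_one_lt_right
      h.add_eq hx
    obtain ⟨i2, e2⟩ := integral_posPow_neg_mul_jacWeight h.σ_pos h.σ_lt_one h.neg_one_lt_left
      h.add_eq hx
    have e (y : ℝ) : abelKer p σ (x - y) * jacWeight μ ν y =
        p * (posPow (σ - 1) (x - y) * jacWeight μ ν y) +
        (1 - p) * (posPow (σ - 1) (-(x - y)) * jacWeight μ ν y) := by
      rw [abelKer]
      ring
    simp only [abelOp, e]
    refine ⟨(Integrable.const_mul i1 p).add (Integrable.const_mul i2 (1 - p)), ?_⟩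
    rw [integral_add (Integrable.const_mul i1 p) (Integrable.const_mul i2 (1 - p)),
      integral_const_mul, integral_const_mul, e1, e2]
  have hderiv : ∀ x ∈ Lam, HasDerivAt
      (fun x => p * L (2 / (1 + x)) + (1 - p) * R (2 / (1 - x))) 0 x := by
    intro x hx
    have ha : 0 < 1 + x := by linarith [hx.1]
    have hb : 0 < 1 - x := by linarith [hx.2]
    have hq1 : 1 < 2 / (1 + x) := (one_lt_div ha).2 (by linarith)
    have hq2 : 1 < 2 / (1 - x) := (one_lt_div hb).2 (by linarith)
    have d1 : HasDerivAt (fun x : ℝ => 2 / (1 + x)) (-(2 / (1 + x) ^ 2)) x := by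
      refine ((hasDerivAt_const x (2 : ℝ)).div ((hasDerivAt_id x).const_add 1)
        ha.ne').congr_deriv ?_
      simp only [id]
      ring
    have d2 : HasDerivAt (fun x : ℝ => 2 / (1 - x)) (2 / (1 - x) ^ 2) x := by
      refine ((hasDerivAt_const x (2 : ℝ)).div ((hasDerivAt_id x).const_sub 1)
        hb.ne').congr_deriv ?_
      simp only [id]
      ring
    have g1 := hasDerivAt_integral_beta_mul_rpow (c := μ) hσ h.neg_one_lt_right
      (by linarith [h.μ_nonpos]) (by linarith [h.add_eq]) hq1
    have g2 := hasDerivAt_integral_beta_mul_rpow (c := ν) hσ h.neg_one_lt_left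
      (by linarith [h.ν_nonpos]) (by linarith [h.add_eq]) hq2
    refine (((g1.comp x d1).const_mul p).add ((g2.comp x d2).const_mul (1 - p))).congr_deriv ?_
    have t1 := two_div_rpow_mul (σ := σ) (μ := μ) (ν := ν) ha hb (by ring) h.add_eq
    have t2 := two_div_rpow_mul (σ := σ) (μ := ν) (ν := μ) hb ha (by ring)
      (by linarith [h.add_eq])
    have t3 := h.beta_eq
    rw [sub_add_cancel]
    linear_combination (-p * μ * ProbabilityTheory.beta (ν + 1) σ) * t1 +
      ((1 - p) * ν * ProbabilityTheory.beta (μ + 1) σ) * t2 -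
      (2 ^ (1 - σ) * (1 + x) ^ (-1 - μ) * (1 - x) ^ (-1 - ν)) * t3
  obtain ⟨K, hK⟩ := isOpen_Ioo.exists_is_const_of_deriv_eq_zero
    (convex_Ioo (-1 : ℝ) 1).isPreconnected
    (fun x hx => (hderiv x hx).differentiableAt.differentiableWithinAt)
    (fun x hx => (hderiv x hx).deriv)
  refine ⟨K, ?_, fun x hx => ⟨(hval x hx).1, (hval x hx).2.trans (hK x hx)⟩⟩
  rw [← hK 0 (by norm_num)]
  have p1 : 0 < L (2 / (1 + 0)) :=
    integral_beta_mul_rpow_pos hσ h.neg_one_lt_right (by norm_num)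
  have p2 : 0 < R (2 / (1 - 0)) :=
    integral_beta_mul_rpow_pos hσ h.neg_one_lt_left (by norm_num)
  rcases h.p_nonneg.eq_or_lt with h0 | h0
  · rw [← h0]
    linarith
  · have := mul_nonneg (sub_nonneg.2 h.p_le_one) p2.le
    have := mul_pos h0 p1
    linarith

lemma integrable_jacWeight {a b : ℝ} (ha : -1 < a) (hb : -1 < b) :
    Integrable (jacWeight a b) lamMeasure := by
  have h1 := beta_intervalIntegrable ha hb
  have h2 : IntervalIntegrable (fun t : ℝ => jacWeight a b (t + -1)) volume 0 2 := by
    rw [← IntervalIntegrable.comp_mul_left_iff (c := 2) (by norm_num), zero_div,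
      div_self (by norm_num)]
    rw [intervalIntegrable_iff_integrableOn_Ioo_of_le zero_le_one] at h1 ⊢
    refine IntegrableOn.congr_fun (Integrable.const_mul h1 (2 ^ a * 2 ^ b)) (fun s hs => ?_)
      measurableSet_Ioo
    rw [jacWeight, show 1 - (2 * s + -1) = 2 * (1 - s) by ring,
      show 1 + (2 * s + -1) = 2 * s by ring, Real.mul_rpow (by norm_num) (by linarith [hs.2]),
      Real.mul_rpow (by norm_num) hs.1.le]
    ring
  have h3 := h2.comp_add_right 1
  simp only [add_neg_cancel_right] at h3
  norm_num at h3
  exact (intervalIntegrable_iff_integrableOn_Ioo_of_le (by norm_num)).1 h3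

end

end TwoSidedRL

namespace TwoSidedRL

noncomputable section

/-! ### Triangular operators on polynomials -/

open Polynomial in
/-- `A` preserves the degree filtration of `ℝ[X]`, with `d n` as the factor by which it acts on
the leading coefficient in degree `n`. -/
def Triangular (A : ℝ[X] →ₗ[ℝ] ℝ[X]) (d : ℕ → ℝ) : Prop :=
  ∀ n, A (X ^ n) - d n • X ^ n ∈ degreeLT ℝ n

namespace Triangular

open Polynomial

variable {A B : ℝ[X] →ₗ[ℝ] ℝ[X]} {d e : ℕ → ℝ}

lemma X_pow_mem {k n : ℕ} (h : k < n) : (X ^ k : ℝ[X]) ∈ degreeLT ℝ n := by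
  rw [mem_degreeLT, degree_X_pow]
  exact_mod_cast h

lemma map_mem_degreeLT (hA : Triangular A d) {n : ℕ} {r : ℝ[X]} (hr : r ∈ degreeLT ℝ n) :
    A r ∈ degreeLT ℝ n := by
  rw [degreeLT_eq_span_X_pow] at hr
  induction hr using Submodule.span_induction with
  | mem x hx =>
    simp only [Finset.coe_image, Finset.coe_range, mem_image, mem_Iio] at hx
    obtain ⟨k, hk, rfl⟩ := hx
    have h1 := degreeLT_mono hk.le (hA k)
    have h2 := Submodule.add_mem _ h1 (Submodule.smul_mem _ (d k) (X_pow_mem hk))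
    rwa [sub_add_cancel] at h2
  | zero => rw [map_zero]; exact Submodule.zero_mem _
  | add x y _ _ hx hy => rw [map_add]; exact Submodule.add_mem _ hx hy
  | smul a x _ hx => rw [map_smul]; exact Submodule.smul_mem _ _ hx

lemma comp (hA : Triangular A d) (hB : Triangular B e) :
    Triangular (A ∘ₗ B) fun n => d n * e n := by
  intro n
  have h1 := hA.map_mem_degreeLT (hB n)
  have h2 := Submodule.smul_mem _ (e n) (hA n)
  have := Submodule.add_mem _ h1 h2
  rwa [map_sub, map_smul, smul_sub, sub_add_sub_cancel, smul_smul, mul_comm] at this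

lemma add (hA : Triangular A d) (hB : Triangular B e) :
    Triangular (A + B) fun n => d n + e n := by
  intro n
  have := Submodule.add_mem _ (hA n) (hB n)
  rwa [sub_add_sub_comm, ← add_smul] at this

lemma smul_id (c : ℝ) : Triangular (c • LinearMap.id) fun _ => c := by
  intro n
  simp

lemma sub_coeff_smul_mem_degreeLT (n : ℕ) {r : ℝ[X]} (hr : r ∈ degreeLT ℝ (n + 1)) :
    r - r.coeff n • X ^ n ∈ degreeLT ℝ n := by
  rw [Polynomial.mem_degreeLT, degree_lt_iff_coeff_zero] at hr ⊢
  intro m hm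
  rw [coeff_sub, coeff_smul, coeff_X_pow, smul_eq_mul]
  rcases hm.eq_or_lt with rfl | hm
  · simp
  · rw [hr m hm, if_neg hm.ne']
    simp

lemma exists_degreeLT (r : ℝ[X]) : ∃ n, r ∈ degreeLT ℝ n :=
  ⟨r.natDegree + 1, by
    rw [Polynomial.mem_degreeLT]
    exact degree_le_natDegree.trans_lt (by exact_mod_cast Nat.lt_succ_self _)⟩

lemma surjective (hA : Triangular A d) (hd : ∀ n, d n ≠ 0) : Function.Surjective A := by
  have key : ∀ n, ∀ w ∈ degreeLT ℝ n, ∃ r, A r = w := by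
    intro n
    induction n with
    | zero =>
      intro w hw
      refine ⟨0, ?_⟩
      rw [Polynomial.mem_degreeLT, Nat.cast_zero, Nat.WithBot.lt_zero_iff, degree_eq_bot] at hw
      rw [hw, map_zero]
    | succ n ih =>
      intro w hw
      have h1 := sub_coeff_smul_mem_degreeLT n hw
      have h2 := Submodule.smul_mem _ (w.coeff n * (d n)⁻¹) (hA n)
      obtain ⟨r, hr⟩ := ih _ (Submodule.sub_mem _ h1 h2)
      refine ⟨r + (w.coeff n * (d n)⁻¹) • X ^ n, ?_⟩
      rw [map_add, hr, map_smul, smul_sub, smul_smul, inv_mul_cancel_right₀ (hd n)]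
      abel
  intro w
  obtain ⟨n, hn⟩ := exists_degreeLT w
  exact key n w hn

/-- Orthogonal polynomials of a positive functional. -/
lemma exists_orthogonal {Φ : ℝ[X] →ₗ[ℝ] ℝ} (hΦ : ∀ q, q ≠ 0 → 0 < Φ (q * q)) (n : ℕ) :
    ∃ r ∈ degreeLT ℝ n, ∀ s ∈ degreeLT ℝ n, Φ ((X ^ n - r) * s) = 0 := by
  let G : degreeLT ℝ n →ₗ[ℝ] Module.Dual ℝ (degreeLT ℝ n) :=
    (LinearMap.mk₂ ℝ (fun r s : ℝ[X] => Φ (r * s))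
      (fun _ _ _ => by rw [add_mul, map_add])
      (fun _ _ _ => by rw [smul_mul_assoc, map_smul])
      (fun _ _ _ => by rw [mul_add, map_add])
      (fun _ _ _ => by rw [mul_smul_comm, map_smul])).compl₁₂
      (degreeLT ℝ n).subtype (degreeLT ℝ n).subtype
  have hG (r s : degreeLT ℝ n) : G r s = Φ ((r : ℝ[X]) * s) := rfl
  have : FiniteDimensional ℝ (degreeLT ℝ n) :=
    FiniteDimensional.of_injective (degreeLTEquiv ℝ n).toLinearMap (degreeLTEquiv ℝ n).injective
  have hinj : Function.Injective G := by
    rw [injective_iff_map_eq_zero]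
    intro r hr
    by_contra hne
    have h1 := hΦ r (fun h => hne (Subtype.ext h))
    rw [← hG, hr] at h1
    exact lt_irrefl _ h1
  have hsurj : Function.Surjective G :=
    (LinearMap.injective_iff_surjective_of_finrank_eq_finrank
      (Subspace.dual_finrank_eq (K := ℝ) (V := degreeLT ℝ n)).symm).1 hinj
  obtain ⟨r, hr⟩ := hsurj ((Φ ∘ₗ LinearMap.mulLeft ℝ (X ^ n)) ∘ₗ (degreeLT ℝ n).subtype)
  refine ⟨r, r.2, fun s hs => ?_⟩
  have := LinearMap.congr_fun hr ⟨s, hs⟩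
  rw [hG] at this
  simp only [LinearMap.comp_apply, LinearMap.mulLeft_apply, Submodule.subtype_apply] at this
  rw [sub_mul, map_sub, this, sub_self]

/-- A triangular operator that is symmetric for a positive functional and has nonnegative diagonal
is positive semidefinite: it is diagonal in the basis of orthogonal polynomials. -/
lemma nonneg_of_symm (hA : Triangular A d) (hd : ∀ n, 0 ≤ d n) {Φ : ℝ[X] →ₗ[ℝ] ℝ}
    (hΦ : ∀ q, q ≠ 0 → 0 < Φ (q * q)) (hsymm : ∀ r s, Φ (A r * s) = Φ (r * A s)) (r : ℝ[X]) :
    0 ≤ Φ (A r * r) := by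
  have key : ∀ n, ∀ r ∈ degreeLT ℝ n, 0 ≤ Φ (A r * r) := by
    intro n
    induction n with
    | zero =>
      intro w hw
      rw [Polynomial.mem_degreeLT, Nat.cast_zero, Nat.WithBot.lt_zero_iff, degree_eq_bot] at hw
      rw [hw, mul_zero, map_zero]
    | succ n ih =>
      intro r hr
      obtain ⟨r₀, hr₀, horth⟩ := exists_orthogonal hΦ n
      set P := X ^ n - r₀ with hP
      set a := r.coeff n
      have h1 : r - a • P ∈ degreeLT ℝ n := by
        have := Submodule.add_mem _ (sub_coeff_smul_mem_degreeLT n hr) (Submodule.smul_mem _ a hr₀)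
        rwa [show r - a • X ^ n + a • r₀ = r - a • P by rw [hP, smul_sub]; abel] at this
      set s := r - a • P with hs
      -- `A P - d n • P` has lower degree, hence is orthogonal to the monic orthogonal polynomial `P`.
      have hAP : A P - d n • P ∈ degreeLT ℝ n := by
        have := Submodule.add_mem _ (Submodule.sub_mem _ (hA n) (hA.map_mem_degreeLT hr₀))
          (Submodule.smul_mem _ (d n) hr₀)
        rwa [show A (X ^ n) - d n • X ^ n - A r₀ + d n • r₀ = A P - d n • P by
          rw [hP, smul_sub, map_sub]; abel] at this
      have e1 : Φ (A P * P) = d n * Φ (P * P) := by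
        have := horth _ hAP
        rw [mul_sub, map_sub, mul_smul_comm, map_smul, sub_eq_zero, smul_eq_mul] at this
        rw [mul_comm, this]
      have e2 : Φ (A P * s) = 0 := by rw [hsymm]; exact horth _ (hA.map_mem_degreeLT h1)
      have e3 : Φ (A s * P) = 0 := by rw [mul_comm]; exact horth _ (hA.map_mem_degreeLT h1)
      have e4 : r = a • P + s := by rw [hs]; abel
      have hPP : 0 ≤ Φ (P * P) := by
        by_cases h0 : P = 0
        · rw [h0, mul_zero, map_zero]
        · exact (hΦ P h0).le
      rw [e4, map_add, map_smul]
      have : Φ ((a • A P + A s) * (a • P + s)) =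
          a ^ 2 * Φ (A P * P) + a * Φ (A P * s) + a * Φ (A s * P) + Φ (A s * s) := by
        simp only [add_mul, mul_add, smul_mul_assoc, mul_smul_comm, map_add, map_smul, smul_eq_mul]
        ring
      rw [this, e1, e2, e3]
      have := mul_nonneg (sq_nonneg a) (mul_nonneg (hd n) hPP)
      linarith [ih s h1]
  obtain ⟨n, hn⟩ := exists_degreeLT r
  exact key n r hn

end Triangular

/-! ### The Abel operator on weighted polynomials -/

open Polynomial

/-- The polynomial antiderivative without constant term. -/
def polyAntideriv : ℝ[X] →ₗ[ℝ] ℝ[X] :=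
  lsum fun n => (monomial (n + 1)) ∘ₗ (((n : ℝ) + 1)⁻¹ • LinearMap.id)

lemma polyAntideriv_X_pow (n : ℕ) :
    polyAntideriv (X ^ n) = ((n : ℝ) + 1)⁻¹ • X ^ (n + 1) := by
  rw [polyAntideriv, lsum_apply, ← monomial_one_right_eq_X_pow, sum_monomial_index _ _ (by simp)]
  simp [← monomial_one_right_eq_X_pow, smul_monomial]

lemma derivative_polyAntideriv (q : ℝ[X]) : derivative (polyAntideriv q) = q := by
  induction q using Polynomial.induction_on' with
  | add p q hp hq => rw [map_add, map_add, hp, hq]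
  | monomial n a =>
    rw [← mul_one a, ← smul_eq_mul, ← smul_monomial, monomial_one_right_eq_X_pow, map_smul,
      polyAntideriv_X_pow, map_smul, map_smul, derivative_X_pow]
    have : (n : ℝ) + 1 ≠ 0 := by positivity
    congr 1
    rw [Nat.add_sub_cancel, smul_eq_C_mul, ← mul_assoc, ← C_mul]
    push_cast
    rw [inv_mul_cancel₀ this, C_1, one_mul]

lemma polyAntideriv_mem_degreeLT {n : ℕ} {r : ℝ[X]} (hr : r ∈ degreeLT ℝ n) :
    polyAntideriv r ∈ degreeLT ℝ (n + 1) := by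
  rw [degreeLT_eq_span_X_pow] at hr
  induction hr using Submodule.span_induction with
  | mem x hx =>
    simp only [Finset.coe_image, Finset.coe_range, mem_image, mem_Iio] at hx
    obtain ⟨k, hk, rfl⟩ := hx
    rw [polyAntideriv_X_pow]
    exact Submodule.smul_mem _ _ (Triangular.X_pow_mem (by omega))
  | zero => rw [map_zero]; exact Submodule.zero_mem _
  | add x y _ _ hx hy => rw [map_add]; exact Submodule.add_mem _ hx hy
  | smul a x _ hx => rw [map_smul]; exact Submodule.smul_mem _ _ hx

lemma X_mul_mem_degreeLT {n : ℕ} {r : ℝ[X]} (hr : r ∈ degreeLT ℝ n) :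
    X * r ∈ degreeLT ℝ (n + 1) := by
  rw [mem_degreeLT, degree_lt_iff_coeff_zero] at hr ⊢
  intro m hm
  obtain ⟨k, rfl⟩ : ∃ k, m = k + 1 := ⟨m - 1, by omega⟩
  rw [coeff_X_mul]
  exact hr k (by omega)

lemma integral_eval (q : ℝ[X]) (a b : ℝ) :
    ∫ x in a..b, q.eval x = (polyAntideriv q).eval b - (polyAntideriv q).eval a := by
  refine intervalIntegral.integral_eq_sub_of_hasDerivAt
    (f := fun x => (polyAntideriv q).eval x) (fun x _ => ?_)
    (q.continuous.intervalIntegrable _ _)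
  have := (polyAntideriv q).hasDerivAt x
  rwa [derivative_polyAntideriv] at this

lemma exists_eval_bound (q : ℝ[X]) : ∃ K, 0 ≤ K ∧ ∀ x ∈ Lam, ‖q.eval x‖ ≤ K := by
  obtain ⟨K, hK⟩ := isCompact_Icc.exists_bound_of_continuousOn
    (q.continuous.continuousOn (s := Icc (-1 : ℝ) 1))
  exact ⟨K, (norm_nonneg _).trans (hK 0 (by norm_num)), fun x hx => hK x (Ioo_subset_Icc_self hx)⟩

lemma integrable_mul_eval {f : ℝ → ℝ} (hf : Integrable f lamMeasure) (q : ℝ[X]) :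
    Integrable (fun x => f x * q.eval x) lamMeasure := by
  obtain ⟨K, -, hK⟩ := exists_eval_bound q
  refine hf.mul_bdd (c := K) q.continuous.aestronglyMeasurable ?_
  filter_upwards [ae_restrict_mem measurableSet_Ioo] with x hx
  exact hK x hx

lemma integrable_jacWeight_mul_eval {a b : ℝ} (ha : -1 < a) (hb : -1 < b) (q : ℝ[X]) :
    Integrable (fun x => jacWeight a b x * q.eval x) lamMeasure :=
  integrable_mul_eval (integrable_jacWeight ha hb) q

/-- The leading coefficients of the Abel operator on weighted monomials, relative to the one in
degree zero. -/
def abelEig (σ : ℝ) (n : ℕ) : ℝ := ∏ k ∈ Finset.range n, (1 - σ / (k + 1))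

lemma abelEig_succ (σ : ℝ) (n : ℕ) : abelEig σ (n + 1) = abelEig σ n * (1 - σ / (n + 1)) :=
  Finset.prod_range_succ _ _

lemma abelEig_pos {σ : ℝ} (hσ1 : σ < 1) (n : ℕ) : 0 < abelEig σ n := by
  refine Finset.prod_pos fun k _ => sub_pos.2 ?_
  rw [div_lt_one (by positivity)]
  have : (0 : ℝ) ≤ k := k.cast_nonneg
  linarith

/-- The products decay no faster than `1 / n`, since `n * abelEig σ n` is nondecreasing in `n`. -/
lemma le_mul_abelEig {σ : ℝ} (hσ1 : σ < 1) (n : ℕ) :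
    1 - σ ≤ (n + 1) * abelEig σ (n + 1) := by
  induction n with
  | zero => simp [abelEig]
  | succ n ih =>
    refine ih.trans ?_
    rw [abelEig_succ σ (n + 1)]
    have hp := abelEig_pos hσ1 (n + 1)
    have : (n : ℝ) + 1 ≤ (n + 1 + 1) * (1 - σ / (n + 1 + 1)) := by
      have h2 : (0 : ℝ) < n + 1 + 1 := by positivity
      rw [mul_sub, mul_one, mul_div_cancel₀ _ h2.ne']
      linarith
    push_cast
    nlinarith

/-- The Abel operator maps the Jacobi weight times a polynomial to a polynomial of the same
degree, with explicit leading coefficients: if `ω x ^ n` is mapped to `t`, then `ω x ^ (n + 1)` is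
mapped to `x t - σ ∫ t` plus a constant, which multiplies the leading coefficient by
`1 - σ / (n + 1)`. -/
lemma exists_polyOp {p σ μ ν : ℝ} (h : AbelParams p σ μ ν) :
    ∃ K : ℝ, 0 < K ∧ ∃ T : ℝ[X] →ₗ[ℝ] ℝ[X], Triangular T (fun n => K * abelEig σ n) ∧
      ∀ q : ℝ[X], abelOp p σ (fun y => jacWeight μ ν y * q.eval y) =ᵐ[lamMeasure]
        fun x => (T q).eval x := by
  obtain ⟨K, hK, hKv⟩ := abelOp_jacWeight h
  have hw (n : ℕ) : Integrable (fun y => jacWeight μ ν y * y ^ n) lamMeasure := by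
    have := integrable_jacWeight_mul_eval h.neg_one_lt_left h.neg_one_lt_right (X ^ n)
    simpa using this
  have step : ∀ n : ℕ, ∃ t : ℝ[X], t - (K * abelEig σ n) • X ^ n ∈ degreeLT ℝ n ∧
      abelOp p σ (fun y => jacWeight μ ν y * y ^ n) =ᵐ[lamMeasure] fun x => t.eval x := by
    intro n
    induction n with
    | zero =>
      refine ⟨C K, ?_, ?_⟩
      · simp [abelEig, smul_eq_C_mul]
      · filter_upwards [ae_restrict_mem measurableSet_Ioo] with x hx
        simp only [pow_zero, mul_one, eval_C]
        exact (hKv x hx).2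
    | succ n ih =>
      obtain ⟨t, ht, hte⟩ := ih
      obtain ⟨c, hc⟩ := abelOp_id_mul h.σ_pos h.σ_lt_one h.p_nonneg h.p_le_one (hw n)
      refine ⟨X * t - σ • polyAntideriv t + C (σ * (polyAntideriv t).eval (-1) + c), ?_, ?_⟩
      · have h1 := X_mul_mem_degreeLT ht
        have h2 := Submodule.smul_mem _ σ (polyAntideriv_mem_degreeLT ht)
        have h3 : C (σ * (polyAntideriv t).eval (-1) + c) ∈ degreeLT ℝ (n + 1) := by
          rw [mem_degreeLT]
          exact degree_C_le.trans_lt (by exact_mod_cast Nat.succ_pos n)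
        have h4 := Submodule.add_mem _ (Submodule.sub_mem _ h1 h2) h3
        rw [map_sub, map_smul, polyAntideriv_X_pow] at h4
        convert h4 using 1
        rw [abelEig_succ]
        simp only [smul_eq_C_mul, C_mul, C_sub, C_1, div_eq_mul_inv]
        ring
      · filter_upwards [hc, hte, ae_restrict_mem measurableSet_Ioo] with x h1 h2 hx
        have h3 : ∫ ξ in (-1)..x, abelOp p σ (fun y => jacWeight μ ν y * y ^ n) ξ =
            ∫ ξ in (-1)..x, t.eval ξ := by
          rw [intervalIntegral.integral_of_le hx.1.le, intervalIntegral.integral_of_le hx.1.le]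
          refine integral_congr_ae (ae_restrict_of_ae_restrict_of_subset ?_ hte)
          exact fun y hy => ⟨hy.1, hy.2.trans_lt hx.2⟩
        have h4 : abelOp p σ (fun y => jacWeight μ ν y * y ^ (n + 1)) x =
            abelOp p σ (fun y => y * (jacWeight μ ν y * y ^ n)) x := by
          congr 1
          funext y
          ring
        rw [h4, h1, h2, h3, integral_eval]
        simp only [eval_add, eval_sub, eval_mul, eval_X, eval_smul, eval_C, smul_eq_mul]
        ring
  choose t ht hte using step
  refine ⟨K, hK, (basisMonomials ℝ).constr ℝ t, ?_, ?_⟩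
  · intro n
    have : (basisMonomials ℝ).constr ℝ t (X ^ n) = t n := by
      rw [← monomial_one_right_eq_X_pow]
      exact (basisMonomials ℝ).constr_basis ℝ t n
    rw [this]
    exact ht n
  · intro q
    induction q using Polynomial.induction_on' with
    | add q r hq hr =>
      have e : (fun y => jacWeight μ ν y * (q + r).eval y) = fun y =>
          jacWeight μ ν y * q.eval y + jacWeight μ ν y * r.eval y := by
        funext y
        rw [eval_add, mul_add]
      rw [e]
      filter_upwards [hq, hr, abelOp_add h.σ_pos h.σ_lt_one h.p_nonneg h.p_le_one
        (integrable_jacWeight_mul_eval h.neg_one_lt_left h.neg_one_lt_right q)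
        (integrable_jacWeight_mul_eval h.neg_one_lt_left h.neg_one_lt_right r)] with x h1 h2 h3
      rw [h3, h1, h2, map_add, eval_add]
    | monomial n a =>
      have e : (fun y => jacWeight μ ν y * (monomial n a).eval y) = fun y =>
          a * (jacWeight μ ν y * y ^ n) := by
        funext y
        rw [eval_monomial]
        ring
      rw [e]
      filter_upwards [hte n] with x h1
      have h2 : (basisMonomials ℝ).constr ℝ t (monomial n a) = a • t n := by
        rw [← mul_one a, ← smul_eq_mul, ← smul_monomial, map_smul, smul_eq_mul, mul_one]
        congr 1
        exact (basisMonomials ℝ).constr_basis ℝ t n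
      rw [abelOp_const_mul, h1, h2, eval_smul, smul_eq_mul]

end

end TwoSidedRL

namespace TwoSidedRL

noncomputable section

open Polynomial

/-! ### The weighted estimate for polynomials -/

/-- Integration of polynomials against a Jacobi weight. -/
def jacInt {a b : ℝ} (ha : -1 < a) (hb : -1 < b) : ℝ[X] →ₗ[ℝ] ℝ where
  toFun q := ∫ x in Lam, jacWeight a b x * q.eval x
  map_add' q r := by
    simp only [eval_add, mul_add]
    exact integral_add (integrable_jacWeight_mul_eval ha hb q)
      (integrable_jacWeight_mul_eval ha hb r)
  map_smul' c q := by
    simp only [eval_smul, smul_eq_mul, RingHom.id_apply]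
    rw [← integral_const_mul]
    congr 1
    funext x
    ring

lemma jacInt_apply {a b : ℝ} (ha : -1 < a) (hb : -1 < b) (q : ℝ[X]) :
    jacInt ha hb q = ∫ x in Lam, jacWeight a b x * q.eval x := rfl

lemma jacInt_mul_self_pos {a b : ℝ} (ha : -1 < a) (hb : -1 < b) (q : ℝ[X]) (hq : q ≠ 0) :
    0 < jacInt ha hb (q * q) := by
  have hnn : 0 ≤ᵐ[lamMeasure] fun x => jacWeight a b x * (q * q).eval x := by
    filter_upwards [ae_restrict_mem measurableSet_Ioo] with x hx
    rw [eval_mul]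
    exact mul_nonneg (jacWeight_pos hx).le (mul_self_nonneg _)
  rw [jacInt_apply, integral_pos_iff_support_of_nonneg_ae hnn
    (integrable_jacWeight_mul_eval ha hb _)]
  have h1 : Lam \ (q.rootSet ℝ) ⊆
      Function.support fun x => jacWeight a b x * (q * q).eval x := by
    rintro x ⟨hx, hx'⟩
    rw [Function.mem_support, eval_mul]
    have : q.eval x ≠ 0 := fun h0 => hx' (by
      rw [mem_rootSet]
      exact ⟨hq, by simpa using h0⟩)
    exact mul_ne_zero (jacWeight_pos hx).ne' (mul_self_ne_zero.2 this)
  refine lt_of_lt_of_le ?_ (measure_mono h1)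
  rw [Measure.restrict_apply (measurableSet_Ioo.diff (q.rootSet_finite ℝ).measurableSet),
    inter_eq_left.2 sdiff_subset, measure_sdiff_null ((q.rootSet_finite ℝ).measure_zero _)]
  simp

/-- The Jacobi differential operator `-ω⁻¹ ((1 - x²) ω q')'` for the weight
`ω = (1 - x) ^ a (1 + x) ^ b`. -/
def jacOp (a b : ℝ) : ℝ[X] →ₗ[ℝ] ℝ[X] :=
  LinearMap.mulLeft ℝ (X ^ 2 - 1) ∘ₗ derivative ∘ₗ derivative +
    LinearMap.mulLeft ℝ (C (a + b + 2) * X - C (b - a)) ∘ₗ derivative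

lemma jacOp_apply (a b : ℝ) (q : ℝ[X]) : jacOp a b q =
    (X ^ 2 - 1) * derivative (derivative q) +
      (C (a + b + 2) * X - C (b - a)) * derivative q := rfl

lemma triangular_jacOp (a b : ℝ) :
    Triangular (jacOp a b) fun n => n * (n + 1 + (a + b)) := by
  intro n
  rw [jacOp_apply]
  rcases n with _ | _ | n
  · simp
  · simp only [zero_add, pow_one, derivative_X, derivative_one, mul_zero, mul_one, Nat.cast_one]
    have : C (a + b + 2) * X - C (b - a) - ((1 : ℝ) * (1 + 1 + (a + b))) • X = C (a - b) := by
      rw [smul_eq_C_mul]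
      simp only [C_add, C_sub, C_mul, C_1]
      have : (C (2 : ℝ) : ℝ[X]) = 1 + 1 := by rw [← C_1, ← C_add]; norm_num
      rw [this]
      ring
    rw [this, mem_degreeLT]
    exact degree_C_le.trans_lt (by norm_num)
  · have e : (X ^ 2 - 1) * derivative (derivative (X ^ (n + 1 + 1) : ℝ[X])) +
        (C (a + b + 2) * X - C (b - a)) * derivative (X ^ (n + 1 + 1)) -
        (((n + 1 + 1 : ℕ) : ℝ) * (((n + 1 + 1 : ℕ) : ℝ) + 1 + (a + b))) • X ^ (n + 1 + 1) =
        (-((n + 2 : ℝ) * (n + 1))) • X ^ n + (-((b - a) * (n + 2))) • X ^ (n + 1) := by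
      simp only [derivative_X_pow, Nat.add_sub_cancel, derivative_C_mul, smul_eq_C_mul]
      push_cast
      simp only [C_add, C_sub, C_mul, C_1, C_neg, map_natCast]
      have : (C (2 : ℝ) : ℝ[X]) = 2 := rfl
      rw [this]
      ring
    rw [e]
    exact Submodule.add_mem _ (Submodule.smul_mem _ _ (Triangular.X_pow_mem (by omega)))
      (Submodule.smul_mem _ _ (Triangular.X_pow_mem (by omega)))

/-- The integral of the derivative of `(1 - x²) ω q` vanishes. -/
lemma jacInt_deriv_eq_zero {a b : ℝ} (ha : -1 < a) (hb : -1 < b) (q : ℝ[X]) :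
    jacInt ha hb ((1 - X ^ 2) * derivative q - (C (a + b + 2) * X - C (b - a)) * q) = 0 := by
  have hint := integrable_jacWeight_mul_eval ha hb
    ((1 - X ^ 2) * derivative q - (C (a + b + 2) * X - C (b - a)) * q)
  have hF : ContinuousOn (fun x => (1 - x) ^ (a + 1) * (1 + x) ^ (b + 1) * q.eval x)
      (Icc (-1 : ℝ) 1) := by
    refine (ContinuousOn.mul ?_ ?_).mul q.continuous.continuousOn
    · exact (continuousOn_const.sub continuousOn_id).rpow_const fun x _ => Or.inr (by linarith)
    · exact (continuousOn_const.add continuousOn_id).rpow_const fun x _ => Or.inr (by linarith)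
  have := intervalIntegral.integral_eq_sub_of_hasDerivAt_of_le (a := (-1 : ℝ)) (b := 1)
    (f' := fun x => jacWeight a b x * eval x
      ((1 - X ^ 2) * derivative q - (C (a + b + 2) * X - C (b - a)) * q))
    (by norm_num) hF ?_
    ((intervalIntegrable_iff_integrableOn_Ioo_of_le (by norm_num)).2 hint)
  · rw [jacInt_apply, ← integral_Ioc_eq_integral_Ioo,
      ← intervalIntegral.integral_of_le (by norm_num), this]
    simp [Real.zero_rpow (show a + 1 ≠ 0 by linarith), Real.zero_rpow (show b + 1 ≠ 0 by linarith)]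
  · intro x hx
    have h1 : 0 < 1 - x := by linarith [hx.2]
    have h2 : 0 < 1 + x := by linarith [hx.1]
    have d1 := ((hasDerivAt_id x).const_sub 1).rpow_const (p := a + 1) (Or.inl h1.ne')
    have d2 := ((hasDerivAt_id x).const_add 1).rpow_const (p := b + 1) (Or.inl h2.ne')
    refine ((d1.mul d2).mul (q.hasDerivAt x)).congr_deriv ?_
    simp only [Pi.mul_apply, id, add_sub_cancel_right, Real.rpow_add_one h1.ne',
      Real.rpow_add_one h2.ne', jacWeight, eval_sub, eval_mul, eval_pow, eval_X, eval_C, eval_one]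
    ring

/-- The Dirichlet form of the Jacobi operator. -/
lemma jacInt_jacOp_mul {a b : ℝ} (ha : -1 < a) (hb : -1 < b) (r s : ℝ[X]) :
    jacInt ha hb (jacOp a b r * s) =
      jacInt ha hb ((1 - X ^ 2) * (derivative r * derivative s)) := by
  have := jacInt_deriv_eq_zero ha hb (derivative r * s)
  rw [← sub_eq_zero, ← neg_eq_zero, ← map_sub, ← map_neg, ← this, jacOp_apply]
  congr 1
  rw [derivative_mul]
  ring

/-- Adjointness of the Abel operators with parameters `p` and `1 - p`, tested with weighted
polynomials. -/
lemma integral_abelOp_mul_jacWeight {p σ μ ν : ℝ} (h : AbelParams p σ μ ν) {u : ℝ → ℝ}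
    (hu : Integrable u lamMeasure) (s : ℝ[X]) :
    ∫ x in Lam, abelOp p σ u x * (jacWeight ν μ x * s.eval x) =
      ∫ y in Lam, u y * abelOp (1 - p) σ (fun x => jacWeight ν μ x * s.eval x) y := by
  obtain ⟨K, hK, hKv⟩ := abelOp_jacWeight h.symm
  obtain ⟨B, hB0, hB⟩ := exists_eval_bound s
  have hs := integrable_jacWeight_mul_eval h.neg_one_lt_right h.neg_one_lt_left s
  have hint : ∀ y ∈ Lam, Integrable
      (fun x => abelKer (1 - p) σ (y - x) * (jacWeight ν μ x * s.eval x)) lamMeasure := by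
    intro y hy
    simp only [← mul_assoc]
    exact integrable_mul_eval (hKv y hy).1 s
  refine integral_abelOp_mul (M := K * B) h.p_nonneg h.p_le_one hu hs.1 ?_ ?_
  · filter_upwards [ae_restrict_mem measurableSet_Ioo] with y hy
    exact hint y hy
  · filter_upwards [ae_restrict_mem measurableSet_Ioo] with y hy
    rw [← (hKv y hy).2, abelOp, abelOp, ← integral_mul_const]
    have hi : Integrable (fun x => abelKer (1 - p) σ (y - x) * ‖jacWeight ν μ x * s.eval x‖)
        lamMeasure := by
      refine (hint y hy).norm.congr (Filter.Eventually.of_forall fun x => ?_)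
      beta_reduce
      rw [norm_mul, Real.norm_of_nonneg
        (abelKer_nonneg h.symm.p_nonneg h.symm.p_le_one σ (y - x))]
    refine integral_mono_ae hi ((hKv y hy).1.mul_const B) ?_
    filter_upwards [ae_restrict_mem measurableSet_Ioo] with x hx
    rw [norm_mul, Real.norm_of_nonneg (jacWeight_pos hx).le, mul_assoc]
    exact mul_le_mul_of_nonneg_left
      (mul_le_mul_of_nonneg_left (hB x hx) (jacWeight_pos hx).le)
      (abelKer_nonneg h.symm.p_nonneg h.symm.p_le_one σ (y - x))

/-- The polynomial operators `T` and `T'` induced by the Abel operators with parameters `p` and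
`1 - p` are adjoint to each other, for the weights `(1 - x) ^ μ (1 + x) ^ ν` and
`(1 - x) ^ ν (1 + x) ^ μ`. -/
lemma jacInt_polyOp_mul {p σ μ ν : ℝ} (h : AbelParams p σ μ ν) {T T' : ℝ[X] →ₗ[ℝ] ℝ[X]}
    (hT : ∀ q : ℝ[X], abelOp p σ (fun y => jacWeight μ ν y * q.eval y) =ᵐ[lamMeasure]
      fun x => (T q).eval x)
    (hT' : ∀ q : ℝ[X], abelOp (1 - p) σ (fun y => jacWeight ν μ y * q.eval y) =ᵐ[lamMeasure]
      fun x => (T' q).eval x) (r s : ℝ[X]) :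
    jacInt h.neg_one_lt_right h.neg_one_lt_left (T r * s) =
      jacInt h.neg_one_lt_left h.neg_one_lt_right (r * T' s) := by
  have key := integral_abelOp_mul_jacWeight h
    (integrable_jacWeight_mul_eval h.neg_one_lt_left h.neg_one_lt_right r) s
  rw [jacInt_apply, jacInt_apply]
  calc ∫ x in Lam, jacWeight ν μ x * (T r * s).eval x
      = ∫ x in Lam, abelOp p σ (fun y => jacWeight μ ν y * r.eval y) x *
          (jacWeight ν μ x * s.eval x) := by
        refine integral_congr_ae ?_
        filter_upwards [hT r] with x hx
        rw [hx, eval_mul]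
        ring
    _ = _ := key
    _ = _ := by
        refine integral_congr_ae ?_
        filter_upwards [hT' s] with x hx
        rw [hx, eval_mul]
        ring

/-- The fundamental estimate: on weighted polynomials the Abel operator smooths by at most one
order. With `T'` the adjoint and `J` the Jacobi operator, `T' (1 + J) T - c` is triangular,
symmetric, and has nonnegative diagonal for small `c`. -/
lemma exists_polyOp_bound {p σ μ ν : ℝ} (h : AbelParams p σ μ ν) :
    ∃ T : ℝ[X] →ₗ[ℝ] ℝ[X], Function.Surjective T ∧
      (∀ q : ℝ[X], abelOp p σ (fun y => jacWeight μ ν y * q.eval y) =ᵐ[lamMeasure]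
        fun x => (T q).eval x) ∧
      ∃ c : ℝ, 0 < c ∧ ∀ q : ℝ[X],
        c * jacInt h.neg_one_lt_left h.neg_one_lt_right (q * q) ≤
          jacInt h.neg_one_lt_right h.neg_one_lt_left (T q * T q) +
          jacInt h.neg_one_lt_right h.neg_one_lt_left
            ((1 - X ^ 2) * (derivative (T q) * derivative (T q))) := by
  obtain ⟨K, hK, T, hTt, hT⟩ := exists_polyOp h
  obtain ⟨K', hK', T', hTt', hT'⟩ := exists_polyOp h.symm
  have heig := abelEig_pos h.σ_lt_one
  have hadj := jacInt_polyOp_mul h hT hT'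
  set Φ := jacInt h.neg_one_lt_left h.neg_one_lt_right
  set Ψ := jacInt h.neg_one_lt_right h.neg_one_lt_left
  have hσ := h.σ_lt_one
  -- The diagonal entries of `T' (1 + J) T` are at least this `c`, because the eigenvalues of
  -- `1 + J` are at least `n ^ 2` and those of `T` and `T'` at least `(1 - σ) / n` up to `K`, `K'`.
  set c := K * K' * (1 - σ) ^ 2 with hc
  have hc0 : 0 < c := by
    have : 0 < 1 - σ := by linarith
    positivity
  refine ⟨T, hTt.surjective fun n => (mul_pos hK (heig n)).ne', hT, c, hc0, fun q => ?_⟩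
  set A : ℝ[X] →ₗ[ℝ] ℝ[X] :=
    T' ∘ₗ ((1 : ℝ) • LinearMap.id + jacOp ν μ) ∘ₗ T + (-c) • LinearMap.id with hA
  have hAt : Triangular A fun n => K' * abelEig σ n *
      ((1 + n * (n + 1 + (ν + μ))) * (K * abelEig σ n)) + -c :=
    (hTt'.comp (((Triangular.smul_id 1).add (triangular_jacOp ν μ)).comp hTt)).add
      (Triangular.smul_id (-c))
  have hd : ∀ n : ℕ, 0 ≤ K' * abelEig σ n *
      ((1 + n * (n + 1 + (ν + μ))) * (K * abelEig σ n)) + -c := by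
    intro n
    have hKK : 0 < K * K' := mul_pos hK hK'
    rcases n with _ | n
    · simp only [abelEig, Finset.range_zero, Finset.prod_empty, Nat.cast_zero, hc]
      have h1 : (1 - σ) ^ 2 ≤ 1 := pow_le_one₀ (by linarith) (by linarith [h.σ_pos])
      have := mul_le_mul_of_nonneg_left h1 hKK.le
      linarith
    · have h1 := le_mul_abelEig hσ n
      have h2 : (1 - σ) ^ 2 ≤ ((n + 1) * abelEig σ (n + 1)) ^ 2 :=
        pow_le_pow_left₀ (by linarith) h1 2
      have h3 : ((n : ℝ) + 1) ^ 2 ≤ 1 + (n + 1) * (n + 1 + 1 + (ν + μ)) := by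
        have : (0 : ℝ) ≤ n := n.cast_nonneg
        have : -1 < ν + μ := by linarith [h.add_eq]
        nlinarith
      have h4 := mul_le_mul_of_nonneg_right h3 (sq_nonneg (abelEig σ (n + 1)))
      have h5 := mul_le_mul_of_nonneg_left (h2.trans ((mul_pow _ _ _).le.trans h4)) hKK.le
      push_cast
      rw [hc]
      linarith
  -- The adjointness of `T` and `T'` turns the form of `A` into one that is visibly symmetric.
  have hAΦ (r s : ℝ[X]) : Φ (A r * s) = Ψ (T r * T s) +
      Ψ ((1 - X ^ 2) * (derivative (T r) * derivative (T s))) - c * Φ (r * s) := by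
    have e1 := hadj s (T r + jacOp ν μ (T r))
    rw [mul_comm (T s), mul_comm s, add_mul, map_add, jacInt_jacOp_mul] at e1
    have e2 : A r = T' (T r + jacOp ν μ (T r)) + (-c) • r := by
      simp [hA]
    rw [e2, add_mul, map_add, smul_mul_assoc, map_smul, ← e1, smul_eq_mul]
    ring
  have hsymm (r s : ℝ[X]) : Φ (A r * s) = Φ (r * A s) := by
    rw [mul_comm r, hAΦ, hAΦ, mul_comm (T s), mul_comm (derivative (T s)), mul_comm s]
  have := hAt.nonneg_of_symm hd (jacInt_mul_self_pos _ _) hsymm q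
  rw [hAΦ] at this
  linarith

end

end TwoSidedRL

namespace TwoSidedRL

noncomputable section

/-! ### Positivity of the symmetrized kernel -/

lemma posPow_mul {t : ℝ} (ht : 0 < t) (s a : ℝ) : posPow s (t * a) = t ^ s * posPow s a := by
  have : max (t * a) 0 = t * max a 0 := by
    rw [mul_max_of_nonneg _ _ ht.le, mul_zero]
  rw [posPow, posPow, this, Real.mul_rpow ht.le (le_max_right _ _)]

/-- The autocorrelation of the one-sided power `t₊ ^ s`. -/
def posPowCorr (s t : ℝ) : ℝ := ∫ ζ, posPow s (t + ζ) * posPow s ζ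

lemma integrable_posPow_mul_posPow {s t : ℝ} (hs : -1 < s) (hs' : s < -1 / 2) (ht : 0 < t) :
    Integrable fun ζ => posPow s (t + ζ) * posPow s ζ := by
  have hs0 : s ≠ 0 := by linarith
  have hmeas : Measurable fun ζ => posPow s (t + ζ) * posPow s ζ := by fun_prop
  have h0 : IntegrableOn (fun ζ => posPow s (t + ζ) * posPow s ζ) (Iic 0) := by
    refine integrableOn_zero.congr_fun (fun ζ hζ => ?_) measurableSet_Iic
    rw [posPow_of_nonpos hs0 hζ, mul_zero]
  have h1 : IntegrableOn (fun ζ => posPow s (t + ζ) * posPow s ζ) (Ioc 0 1) := by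
    refine ((integrableOn_posPow hs hs0 0 1).const_mul (t ^ s)).mono'
      hmeas.aestronglyMeasurable ?_
    filter_upwards [ae_restrict_mem measurableSet_Ioc] with ζ hζ
    rw [Real.norm_of_nonneg (mul_nonneg (posPow_nonneg _ _) (posPow_nonneg _ _)),
      posPow_of_pos (add_pos ht hζ.1)]
    exact mul_le_mul_of_nonneg_right
      (Real.rpow_le_rpow_of_nonpos ht (by linarith [hζ.1]) (by linarith)) (posPow_nonneg _ _)
  have h2 : IntegrableOn (fun ζ => posPow s (t + ζ) * posPow s ζ) (Ioi 1) := by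
    refine (integrableOn_Ioi_rpow_of_lt (a := s + s) (by linarith) one_pos).mono'
      hmeas.aestronglyMeasurable ?_
    filter_upwards [ae_restrict_mem measurableSet_Ioi] with ζ hζ
    have hζ0 : 0 < ζ := lt_trans one_pos hζ
    rw [Real.norm_of_nonneg (mul_nonneg (posPow_nonneg _ _) (posPow_nonneg _ _)),
      posPow_of_pos (add_pos ht hζ0), posPow_of_pos hζ0, Real.rpow_add hζ0]
    exact mul_le_mul_of_nonneg_right
      (Real.rpow_le_rpow_of_nonpos hζ0 (by linarith) (by linarith)) (Real.rpow_nonneg hζ0.le _)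
  have := (h0.union h1).union h2
  rwa [Iic_union_Ioc_eq_Iic zero_le_one, Iic_union_Ioi, integrableOn_univ] at this

/-- The autocorrelation is homogeneous of degree `2 * s + 1`. -/
lemma posPowCorr_of_pos {s t : ℝ} (ht : 0 < t) :
    posPowCorr s t = t ^ (2 * s + 1) * posPowCorr s 1 := by
  have h := Measure.integral_comp_mul_left (fun ζ => posPow s (t + ζ) * posPow s ζ) t
  have e (ζ : ℝ) : posPow s (t + t * ζ) * posPow s (t * ζ) =
      t ^ s * t ^ s * (posPow s (1 + ζ) * posPow s ζ) := by
    rw [show t + t * ζ = t * (1 + ζ) by ring, posPow_mul ht, posPow_mul ht]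
    ring
  simp only [e] at h
  rw [integral_const_mul, abs_of_pos (inv_pos.2 ht), smul_eq_mul] at h
  have h' : t ^ s * t ^ s * posPowCorr s 1 = t⁻¹ * posPowCorr s t := h
  rw [Real.rpow_add_one ht.ne', two_mul, Real.rpow_add ht]
  calc posPowCorr s t = t * (t⁻¹ * posPowCorr s t) := by field_simp
    _ = _ := by
      rw [← h']
      ring

lemma posPowCorr_neg (s t : ℝ) : posPowCorr s (-t) = posPowCorr s t := by
  have h := integral_add_left_eq_self (μ := volume)
    (fun ζ => posPow s (-t + ζ) * posPow s ζ) t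
  simp only [neg_add_cancel_left] at h
  rw [posPowCorr, posPowCorr, ← h]
  congr 1
  funext ζ
  ring

lemma posPowCorr_one_pos {s : ℝ} (hs : -1 < s) (hs' : s < -1 / 2) : 0 < posPowCorr s 1 := by
  rw [posPowCorr, integral_pos_iff_support_of_nonneg
    (fun ζ => mul_nonneg (posPow_nonneg _ _) (posPow_nonneg _ _))
    (integrable_posPow_mul_posPow hs hs' one_pos)]
  refine lt_of_lt_of_le ?_ (measure_mono (s := Ioo (0 : ℝ) 1) fun ζ hζ => ?_)
  · simp
  · rw [Function.mem_support, posPow_of_pos hζ.1, posPow_of_pos (by linarith [hζ.1])]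
    exact (mul_pos (Real.rpow_pos_of_pos (by linarith [hζ.1]) _)
      (Real.rpow_pos_of_pos hζ.1 _)).ne'

/-- The symmetric Abel kernel is a multiple of the autocorrelation of a one-sided power. -/
lemma posPowCorr_eq {σ t : ℝ} (hσ1 : σ < 1) (ht : t ≠ 0) :
    posPowCorr (σ / 2 - 1) t =
      posPowCorr (σ / 2 - 1) 1 * (posPow (σ - 1) t + posPow (σ - 1) (-t)) := by
  have hs : σ - 1 ≠ 0 := by linarith
  have e : 2 * (σ / 2 - 1) + 1 = σ - 1 := by ring
  rcases lt_or_gt_of_ne ht with h | h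
  · rw [posPow_of_nonpos hs h.le, posPow_of_pos (neg_pos.2 h), ← posPowCorr_neg,
      posPowCorr_of_pos (neg_pos.2 h), e]
    ring
  · rw [posPow_of_nonpos hs (neg_nonpos.2 h.le), posPow_of_pos h, posPowCorr_of_pos h, e]
    ring

lemma integral_posPow_sub_mul (s x y : ℝ) :
    ∫ z, posPow s (x - z) * posPow s (y - z) = posPowCorr s (x - y) := by
  have h := integral_sub_left_eq_self (fun ζ => posPow s (x - y + ζ) * posPow s ζ) volume y
  rw [posPowCorr, ← h]
  congr 1
  funext z
  congr 2
  ring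

lemma integrable_posPow_sub_mul {s x y : ℝ} (hs : -1 < s) (hs' : s < -1 / 2) (hxy : x ≠ y) :
    Integrable fun z => posPow s (x - z) * posPow s (y - z) := by
  wlog h : y < x generalizing x y
  · simp only [mul_comm (posPow s (x - _))]
    exact this hxy.symm (lt_of_le_of_ne (not_lt.1 h) hxy)
  have h1 := (integrable_posPow_mul_posPow hs hs' (sub_pos.2 h)).comp_sub_left y
  refine h1.congr (Filter.Eventually.of_forall fun z => ?_)
  beta_reduce
  congr 2
  ring

lemma ae_fst_ne_snd : ∀ᵐ w ∂lamMeasure.prod lamMeasure, w.1 ≠ w.2 := by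
  have hm : MeasurableSet {w : ℝ × ℝ | w.1 ≠ w.2} :=
    (measurableSet_eq_fun measurable_fst measurable_snd).compl
  rw [Measure.ae_prod_iff_ae_ae hm]
  refine Filter.Eventually.of_forall fun x => ?_
  filter_upwards [(countable_singleton x).ae_notMem lamMeasure] with y hy
  exact fun h => hy h.symm

/-- The quadratic form of the Abel kernel is nonnegative: up to a factor it is the integral over
`z` of the squares of `∫ u(x) (x - z)₊ ^ (σ / 2 - 1) dx`. -/
lemma integral_mul_abelOp_nonneg {p σ : ℝ} (hσ0 : 0 < σ) (hσ1 : σ < 1) {u : ℝ → ℝ}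
    (hu : AEStronglyMeasurable u lamMeasure)
    (hint : Integrable (fun w : ℝ × ℝ => u w.1 * (abelKer p σ (w.1 - w.2) * u w.2))
      (lamMeasure.prod lamMeasure)) :
    0 ≤ ∫ x in Lam, u x * abelOp p σ u x := by
  set s := σ / 2 - 1 with hs
  have hs1 : -1 < s := by linarith
  have hs2 : s < -1 / 2 := by linarith
  set β := posPowCorr s 1 with hβ
  have hβ0 : 0 < β := posPowCorr_one_pos hs1 hs2
  have hsymint : Integrable (fun w : ℝ × ℝ => u w.1 * u w.2 * posPowCorr s (w.1 - w.2))
      (lamMeasure.prod lamMeasure) := by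
    refine ((hint.add hint.swap).const_mul β).congr ?_
    filter_upwards [ae_fst_ne_snd] with w hw
    rw [posPowCorr_eq hσ1 (sub_ne_zero.2 hw)]
    simp only [Pi.add_apply, Function.comp_apply, Prod.fst_swap, Prod.snd_swap, abelKer, neg_sub]
    ring
  have hsym : ∫ w, u w.1 * u w.2 * posPowCorr s (w.1 - w.2) ∂(lamMeasure.prod lamMeasure) =
      2 * β * ∫ x in Lam, u x * abelOp p σ u x := by
    have h1 : ∫ w, u w.1 * u w.2 * posPowCorr s (w.1 - w.2) ∂(lamMeasure.prod lamMeasure) =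
        ∫ w, β * (u w.1 * (abelKer p σ (w.1 - w.2) * u w.2) +
          u w.2 * (abelKer p σ (w.2 - w.1) * u w.1)) ∂(lamMeasure.prod lamMeasure) := by
      refine integral_congr_ae ?_
      filter_upwards [ae_fst_ne_snd] with w hw
      rw [posPowCorr_eq hσ1 (sub_ne_zero.2 hw)]
      simp only [abelKer, neg_sub]
      ring
    have h2 : ∫ w, u w.2 * (abelKer p σ (w.2 - w.1) * u w.1) ∂(lamMeasure.prod lamMeasure) =
        ∫ w, u w.1 * (abelKer p σ (w.1 - w.2) * u w.2) ∂(lamMeasure.prod lamMeasure) :=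
      integral_prod_swap (μ := lamMeasure) (ν := lamMeasure)
        (fun w => u w.1 * (abelKer p σ (w.1 - w.2) * u w.2))
    have h3 : ∫ w, u w.1 * (abelKer p σ (w.1 - w.2) * u w.2) ∂(lamMeasure.prod lamMeasure) =
        ∫ x in Lam, u x * abelOp p σ u x := by
      rw [integral_prod _ hint]
      simp only [integral_const_mul, abelOp]
    have h4 : Integrable (fun w : ℝ × ℝ => u w.2 * (abelKer p σ (w.2 - w.1) * u w.1))
        (lamMeasure.prod lamMeasure) := hint.swap
    rw [h1, integral_const_mul, integral_add hint h4, h2, h3]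
    ring
  -- Tonelli applies since the autocorrelation, being a multiple of the symmetrized kernel, is
  -- integrable against `|u| ⊗ |u|`.
  have hF : Integrable (fun w : (ℝ × ℝ) × ℝ => u w.1.1 * u w.1.2 *
      (posPow s (w.1.1 - w.2) * posPow s (w.1.2 - w.2)))
      ((lamMeasure.prod lamMeasure).prod volume) := by
    have hm : AEStronglyMeasurable (fun w : (ℝ × ℝ) × ℝ => u w.1.1 * u w.1.2 *
        (posPow s (w.1.1 - w.2) * posPow s (w.1.2 - w.2)))
        ((lamMeasure.prod lamMeasure).prod volume) := by
      refine AEStronglyMeasurable.mul ?_ (Measurable.aestronglyMeasurable (by fun_prop))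
      exact (hu.comp_fst.mul hu.comp_snd).comp_fst
    rw [integrable_prod_iff hm]
    constructor
    · filter_upwards [ae_fst_ne_snd] with w hw
      exact (integrable_posPow_sub_mul hs1 hs2 hw).const_mul _
    · refine hsymint.norm.congr (Filter.Eventually.of_forall fun w => ?_)
      have hn (z : ℝ) : 0 ≤ posPow s (w.1 - z) * posPow s (w.2 - z) :=
        mul_nonneg (posPow_nonneg _ _) (posPow_nonneg _ _)
      beta_reduce
      rw [norm_mul (u w.1 * u w.2), ← integral_posPow_sub_mul,
        Real.norm_of_nonneg (integral_nonneg hn), ← integral_const_mul]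
      congr 1
      funext z
      rw [norm_mul (u w.1 * u w.2), Real.norm_of_nonneg (hn z)]
  have hpos : 0 ≤ ∫ w, u w.1 * u w.2 * posPowCorr s (w.1 - w.2)
      ∂(lamMeasure.prod lamMeasure) := by
    have h1 : ∫ w, u w.1 * u w.2 * posPowCorr s (w.1 - w.2) ∂(lamMeasure.prod lamMeasure) =
        ∫ w, (∫ z, u w.1 * u w.2 * (posPow s (w.1 - z) * posPow s (w.2 - z)))
          ∂(lamMeasure.prod lamMeasure) := by
      congr 1
      funext w
      rw [integral_const_mul, integral_posPow_sub_mul]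
    rw [h1, integral_integral_swap hF]
    refine integral_nonneg fun z => ?_
    have h2 : ∫ w, u w.1 * u w.2 * (posPow s (w.1 - z) * posPow s (w.2 - z))
        ∂(lamMeasure.prod lamMeasure) =
        (∫ x in Lam, u x * posPow s (x - z)) * ∫ y in Lam, u y * posPow s (y - z) := by
      rw [← integral_prod_mul]
      congr 1
      funext w
      ring
    beta_reduce
    rw [h2]
    exact mul_self_nonneg _
  rw [hsym] at hpos
  exact nonneg_of_mul_nonneg_right hpos (by positivity)

open Polynomial

/-- Positivity for weighted polynomials. The double integral converges because the image of the
weight under the Abel operator is bounded. -/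
lemma integral_jacWeight_mul_abelOp_nonneg {p σ μ ν : ℝ} (h : AbelParams p σ μ ν) (q : ℝ[X]) :
    0 ≤ ∫ x in Lam, jacWeight μ ν x * q.eval x *
      abelOp p σ (fun y => jacWeight μ ν y * q.eval y) x := by
  obtain ⟨K, hK, hKv⟩ := abelOp_jacWeight h
  obtain ⟨B, hB0, hB⟩ := exists_eval_bound q
  have hu := integrable_jacWeight_mul_eval h.neg_one_lt_left h.neg_one_lt_right q
  refine integral_mul_abelOp_nonneg h.σ_pos h.σ_lt_one hu.1 ?_
  have hm : AEStronglyMeasurable (fun w : ℝ × ℝ => jacWeight μ ν w.1 * q.eval w.1 *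
      (abelKer p σ (w.1 - w.2) * (jacWeight μ ν w.2 * q.eval w.2)))
      (lamMeasure.prod lamMeasure) :=
    hu.1.comp_fst.mul (aestronglyMeasurable_abelKer_mul p σ hu.1)
  have hi : ∀ x ∈ Lam, Integrable
      (fun y => abelKer p σ (x - y) * (jacWeight μ ν y * q.eval y)) lamMeasure := by
    intro x hx
    simp only [← mul_assoc]
    exact integrable_mul_eval (hKv x hx).1 q
  rw [integrable_prod_iff hm]
  constructor
  · filter_upwards [ae_restrict_mem measurableSet_Ioo] with x hx
    exact (hi x hx).const_mul _
  · refine (hu.norm.mul_const (K * B)).mono' hm.norm.integral_prod_right' ?_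
    filter_upwards [ae_restrict_mem measurableSet_Ioo] with x hx
    rw [Real.norm_of_nonneg (integral_nonneg fun _ => norm_nonneg _)]
    simp only [norm_mul (jacWeight μ ν x * q.eval x)]
    rw [integral_const_mul]
    refine mul_le_mul_of_nonneg_left ?_ (norm_nonneg _)
    rw [← (hKv x hx).2, abelOp, ← integral_mul_const]
    refine integral_mono_ae (hi x hx).norm ((hKv x hx).1.mul_const B) ?_
    filter_upwards [ae_restrict_mem measurableSet_Ioo] with y hy
    rw [norm_mul, norm_mul, Real.norm_of_nonneg (abelKer_nonneg h.p_nonneg h.p_le_one σ _),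
      Real.norm_of_nonneg (jacWeight_pos hy).le, mul_assoc]
    exact mul_le_mul_of_nonneg_left
      (mul_le_mul_of_nonneg_left (hB y hy) (jacWeight_pos hy).le)
      (abelKer_nonneg h.p_nonneg h.p_le_one σ _)

/-! ### The estimate in `L¹` -/

/-- The Cauchy-Schwarz inequality for the functions `1` and `f` with weight `w`. -/
lemma sq_integral_mul_le {X : Type*} [MeasurableSpace X] {m : Measure X} {w f : X → ℝ}
    (hw : 0 ≤ᵐ[m] w) (h0 : Integrable w m) (h1 : Integrable (fun x => w x * f x) m)
    (h2 : Integrable (fun x => w x * (f x * f x)) m) :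
    (∫ x, w x * f x ∂m) ^ 2 ≤ (∫ x, w x ∂m) * ∫ x, w x * (f x * f x) ∂m := by
  have key : ∀ t : ℝ, 0 ≤ (∫ x, w x ∂m) * (t * t) + (2 * ∫ x, w x * f x ∂m) * t +
      ∫ x, w x * (f x * f x) ∂m := by
    intro t
    have : (∫ x, w x ∂m) * (t * t) + (2 * ∫ x, w x * f x ∂m) * t +
      ∫ x, w x * (f x * f x) ∂m = ∫ x, w x * ((t + f x) * (t + f x)) ∂m := by
      rw [← integral_mul_const, ← integral_const_mul, ← integral_mul_const,
        ← integral_add (h0.mul_const _) ((h1.const_mul _).mul_const _),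
        ← integral_add (f := fun x => w x * (t * t) + 2 * (w x * f x) * t)
          ((h0.mul_const _).add ((h1.const_mul _).mul_const _)) h2]
      congr 1
      funext x
      ring
    rw [this]
    refine integral_nonneg_of_ae ?_
    filter_upwards [hw] with x hx
    exact mul_nonneg hx (mul_self_nonneg _)
  have := discrim_le_zero key
  rw [discrim] at this
  linarith

lemma integral_Lam_one : ∫ _ in Lam, (1 : ℝ) = 2 := by
  rw [← integral_Ioc_eq_integral_Ioo, ← intervalIntegral.integral_of_le (by norm_num),
    intervalIntegral.integral_const]
  norm_num

lemma sq_integral_norm_le {g : ℝ → ℝ} (hg : MemLp g 2 lamMeasure) :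
    (∫ x in Lam, ‖g x‖) ^ 2 ≤ 2 * ∫ x in Lam, g x * g x := by
  have h := sq_integral_mul_le (m := lamMeasure) (w := fun _ => 1) (f := fun x => ‖g x‖)
    (Filter.Eventually.of_forall fun _ => zero_le_one) (integrable_const _)
    (by simpa using (hg.integrable (by norm_num)).norm)
    (by
      have : Integrable (fun x => g x * g x) lamMeasure := hg.integrable_mul hg
      simpa using this)
  rw [integral_Lam_one] at h
  simpa only [one_mul, Real.norm_eq_abs, abs_mul_abs_self] using h

lemma abs_primitive_le {g : ℝ → ℝ} (hg : Integrable g lamMeasure) {x : ℝ}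
    (hx : x ∈ Icc (-1 : ℝ) 1) : |∫ y in (-1)..x, g y| ≤ ∫ y in Lam, ‖g y‖ := by
  refine (intervalIntegral.norm_integral_le_integral_norm (f := g) hx.1).trans ?_
  rw [intervalIntegral.integral_of_le hx.1, integral_Ioc_eq_integral_Ioo]
  exact setIntegral_mono_set hg.norm (Filter.Eventually.of_forall fun _ => norm_nonneg _)
    (Ioo_subset_Ioo_right hx.2).eventuallyLE

lemma memLp_eval (q : ℝ[X]) : MemLp (fun x => q.eval x) 2 lamMeasure := by
  obtain ⟨K, -, hK⟩ := exists_eval_bound q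
  refine MemLp.of_bound q.continuous.aestronglyMeasurable K ?_
  filter_upwards [ae_restrict_mem measurableSet_Ioo] with x hx
  exact hK x hx

lemma one_sub_sq_mul_jacWeight_le {a b x : ℝ} (ha : -1 < a) (ha0 : a ≤ 0) (hb : -1 < b)
    (hb0 : b ≤ 0) (hx : x ∈ Lam) : (1 - x ^ 2) * jacWeight a b x ≤ 4 := by
  have h1 : 0 < 1 - x := by linarith [hx.2]
  have h2 : 0 < 1 + x := by linarith [hx.1]
  have key {c y : ℝ} (hc : -1 < c) (hc0 : c ≤ 0) (hy : 0 < y) (hy2 : y ≤ 2) :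
      y ^ (c + 1) ≤ 2 := by
    calc y ^ (c + 1) ≤ 2 ^ (c + 1) := Real.rpow_le_rpow hy.le hy2 (by linarith)
      _ ≤ 2 ^ (1 : ℝ) := Real.rpow_le_rpow_of_exponent_le (by norm_num) (by linarith)
      _ = 2 := Real.rpow_one _
  have e : (1 - x ^ 2) * jacWeight a b x = (1 - x) ^ (a + 1) * (1 + x) ^ (b + 1) := by
    rw [Real.rpow_add_one h1.ne', Real.rpow_add_one h2.ne', jacWeight]
    ring
  rw [e]
  calc _ ≤ (2 : ℝ) * 2 := mul_le_mul (key ha ha0 h1 (by linarith [hx.1]))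
        (key hb hb0 h2 (by linarith [hx.2])) (Real.rpow_nonneg h2.le _) (by norm_num)
    _ = 4 := by norm_num

/-- Solvability for polynomial right-hand sides with an a priori bound: the `L¹` norm of the
solution is controlled by the `L²` norm of the derivative of its image. -/
lemma exists_polyOp_L1_bound {p σ μ ν : ℝ} (h : AbelParams p σ μ ν) :
    ∃ T : ℝ[X] →ₗ[ℝ] ℝ[X], Function.Surjective T ∧
      (∀ q : ℝ[X], abelOp p σ (fun y => jacWeight μ ν y * q.eval y) =ᵐ[lamMeasure]
        fun x => (T q).eval x) ∧
      ∃ M : ℝ, 0 ≤ M ∧ ∀ q : ℝ[X], (T q).eval (-1) = 0 →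
        (∫ x in Lam, ‖jacWeight μ ν x * q.eval x‖) ^ 2 ≤
          M * ∫ x in Lam, (derivative (T q)).eval x * (derivative (T q)).eval x := by
  obtain ⟨T, hTs, hT, c, hc, hb⟩ := exists_polyOp_bound h
  set W := ∫ x in Lam, jacWeight μ ν x with hW
  set W' := ∫ x in Lam, jacWeight ν μ x with hW'
  have hWn : 0 ≤ W := setIntegral_nonneg measurableSet_Ioo fun x hx => (jacWeight_pos hx).le
  have hWn' : 0 ≤ W' := setIntegral_nonneg measurableSet_Ioo fun x hx => (jacWeight_pos hx).le
  refine ⟨T, hTs, hT, W * (c⁻¹ * (2 * W' + 4)), by positivity, fun q hq => ?_⟩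
  set g := derivative (T q) with hg
  set E := ∫ x in Lam, g.eval x * g.eval x with hE
  have hgm := memLp_eval g
  have h1 : (∫ x in Lam, ‖jacWeight μ ν x * q.eval x‖) ^ 2 ≤
      W * jacInt h.neg_one_lt_left h.neg_one_lt_right (q * q) := by
    have h2 := sq_integral_mul_le (m := lamMeasure) (w := jacWeight μ ν)
      (f := fun x => ‖q.eval x‖)
      (by
        filter_upwards [ae_restrict_mem measurableSet_Ioo] with x hx
        exact (jacWeight_pos hx).le)
      (integrable_jacWeight h.neg_one_lt_left h.neg_one_lt_right)
      (by
        refine (integrable_jacWeight_mul_eval h.neg_one_lt_left h.neg_one_lt_right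
          q).norm.congr ?_
        filter_upwards [ae_restrict_mem measurableSet_Ioo] with x hx
        rw [norm_mul, Real.norm_of_nonneg (jacWeight_pos hx).le])
      (by
        have := integrable_jacWeight_mul_eval h.neg_one_lt_left h.neg_one_lt_right (q * q)
        simpa using this)
    rw [jacInt_apply]
    simp only [eval_mul]
    simp only [Real.norm_eq_abs, abs_mul_abs_self] at h2 ⊢
    refine le_trans (le_of_eq ?_) h2
    congr 1
    refine setIntegral_congr_fun measurableSet_Ioo fun x hx => ?_
    simp only [abs_mul, abs_of_pos (jacWeight_pos hx)]
  have h3 : ∀ x ∈ Lam, (T q).eval x * (T q).eval x ≤ 2 * E := by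
    intro x hx
    have e1 : (T q).eval x = ∫ y in (-1)..x, g.eval y := by
      rw [intervalIntegral.integral_eq_sub_of_hasDerivAt (f := fun x => (T q).eval x)
        (fun y _ => (T q).hasDerivAt y) (g.continuous.intervalIntegrable _ _), hq, sub_zero]
    have e2 := abs_primitive_le (hgm.integrable (by norm_num)) (Ioo_subset_Icc_self hx)
    rw [← e1] at e2
    have e3 := pow_le_pow_left₀ (abs_nonneg _) e2 2
    rw [sq_abs] at e3
    rw [← sq]
    exact e3.trans (sq_integral_norm_le hgm)
  have h4 : jacInt h.neg_one_lt_right h.neg_one_lt_left (T q * T q) ≤ W' * (2 * E) := by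
    rw [jacInt_apply, hW', ← integral_mul_const]
    refine setIntegral_mono_on
      (integrable_jacWeight_mul_eval h.neg_one_lt_right h.neg_one_lt_left _)
      ((integrable_jacWeight h.neg_one_lt_right h.neg_one_lt_left).mul_const _)
      measurableSet_Ioo fun x hx => ?_
    rw [eval_mul]
    exact mul_le_mul_of_nonneg_left (h3 x hx) (jacWeight_pos hx).le
  have h5 : jacInt h.neg_one_lt_right h.neg_one_lt_left ((1 - X ^ 2) * (g * g)) ≤ 4 * E := by
    rw [jacInt_apply, hE, ← integral_const_mul]
    refine setIntegral_mono_on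
      (integrable_jacWeight_mul_eval h.neg_one_lt_right h.neg_one_lt_left _)
      ((hgm.integrable_mul hgm).const_mul 4) measurableSet_Ioo fun x hx => ?_
    have := one_sub_sq_mul_jacWeight_le h.neg_one_lt_right h.ν_nonpos h.neg_one_lt_left
      h.μ_nonpos hx
    simp only [eval_mul, eval_sub, eval_one, eval_pow, eval_X]
    rw [← mul_assoc, mul_comm (jacWeight ν μ x)]
    exact mul_le_mul_of_nonneg_right this (mul_self_nonneg _)
  refine h1.trans ?_
  rw [mul_assoc]
  refine mul_le_mul_of_nonneg_left ?_ hWn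
  have h6 := hb q
  rw [mul_assoc, ← div_eq_inv_mul, le_div_iff₀ hc]
  linarith

end

end TwoSidedRL

namespace TwoSidedRL

noncomputable section

open Polynomial Filter Topology

/-! ### Primitives of square integrable functions -/

/-- The primitive of `g` that vanishes at `-1`. -/
def prim (g : ℝ → ℝ) (x : ℝ) : ℝ := ∫ y in (-1)..x, g y

lemma continuousOn_prim {g : ℝ → ℝ} (hg : Integrable g lamMeasure) :
    ContinuousOn (prim g) (Icc (-1) 1) := by
  have h : IntegrableOn g (Icc (-1) 1) := by
    rw [integrableOn_Icc_iff_integrableOn_Ioo]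
    exact hg
  have := intervalIntegral.continuousOn_primitive_interval (μ := volume) (a := -1) (b := 1)
    (by rwa [uIcc_of_le (by norm_num)])
  rwa [uIcc_of_le (by norm_num)] at this

lemma prim_congr {g h : ℝ → ℝ} (e : g =ᵐ[lamMeasure] h) {x : ℝ} (hx : x ∈ Icc (-1 : ℝ) 1) :
    prim g x = prim h x := by
  rw [prim, prim, intervalIntegral.integral_of_le hx.1, intervalIntegral.integral_of_le hx.1,
    integral_Ioc_eq_integral_Ioo, integral_Ioc_eq_integral_Ioo]
  exact integral_congr_ae (ae_restrict_of_ae_restrict_of_subset (Ioo_subset_Ioo_right hx.2) e)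

lemma intervalIntegrable_of_Lam {g : ℝ → ℝ} (hg : Integrable g lamMeasure) {x : ℝ}
    (hx : x ∈ Icc (-1 : ℝ) 1) : IntervalIntegrable g volume (-1) x :=
  (intervalIntegrable_iff_integrableOn_Ioo_of_le hx.1).2
    (IntegrableOn.mono_set hg (Ioo_subset_Ioo_right hx.2))

lemma prim_add {g h : ℝ → ℝ} (hg : Integrable g lamMeasure) (hh : Integrable h lamMeasure)
    {x : ℝ} (hx : x ∈ Icc (-1 : ℝ) 1) :
    prim (fun y => g y + h y) x = prim g x + prim h x :=
  intervalIntegral.integral_add (intervalIntegrable_of_Lam hg hx) (intervalIntegrable_of_Lam hh hx)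

lemma prim_const_mul (a : ℝ) (g : ℝ → ℝ) (x : ℝ) :
    prim (fun y => a * g y) x = a * prim g x :=
  intervalIntegral.integral_const_mul _ _

lemma prim_one (g : ℝ → ℝ) : prim g 1 = ∫ x in Lam, g x := by
  rw [prim, intervalIntegral.integral_of_le (by norm_num), integral_Ioc_eq_integral_Ioo]

lemma prim_neg_one (g : ℝ → ℝ) : prim g (-1) = 0 := intervalIntegral.integral_same

/-- Square integrable functions on `Λ`, up to null sets. -/
abbrev L2Lam : Type := Lp ℝ 2 lamMeasure

/-- Integrable functions on `Λ`, up to null sets. -/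
abbrev L1Lam : Type := Lp ℝ 1 lamMeasure

lemma integrable_L2 (g : L2Lam) : Integrable g lamMeasure :=
  (Lp.memLp g).integrable (by norm_num)

lemma integrable_L1 (u : L1Lam) : Integrable u lamMeasure :=
  memLp_one_iff_integrable.1 (Lp.memLp u)

lemma inner_eq_integral (f g : L2Lam) : inner ℝ f g = ∫ x in Lam, f x * g x := by
  rw [L2.inner_def]
  congr 1
  funext x
  simp [mul_comm]

lemma norm_sq_eq_integral (g : L2Lam) : ‖g‖ ^ 2 = ∫ x in Lam, g x * g x := by
  rw [← real_inner_self_eq_norm_sq, inner_eq_integral]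

lemma integral_norm_le (g : L2Lam) : ∫ x in Lam, ‖g x‖ ≤ √2 * ‖g‖ := by
  have h := sq_integral_norm_le (Lp.memLp g)
  rw [← norm_sq_eq_integral] at h
  refine abs_le_of_sq_le_sq' ?_ (by positivity) |>.2
  rwa [mul_pow, Real.sq_sqrt (by norm_num)]

lemma abs_prim_le (g : L2Lam) {x : ℝ} (hx : x ∈ Icc (-1 : ℝ) 1) : |prim g x| ≤ √2 * ‖g‖ :=
  (abs_primitive_le (integrable_L2 g) hx).trans (integral_norm_le g)

lemma aestronglyMeasurable_prim (g : L2Lam) : AEStronglyMeasurable (prim g) lamMeasure :=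
  ((continuousOn_prim (integrable_L2 g)).mono Ioo_subset_Icc_self).aestronglyMeasurable
    measurableSet_Ioo

lemma ae_norm_prim_le (g : L2Lam) : ∀ᵐ x ∂lamMeasure, ‖prim g x‖ ≤ √2 * ‖g‖ := by
  filter_upwards [ae_restrict_mem measurableSet_Ioo] with x hx
  exact abs_prim_le g (Ioo_subset_Icc_self hx)

lemma memLp_prim (q : ℝ≥0∞) (g : L2Lam) : MemLp (prim g) q lamMeasure :=
  MemLp.of_bound (aestronglyMeasurable_prim g) _ (ae_norm_prim_le g)

lemma prim_coe_add (g h : L2Lam) {x : ℝ} (hx : x ∈ Icc (-1 : ℝ) 1) :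
    prim (g + h : L2Lam) x = prim g x + prim h x :=
  (prim_congr (Lp.coeFn_add g h) hx).trans (prim_add (integrable_L2 g) (integrable_L2 h) hx)

lemma prim_coe_smul (a : ℝ) (g : L2Lam) {x : ℝ} (hx : x ∈ Icc (-1 : ℝ) 1) :
    prim (a • g : L2Lam) x = a * prim g x :=
  (prim_congr (Lp.coeFn_smul a g) hx).trans (prim_const_mul a g x)

/-- Taking primitives, as a bounded operator from `L²` to `L^q`. -/
def primLp (q : ℝ≥0∞) [Fact (1 ≤ q)] : L2Lam →L[ℝ] Lp ℝ q lamMeasure :=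
  LinearMap.mkContinuous
    { toFun := fun g => (memLp_prim q g).toLp (prim g)
      map_add' := fun g h => by
        rw [← MemLp.toLp_add]
        refine MemLp.toLp_congr _ _ ?_
        filter_upwards [ae_restrict_mem measurableSet_Ioo] with x hx
        exact prim_coe_add g h (Ioo_subset_Icc_self hx)
      map_smul' := fun a g => by
        rw [RingHom.id_apply, ← MemLp.toLp_const_smul]
        refine MemLp.toLp_congr _ _ ?_
        filter_upwards [ae_restrict_mem measurableSet_Ioo] with x hx
        exact prim_coe_smul a g (Ioo_subset_Icc_self hx) }
    (measureUnivNNReal lamMeasure ^ q.toReal⁻¹ * √2) fun g => by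
      rw [mul_assoc]
      refine Lp.norm_le_of_ae_bound (by positivity) ?_
      filter_upwards [(memLp_prim q g).coeFn_toLp, ae_norm_prim_le g] with x h1 h2
      change ‖((memLp_prim q g).toLp (prim g)) x‖ ≤ _
      rwa [h1]

lemma coeFn_primLp (q : ℝ≥0∞) [Fact (1 ≤ q)] (g : L2Lam) :
    primLp q g =ᵐ[lamMeasure] prim g :=
  (memLp_prim q g).coeFn_toLp

lemma integrable_mul_prim (u : L1Lam) (g : L2Lam) :
    Integrable (fun x => u x * prim g x) lamMeasure :=
  (integrable_L1 u).mul_bdd (aestronglyMeasurable_prim g) (ae_norm_prim_le g)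

/-- The bounded bilinear form `(u, g) ↦ ∫ u · prim g` on `L¹ × L²`. -/
def primPairing : L1Lam →L[ℝ] L2Lam →L[ℝ] ℝ :=
  LinearMap.mkContinuous₂
    (LinearMap.mk₂ ℝ (fun (u : L1Lam) (g : L2Lam) => ∫ x in Lam, u x * prim g x)
      (fun u v g => by
        rw [← integral_add (integrable_mul_prim u g) (integrable_mul_prim v g)]
        refine integral_congr_ae ?_
        filter_upwards [Lp.coeFn_add u v] with x hx
        rw [hx, Pi.add_apply, add_mul])
      (fun a u g => by
        rw [smul_eq_mul, ← integral_const_mul]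
        refine integral_congr_ae ?_
        filter_upwards [Lp.coeFn_smul a u] with x hx
        rw [hx, Pi.smul_apply, smul_eq_mul, mul_assoc])
      (fun u g h => by
        rw [← integral_add (integrable_mul_prim u g) (integrable_mul_prim u h)]
        refine setIntegral_congr_fun measurableSet_Ioo fun x hx => ?_
        rw [prim_coe_add g h (Ioo_subset_Icc_self hx), mul_add])
      (fun a u g => by
        rw [smul_eq_mul, ← integral_const_mul]
        refine setIntegral_congr_fun measurableSet_Ioo fun x hx => ?_
        rw [prim_coe_smul a g (Ioo_subset_Icc_self hx)]
        ring))
    √2 fun u g => by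
      rw [LinearMap.mk₂_apply, L1.norm_eq_integral_norm]
      refine (norm_integral_le_integral_norm _).trans ?_
      calc ∫ x in Lam, ‖u x * prim g x‖ ≤ ∫ x in Lam, ‖u x‖ * (√2 * ‖g‖) := by
            refine integral_mono_ae (integrable_mul_prim u g).norm
              ((integrable_L1 u).norm.mul_const _) ?_
            filter_upwards [ae_norm_prim_le g] with x hx
            rw [norm_mul]
            exact mul_le_mul_of_nonneg_left hx (norm_nonneg _)
        _ = _ := by
            rw [integral_mul_const]
            ring

lemma primPairing_apply (u : L1Lam) (g : L2Lam) :
    primPairing u g = ∫ x in Lam, u x * prim g x := rfl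

/-- The Abel operator on `L¹`. -/
def abelCLM {p σ μ ν : ℝ} (h : AbelParams p σ μ ν) : L1Lam →L[ℝ] L1Lam :=
  LinearMap.mkContinuous
    { toFun := fun u => (integrable_abelOp h.σ_pos h.σ_lt_one h.p_nonneg h.p_le_one
        (integrable_L1 u)).toL1 _
      map_add' := fun u v => by
        rw [← Integrable.toL1_add, Integrable.toL1_eq_toL1_iff]
        rw [abelOp_congr p σ (Lp.coeFn_add u v)]
        exact abelOp_add h.σ_pos h.σ_lt_one h.p_nonneg h.p_le_one (integrable_L1 u)
          (integrable_L1 v)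
      map_smul' := fun a u => by
        rw [RingHom.id_apply, ← Integrable.toL1_smul, Integrable.toL1_eq_toL1_iff]
        rw [abelOp_congr p σ (Lp.coeFn_smul a u)]
        exact Eventually.of_forall fun x => abelOp_const_mul p σ a u x }
    (abelMass p σ) fun u => by
      have hi := integrable_abelOp h.σ_pos h.σ_lt_one h.p_nonneg h.p_le_one (integrable_L1 u)
      change ‖hi.toL1 _‖ ≤ _
      rw [L1.norm_eq_integral_norm, L1.norm_eq_integral_norm]
      refine le_trans (le_of_eq ?_) (integral_norm_abelOp_le h.σ_pos h.σ_lt_one h.p_nonneg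
        h.p_le_one (integrable_L1 u))
      refine integral_congr_ae ?_
      filter_upwards [hi.coeFn_toL1] with x hx
      rw [hx]

lemma coeFn_abelCLM {p σ μ ν : ℝ} (h : AbelParams p σ μ ν) (u : L1Lam) :
    abelCLM h u =ᵐ[lamMeasure] abelOp p σ u :=
  (integrable_abelOp h.σ_pos h.σ_lt_one h.p_nonneg h.p_le_one (integrable_L1 u)).coeFn_toL1

/-! ### Density of polynomials and inversion of the Abel operator -/

/-- A polynomial as an element of `L²(Λ)`. -/
def polyLp (q : ℝ[X]) : L2Lam := (memLp_eval q).toLp _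

lemma coeFn_polyLp (q : ℝ[X]) : polyLp q =ᵐ[lamMeasure] fun x => q.eval x :=
  (memLp_eval q).coeFn_toLp

lemma polyLp_sub (q r : ℝ[X]) : polyLp (q - r) = polyLp q - polyLp r := by
  rw [polyLp, polyLp, polyLp, ← MemLp.toLp_sub]
  exact MemLp.toLp_congr _ _ (Eventually.of_forall fun x => by simp)

lemma prim_polyLp (q : ℝ[X]) {x : ℝ} (hx : x ∈ Icc (-1 : ℝ) 1) :
    prim (polyLp q) x = ∫ y in (-1)..x, q.eval y :=
  prim_congr (coeFn_polyLp q) hx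

lemma denseRange_polyLp : DenseRange polyLp := by
  intro g
  rw [Metric.mem_closure_iff]
  intro ε hε
  obtain ⟨f, hf1, hf2⟩ := (Lp.memLp g).exists_boundedContinuous_eLpNorm_sub_le (by norm_num)
    (ENNReal.ofReal_pos.2 (half_pos hε)).ne'
  set D : ℝ := measureUnivNNReal lamMeasure ^ (2 : ℝ≥0∞).toReal⁻¹ with hD
  have hD0 : 0 ≤ D := by positivity
  obtain ⟨q, hq⟩ := exists_polynomial_near_of_continuousOn (-1) 1 f f.continuous.continuousOn
    (ε / (2 * (D + 1))) (by positivity)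
  refine ⟨polyLp q, ⟨q, rfl⟩, ?_⟩
  have h1 : dist g (hf2.toLp f) ≤ ε / 2 := by
    rw [dist_eq_norm, Lp.norm_def]
    refine ENNReal.toReal_le_of_le_ofReal (half_pos hε).le (le_trans (le_of_eq ?_) hf1)
    refine eLpNorm_congr_ae ?_
    filter_upwards [Lp.coeFn_sub g (hf2.toLp f), hf2.coeFn_toLp] with x a b
    rw [a, Pi.sub_apply, Pi.sub_apply, b]
  have h2 : dist (hf2.toLp f) (polyLp q) < ε / 2 := by
    rw [dist_eq_norm]
    have := Lp.norm_le_of_ae_bound (f := hf2.toLp f - polyLp q) (C := ε / (2 * (D + 1)))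
      (by positivity) (by
        filter_upwards [Lp.coeFn_sub (hf2.toLp f) (polyLp q), hf2.coeFn_toLp, coeFn_polyLp q,
          ae_restrict_mem measurableSet_Ioo] with x a b c hx
        rw [a, Pi.sub_apply, b, c, Real.norm_eq_abs, abs_sub_comm]
        exact (hq x (Ioo_subset_Icc_self hx)).le)
    refine this.trans_lt ?_
    rw [← hD, mul_div_assoc', div_lt_div_iff₀ (by positivity) (by norm_num)]
    nlinarith
  linarith [dist_triangle g (hf2.toLp f) (polyLp q)]

/-- The first-kind equation `abelOp u = prim g` is solvable in `L¹` for every `g ∈ L²`, with a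
bound, and its solution pairs nonnegatively with the right-hand side. -/
lemma exists_abelOp_eq_prim {p σ μ ν : ℝ} (h : AbelParams p σ μ ν) :
    ∃ M : ℝ, 0 ≤ M ∧ ∀ g : L2Lam, ∃ u : L1Lam, abelOp p σ u =ᵐ[lamMeasure] prim g ∧
      ‖u‖ ≤ M * ‖g‖ ∧ 0 ≤ primPairing u g := by
  obtain ⟨T, hTs, hT, M, hM0, hM⟩ := exists_polyOp_L1_bound h
  have hwi (r : ℝ[X]) : Integrable (fun x => jacWeight μ ν x * r.eval x) lamMeasure :=
    integrable_jacWeight_mul_eval h.neg_one_lt_left h.neg_one_lt_right r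
  set V : ℝ[X] → L1Lam := fun r => (hwi r).toL1 _ with hV
  have hVc (r : ℝ[X]) : V r =ᵐ[lamMeasure] fun x => jacWeight μ ν x * r.eval x :=
    (hwi r).coeFn_toL1
  have hVsub (r s : ℝ[X]) : V r - V s = V (r - s) := by
    rw [hV]
    beta_reduce
    rw [← Integrable.toL1_sub, Integrable.toL1_eq_toL1_iff]
    exact Eventually.of_forall fun x => by
      simp only [Pi.sub_apply, eval_sub, mul_sub]
  have hbound (r : ℝ[X]) (hr : (T r).eval (-1) = 0) :
      ‖V r‖ ≤ √M * ‖polyLp (derivative (T r))‖ := by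
    refine abs_le_of_sq_le_sq' ?_ (by positivity) |>.2
    rw [mul_pow, Real.sq_sqrt hM0, norm_sq_eq_integral, L1.norm_eq_integral_norm]
    have e1 : ∫ x in Lam, ‖V r x‖ = ∫ x in Lam, ‖jacWeight μ ν x * r.eval x‖ :=
      integral_congr_ae (by filter_upwards [hVc r] with x hx; rw [hx])
    have e2 : ∫ x in Lam, polyLp (derivative (T r)) x * polyLp (derivative (T r)) x =
        ∫ x in Lam, (derivative (T r)).eval x * (derivative (T r)).eval x :=
      integral_congr_ae (by filter_upwards [coeFn_polyLp (derivative (T r))] with x hx; rw [hx])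
    rw [e1, e2]
    exact hM r hr
  -- For a polynomial `g = q` the solution is `V (S q)`, by surjectivity of `T`.
  have hsol (q : ℝ[X]) : ∃ r : ℝ[X], (T r).eval (-1) = 0 ∧ derivative (T r) = q := by
    obtain ⟨r, hr⟩ := hTs (polyAntideriv q - C ((polyAntideriv q).eval (-1)))
    exact ⟨r, by rw [hr, eval_sub, eval_C, sub_self],
      by rw [hr, derivative_sub, derivative_C, sub_zero, derivative_polyAntideriv]⟩
  choose S hS0 hS using hsol
  have hSab (q : ℝ[X]) : abelOp p σ (V (S q)) =ᵐ[lamMeasure] prim (polyLp q) := by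
    rw [abelOp_congr p σ (hVc (S q))]
    filter_upwards [hT (S q), ae_restrict_mem measurableSet_Ioo] with x h1 hx
    rw [h1, prim_polyLp q (Ioo_subset_Icc_self hx),
      intervalIntegral.integral_eq_sub_of_hasDerivAt (f := fun x => (T (S q)).eval x)
        (fun y _ => by simpa only [hS q] using (T (S q)).hasDerivAt y)
        (q.continuous.intervalIntegrable _ _), hS0, sub_zero]
  have hdist (q q' : ℝ[X]) : ‖V (S q) - V (S q')‖ ≤ √M * ‖polyLp q - polyLp q'‖ := by
    have h0 : (T (S q - S q')).eval (-1) = 0 := by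
      rw [map_sub, eval_sub, hS0, hS0, sub_self]
    have := hbound _ h0
    rwa [map_sub, derivative_sub, hS, hS, polyLp_sub, ← hVsub] at this
  refine ⟨√M, Real.sqrt_nonneg _, fun g => ?_⟩
  obtain ⟨G, hGr, hG⟩ := mem_closure_iff_seq_limit.1 (denseRange_polyLp g)
  choose q hq using hGr
  have hGq : Tendsto (fun n => polyLp (q n)) atTop (𝓝 g) := by
    simpa only [hq] using hG
  -- The a priori bound, applied to differences, carries approximations of `g` to solutions.
  have hcau : CauchySeq fun n => V (S (q n)) := by
    have hc := hGq.cauchySeq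
    rw [Metric.cauchySeq_iff] at hc ⊢
    intro ε hε
    obtain ⟨N, hN⟩ := hc (ε / (√M + 1)) (by positivity)
    refine ⟨N, fun m hm n hn => ?_⟩
    have h1 := hN m hm n hn
    rw [dist_eq_norm] at h1 ⊢
    rw [lt_div_iff₀ (by positivity)] at h1
    have h2 := hdist (q m) (q n)
    have h3 := norm_nonneg (polyLp (q m) - polyLp (q n))
    linarith
  obtain ⟨u, hu⟩ := cauchySeq_tendsto_of_complete hcau
  refine ⟨u, ?_, ?_, ?_⟩
  · have h1 : Tendsto (fun n => abelCLM h (V (S (q n)))) atTop (𝓝 (abelCLM h u)) :=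
      ((abelCLM h).continuous.tendsto u).comp hu
    have h2 : Tendsto (fun n => primLp 1 (polyLp (q n))) atTop (𝓝 (primLp 1 g)) :=
      ((primLp 1).continuous.tendsto g).comp hGq
    have h3 : ∀ n, abelCLM h (V (S (q n))) = primLp 1 (polyLp (q n)) := fun n =>
      Lp.ext ((coeFn_abelCLM h _).trans ((hSab (q n)).trans (coeFn_primLp 1 _).symm))
    simp only [h3] at h1
    have h4 := tendsto_nhds_unique h1 h2
    refine (coeFn_abelCLM h u).symm.trans ?_
    rw [h4]
    exact coeFn_primLp 1 g
  · refine le_of_tendsto_of_tendsto' hu.norm (hGq.norm.const_mul _) fun n => ?_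
    have := hbound _ (hS0 (q n))
    rwa [hS] at this
  · have hc : Continuous fun z : L1Lam × L2Lam => primPairing z.1 z.2 :=
      (primPairing.continuous.comp continuous_fst).clm_apply continuous_snd
    have h1 := (hc.tendsto (u, g)).comp (hu.prodMk_nhds hGq)
    refine ge_of_tendsto' h1 fun n => ?_
    change 0 ≤ primPairing (V (S (q n))) (polyLp (q n))
    have h2 := integral_jacWeight_mul_abelOp_nonneg h (S (q n))
    rw [primPairing_apply]
    refine h2.trans (le_of_eq (integral_congr_ae ?_))
    have h3 := hSab (q n)
    rw [abelOp_congr p σ (hVc (S (q n)))] at h3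
    filter_upwards [h3, hVc (S (q n))] with x a b
    rw [a, b]

/-- An integrable function on `Λ` orthogonal to all polynomials vanishes. -/
lemma ae_eq_zero_of_integral_mul_eval {u : ℝ → ℝ} (hu : Integrable u lamMeasure)
    (h : ∀ q : ℝ[X], ∫ x in Lam, u x * q.eval x = 0) : u =ᵐ[lamMeasure] 0 := by
  have key := IsOpen.ae_eq_zero_of_integral_contDiff_smul_eq_zero (μ := lamMeasure)
    (f := u) (isOpen_Ioo (a := (-1 : ℝ)) (b := 1))
    (hu.locallyIntegrable.locallyIntegrableOn _) (by
      intro φ hφ hc hs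
      obtain ⟨K, hK⟩ := hφ.continuous.bounded_above_of_compact_support hc
      have hi : Integrable (fun x => u x * φ x) lamMeasure :=
        hu.mul_bdd hφ.continuous.aestronglyMeasurable (Eventually.of_forall hK)
      have hle : ∀ ε : ℝ, 0 < ε → |∫ x in Lam, u x * φ x| ≤ (∫ x in Lam, ‖u x‖) * ε := by
        intro ε hε
        obtain ⟨q, hq⟩ := exists_polynomial_near_of_continuousOn (-1) 1 φ
          hφ.continuous.continuousOn ε hε
        rw [← sub_zero (∫ x in Lam, u x * φ x), ← h q,
          ← integral_sub hi (integrable_mul_eval hu q), ← integral_mul_const,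
          ← Real.norm_eq_abs]
        refine (norm_integral_le_integral_norm _).trans ?_
        refine setIntegral_mono_on (hi.sub (integrable_mul_eval hu q)).norm
          (hu.norm.mul_const _) measurableSet_Ioo fun x hx => ?_
        rw [← mul_sub, norm_mul, Real.norm_eq_abs (φ x - _), abs_sub_comm]
        exact mul_le_mul_of_nonneg_left (hq x (Ioo_subset_Icc_self hx)).le (norm_nonneg _)
      simp only [smul_eq_mul, mul_comm (φ _)]
      have hn : 0 ≤ ∫ x in Lam, ‖u x‖ := integral_nonneg fun _ => norm_nonneg _
      by_contra hne
      have h1 := abs_pos.2 hne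
      have h2 := hle (|∫ x in Lam, u x * φ x| / (2 * ((∫ x in Lam, ‖u x‖) + 1)))
        (by positivity)
      rw [mul_div_assoc', le_div_iff₀ (by positivity)] at h2
      nlinarith)
  filter_upwards [key, ae_restrict_mem measurableSet_Ioo] with x hx hxm
  exact hx hxm

/-- The Abel operator is injective on `L¹`: the range of its adjoint contains all polynomials. -/
lemma ae_eq_zero_of_abelOp {p σ μ ν : ℝ} (h : AbelParams p σ μ ν) {u : ℝ → ℝ}
    (hu : Integrable u lamMeasure) (h0 : abelOp p σ u =ᵐ[lamMeasure] 0) :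
    u =ᵐ[lamMeasure] 0 := by
  obtain ⟨T, hTs, hT, -⟩ := exists_polyOp_bound h.symm
  refine ae_eq_zero_of_integral_mul_eval hu fun q => ?_
  obtain ⟨s, rfl⟩ := hTs q
  have h1 := integral_abelOp_mul_jacWeight h hu s
  have h2 : ∫ x in Lam, abelOp p σ u x * (jacWeight ν μ x * s.eval x) = 0 :=
    integral_eq_zero_of_ae (by filter_upwards [h0] with x hx; simp [hx])
  rw [h2] at h1
  rw [h1]
  refine integral_congr_ae ?_
  filter_upwards [hT s] with x hx
  rw [hx]

lemma abelOp_injective {p σ μ ν : ℝ} (h : AbelParams p σ μ ν) {u v : L1Lam}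
    (huv : abelOp p σ u =ᵐ[lamMeasure] abelOp p σ v) : u = v := by
  rw [← sub_eq_zero]
  refine Lp.ext ((ae_eq_zero_of_abelOp h (integrable_L1 (u - v)) ?_).trans
    (Lp.coeFn_zero ℝ 1 lamMeasure).symm)
  refine (coeFn_abelCLM h (u - v)).symm.trans ?_
  have : abelCLM h u = abelCLM h v :=
    Lp.ext ((coeFn_abelCLM h u).trans (huv.trans (coeFn_abelCLM h v).symm))
  rw [map_sub, this, sub_self]
  exact Lp.coeFn_zero ℝ 1 lamMeasure

end

end TwoSidedRL

namespace TwoSidedRL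

noncomputable section

open Filter Topology

/-! ### Weak derivatives and primitives -/

/-- The fundamental theorem of calculus for integrable functions, in weak form; no differentiation
theorem is needed, only Fubini. -/
lemma hasWeakDeriv_prim {g : ℝ → ℝ} (hg : Integrable g lamMeasure) :
    HasWeakDeriv (prim g) g := by
  intro φ h1 h2 h3
  have hd : Continuous (deriv φ) := h1.continuous_deriv (by simp)
  obtain ⟨K, hK⟩ := hd.bounded_above_of_compact_support h2.deriv
  have hdi : Integrable (deriv φ) lamMeasure :=
    Integrable.of_bound hd.aestronglyMeasurable K (Eventually.of_forall hK)
  have hφ1 : φ 1 = 0 := image_eq_zero_of_notMem_tsupport fun h => lt_irrefl _ (h3 h).2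
  have hm : MeasurableSet {z : ℝ × ℝ | z.2 < z.1} :=
    measurableSet_lt measurable_snd measurable_fst
  have hF : Integrable (fun z : ℝ × ℝ => {z : ℝ × ℝ | z.2 < z.1}.indicator
      (fun z => deriv φ z.1 * g z.2) z) (lamMeasure.prod lamMeasure) :=
    (hdi.mul_prod hg).indicator hm
  have e1 : ∀ x ∈ Lam, prim g x * deriv φ x =
      ∫ y in Lam, {z : ℝ × ℝ | z.2 < z.1}.indicator (fun z => deriv φ z.1 * g z.2) (x, y) := by
    intro x hx
    have : ∀ y, {z : ℝ × ℝ | z.2 < z.1}.indicator (fun z => deriv φ z.1 * g z.2) (x, y) =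
        (Iio x).indicator (fun y => deriv φ x * g y) y := fun y => rfl
    simp only [this]
    rw [setIntegral_indicator measurableSet_Iio, Ioo_inter_Iio, min_eq_right hx.2.le,
      integral_const_mul, prim, intervalIntegral.integral_of_le hx.1.le,
      integral_Ioc_eq_integral_Ioo, mul_comm]
  have e2 : ∀ y ∈ Lam,
      ∫ x in Lam, {z : ℝ × ℝ | z.2 < z.1}.indicator (fun z => deriv φ z.1 * g z.2) (x, y) =
      -(g y * φ y) := by
    intro y hy
    have : ∀ x, {z : ℝ × ℝ | z.2 < z.1}.indicator (fun z => deriv φ z.1 * g z.2) (x, y) =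
        (Ioi y).indicator (fun x => deriv φ x * g y) x := fun x => rfl
    simp only [this]
    rw [setIntegral_indicator measurableSet_Ioi, inter_comm, Ioi_inter_Ioo, max_eq_left hy.1.le,
      integral_mul_const, ← integral_Ioc_eq_integral_Ioo,
      ← intervalIntegral.integral_of_le hy.2.le,
      intervalIntegral.integral_deriv_eq_sub
        (fun x _ => (h1.differentiable (by simp)).differentiableAt)
        (hd.intervalIntegrable _ _), hφ1]
    ring
  rw [setIntegral_congr_fun measurableSet_Ioo e1, integral_integral_swap hF,
    setIntegral_congr_fun measurableSet_Ioo e2, integral_neg]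

/-- The du Bois-Reymond lemma: an integrable function on `Λ` with vanishing weak derivative is
constant. -/
lemma ae_eq_const_of_hasWeakDeriv_zero {v : ℝ → ℝ} (hv : Integrable v lamMeasure)
    (h : HasWeakDeriv v fun _ => 0) : ∃ c : ℝ, v =ᵐ[lamMeasure] fun _ => c := by
  let B : ContDiffBump (0 : ℝ) := ⟨1 / 4, 1 / 2, by norm_num, by norm_num⟩
  set ψ₀ : ℝ → ℝ := B.normed volume with hψ₀
  have hs0 : ContDiff ℝ ∞ ψ₀ := B.contDiff_normed
  have hc0 : HasCompactSupport ψ₀ := B.hasCompactSupport_normed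
  have ht0 : tsupport ψ₀ ⊆ Lam := by
    rw [hψ₀, B.tsupport_normed_eq, Real.closedBall_eq_Icc]
    exact Icc_subset_Ioo (by norm_num) (by norm_num)
  have hI0 : ∫ x in Lam, ψ₀ x = 1 := by
    rw [setIntegral_eq_integral_of_forall_compl_eq_zero fun x hx =>
      image_eq_zero_of_notMem_tsupport fun h => hx (ht0 h)]
    exact B.integral_normed
  have hbdd {ψ : ℝ → ℝ} (hs : ContDiff ℝ ∞ ψ) (hc : HasCompactSupport ψ) :
      Integrable ψ lamMeasure ∧ Integrable (fun x => v x * ψ x) lamMeasure := by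
    obtain ⟨K, hK⟩ := hs.continuous.bounded_above_of_compact_support hc
    exact ⟨Integrable.of_bound hs.continuous.aestronglyMeasurable K (Eventually.of_forall hK),
      hv.mul_bdd hs.continuous.aestronglyMeasurable (Eventually.of_forall hK)⟩
  refine ⟨∫ x in Lam, v x * ψ₀ x, ?_⟩
  set c := ∫ x in Lam, v x * ψ₀ x with hcdef
  have key := IsOpen.ae_eq_zero_of_integral_contDiff_smul_eq_zero (μ := lamMeasure)
    (f := fun x => v x - c) (isOpen_Ioo (a := (-1 : ℝ)) (b := 1))
    ((hv.sub (integrable_const c)).locallyIntegrable.locallyIntegrableOn _) (by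
      intro ψ hs hc ht
      -- Correcting `ψ` by a multiple of `ψ₀` makes its mean vanish, and the primitive `φ` of the
      -- result is then an admissible test function for the weak derivative.
      set a := ∫ x in Lam, ψ x with ha
      set θ : ℝ → ℝ := fun x => ψ x - a * ψ₀ x with hθ
      have hθs : ContDiff ℝ ∞ θ := hs.sub (contDiff_const.mul hs0)
      obtain ⟨r, hr0, hr1, hrout⟩ : ∃ r : ℝ, 0 ≤ r ∧ r < 1 ∧ ∀ x, r < |x| → θ x = 0 := by
        have hK : IsCompact (tsupport ψ ∪ tsupport ψ₀) := IsCompact.union hc hc0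
        have hθ0 {x : ℝ} (hx : x ∉ tsupport ψ ∪ tsupport ψ₀) : θ x = 0 := by
          rw [mem_union, not_or] at hx
          rw [hθ]
          beta_reduce
          rw [image_eq_zero_of_notMem_tsupport hx.1, image_eq_zero_of_notMem_tsupport hx.2,
            mul_zero, sub_zero]
        rcases (tsupport ψ ∪ tsupport ψ₀).eq_empty_or_nonempty with he | hne
        · exact ⟨0, le_rfl, zero_lt_one, fun x _ => hθ0 (by rw [he]; exact notMem_empty x)⟩
        · obtain ⟨m, hm, hmax⟩ := hK.exists_isMaxOn hne
            (continuous_abs (G := ℝ)).continuousOn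
          refine ⟨|m|, abs_nonneg m, abs_lt.2 (union_subset ht ht0 hm), fun x hx => hθ0 fun hxK => ?_⟩
          exact absurd (hmax hxK) (not_le.2 hx)
      set φ : ℝ → ℝ := fun x => ∫ t in (-1)..x, θ t with hφ
      have hφd (x : ℝ) : HasDerivAt φ (θ x) x :=
        (hθs.continuous.integral_hasStrictDerivAt (-1) x).hasDerivAt
      have hφderiv : deriv φ = θ := funext fun x => (hφd x).deriv
      have hφs : ContDiff ℝ ∞ φ := by
        rw [contDiff_infty_iff_deriv, hφderiv]
        exact ⟨fun x => (hφd x).differentiableAt, hθs⟩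
      have hθI : ∫ x in Lam, θ x = 0 := by
        rw [hθ, integral_sub (hbdd hs hc).1 ((hbdd hs0 hc0).1.const_mul a), integral_const_mul,
          hI0, mul_one, sub_self]
      have hφ1 : φ 1 = 0 := by
        rw [hφ]
        beta_reduce
        rw [intervalIntegral.integral_of_le (by norm_num), integral_Ioc_eq_integral_Ioo, hθI]
      have hφout : ∀ x, x ∉ Icc (-r) r → φ x = 0 := by
        intro x hx
        rw [mem_Icc, ← abs_le, not_le] at hx
        have hrx := hx
        rcases lt_or_ge x 0 with h0 | h0
        · rw [abs_of_neg h0] at hrx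
          rw [hφ]
          refine intervalIntegral.integral_zero_ae (Eventually.of_forall fun t ht => hrout t ?_)
          rw [uIoc, mem_Ioc] at ht
          have h4 : t ≤ max (-1) x := ht.2
          have h5 : max (-1) x < -r := max_lt (by linarith) (by linarith)
          linarith [neg_le_abs t]
        · rw [abs_of_nonneg h0] at hrx
          have h6 : φ x = φ 1 + ∫ t in (1 : ℝ)..x, θ t :=
            (intervalIntegral.integral_add_adjacent_intervals
              (hθs.continuous.intervalIntegrable _ _)
              (hθs.continuous.intervalIntegrable _ _)).symm
          rw [h6, hφ1, zero_add]
          refine intervalIntegral.integral_zero_ae (Eventually.of_forall fun t ht => hrout t ?_)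
          rw [uIoc, mem_Ioc] at ht
          have h5 : r < min 1 x := lt_min hr1 hrx
          linarith [le_abs_self t, ht.1]
      have hφt : tsupport φ ⊆ Lam := by
        refine (closure_minimal (fun x hx => ?_) isClosed_Icc).trans
          (Icc_subset_Ioo (show (-1 : ℝ) < -r by linarith) hr1)
        by_contra hx'
        exact hx (hφout x hx')
      have h7 := h φ hφs (HasCompactSupport.intro isCompact_Icc hφout) hφt
      rw [hφderiv] at h7
      simp only [zero_mul, integral_zero, neg_zero] at h7
      have h8 : ∫ x in Lam, v x * θ x = (∫ x in Lam, v x * ψ x) - a * c := by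
        rw [hcdef, ← integral_const_mul,
          ← integral_sub (hbdd hs hc).2 ((hbdd hs0 hc0).2.const_mul a)]
        congr 1
        funext x
        rw [hθ]
        ring
      have h9 : ∫ x in Lam, ψ x • (v x - c) = (∫ x in Lam, v x * ψ x) - a * c := by
        rw [ha, ← integral_mul_const, ← integral_sub (hbdd hs hc).2 ((hbdd hs hc).1.mul_const c)]
        congr 1
        funext x
        rw [smul_eq_mul]
        ring
      rw [h9, ← h8, h7])
  filter_upwards [key, ae_restrict_mem measurableSet_Ioo] with x hx hxm
  exact sub_eq_zero.1 (hx hxm)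

/-- A function in `H¹(Λ)` with zero boundary values is the primitive of its weak derivative. -/
lemma ae_eq_prim_of_hasWeakDeriv {w g : ℝ → ℝ} (hw : MemLp w 2 lamMeasure)
    (hg : MemLp g 2 lamMeasure) (h : HasWeakDeriv w g) (hb : ZeroBoundary w) :
    w =ᵐ[lamMeasure] prim g ∧ ∫ x in Lam, g x = 0 := by
  have hgi : Integrable g lamMeasure := hg.integrable (by norm_num)
  have hpc := continuousOn_prim hgi
  have hpm : MemLp (prim g) 2 lamMeasure := by
    obtain ⟨K, hK⟩ := isCompact_Icc.exists_bound_of_continuousOn hpc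
    refine MemLp.of_bound ((hpc.mono Ioo_subset_Icc_self).aestronglyMeasurable
      measurableSet_Ioo) K ?_
    filter_upwards [ae_restrict_mem measurableSet_Ioo] with x hx
    exact hK x (Ioo_subset_Icc_self hx)
  have h1 := (HasWeakDeriv.add hw hg (hpm.const_mul (-1)) (hg.const_mul (-1)) h
    ((hasWeakDeriv_prim hgi).const_mul (-1))).congr (EventuallyEq.refl _ _)
    (g' := fun _ => 0) (Eventually.of_forall fun x => by ring)
  obtain ⟨c, hc⟩ : ∃ c : ℝ, (fun x => w x + -1 * prim g x) =ᵐ[lamMeasure] fun _ => c :=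
    ae_eq_const_of_hasWeakDeriv_zero ((hw.add (hpm.const_mul (-1))).integrable (by norm_num)) h1
  obtain ⟨r, hr, hwr, hr1, hr2⟩ := hb
  have h2 : r =ᵐ[volume.restrict (Icc (-1) 1)] fun x => c + prim g x := by
    rw [← restrict_Ioo_eq_restrict_Icc]
    filter_upwards [hwr, hc] with x a b
    rw [← a]
    linarith
  -- Continuous representatives agree up to the boundary: the value at `-1` gives `c = 0`, and the
  -- value at `1` then gives the vanishing mean.
  have h3 := Measure.eqOn_Icc_of_ae_eq volume (by norm_num) h2 hr
    (continuousOn_const.add hpc)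
  have h4 := h3 (left_mem_Icc.2 (by norm_num))
  have h5 := h3 (right_mem_Icc.2 (by norm_num))
  simp only [hr1, prim_neg_one, add_zero] at h4
  simp only [hr2, prim_one, ← h4, zero_add] at h5
  refine ⟨?_, h5.symm⟩
  filter_upwards [hc] with x hx
  linarith

lemma zeroBoundary_prim {g : ℝ → ℝ} (hg : Integrable g lamMeasure)
    (h0 : ∫ x in Lam, g x = 0) : ZeroBoundary (prim g) :=
  ⟨prim g, continuousOn_prim hg, EventuallyEq.rfl, prim_neg_one g, by rw [prim_one, h0]⟩

lemma ZeroBoundary.congr {w w' : ℝ → ℝ} (h : ZeroBoundary w) (e : w =ᵐ[lamMeasure] w') :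
    ZeroBoundary w' := by
  obtain ⟨r, hr, hwr, h1, h2⟩ := h
  exact ⟨r, hr, e.symm.trans hwr, h1, h2⟩

end

end TwoSidedRL

namespace TwoSidedRL

noncomputable section

open Filter Topology

/-! ### The variational problem -/

/-- The bounded inverse of the Abel operator on primitives of square integrable functions. -/
lemma exists_abelOp_inverse {p σ μ ν : ℝ} (h : AbelParams p σ μ ν) :
    ∃ U : L2Lam →L[ℝ] L1Lam, ∀ g : L2Lam, abelOp p σ (U g) =ᵐ[lamMeasure] prim g ∧
      0 ≤ primPairing (U g) g := by
  obtain ⟨M, -, hM⟩ := exists_abelOp_eq_prim h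
  choose U hU hUM hU0 using hM
  have hCLM (g : L2Lam) : abelCLM h (U g) = primLp 1 g :=
    Lp.ext ((coeFn_abelCLM h _).trans ((hU g).trans (coeFn_primLp 1 g).symm))
  have hinj {u v : L1Lam} (huv : abelCLM h u = abelCLM h v) : u = v := by
    refine abelOp_injective h ((coeFn_abelCLM h u).symm.trans ?_)
    rw [huv]
    exact coeFn_abelCLM h v
  refine ⟨LinearMap.mkContinuous
    { toFun := U
      map_add' := fun g g' => hinj (by rw [map_add, hCLM, hCLM, hCLM, map_add])
      map_smul' := fun a g => hinj (by rw [map_smul, hCLM, hCLM, map_smul, RingHom.id_apply]) }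
    M hUM, fun g => ⟨hU g, hU0 g⟩⟩

/-- The closed subspace of functions in `L²(Λ)` with mean value zero, the weak derivatives of
functions in `H¹₀(Λ)`. -/
def zeroMean : Submodule ℝ L2Lam := (ℝ ∙ Lp.const 2 lamMeasure (1 : ℝ))ᗮ

lemma mem_zeroMean {g : L2Lam} : g ∈ zeroMean ↔ ∫ x in Lam, g x = 0 := by
  rw [zeroMean, Submodule.mem_orthogonal_singleton_iff_inner_right, inner_eq_integral]
  have : ∫ x in Lam, (Lp.const 2 lamMeasure (1 : ℝ)) x * g x = ∫ x in Lam, g x :=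
    integral_congr_ae (by
      filter_upwards [Lp.coeFn_const (p := 2) (μ := lamMeasure) (1 : ℝ)] with x hx
      rw [hx, Function.const_apply, one_mul])
  rw [this]

instance : CompleteSpace zeroMean := by
  unfold zeroMean
  infer_instance

/-- Taking primitives, as a bounded operator from `zeroMean` to `H¹₀(Λ)`. -/
def primH10 : zeroMean →L[ℝ] H10 :=
  (((WithLp.prodContinuousLinearEquiv 2 ℝ L2Lam L2Lam).symm.toContinuousLinearMap ∘L
    ((primLp 2).prod (ContinuousLinearMap.id ℝ L2Lam))) ∘L zeroMean.subtypeL).codRestrict H10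
    fun g => ⟨(hasWeakDeriv_prim (integrable_L2 g.1)).congr (coeFn_primLp 2 g.1).symm
        EventuallyEq.rfl,
      (zeroBoundary_prim (integrable_L2 g.1) (mem_zeroMean.1 g.2)).congr
        (coeFn_primLp 2 g.1).symm⟩

lemma AdmissibleExponents.abelParams {α p μ ν : ℝ} (h : AdmissibleExponents α p μ ν)
    (hα1 : 1 < α) (hα2 : α < 2) (hp0 : 0 ≤ p) (hp1 : p ≤ 1) : AbelParams p (2 - α) μ ν where
  σ_pos := by linarith
  σ_lt_one := by linarith
  p_nonneg := hp0
  p_le_one := hp1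
  μ_nonpos := h.2.1
  ν_nonpos := h.2.2.2.1
  add_eq := by linarith [h.2.2.2.2.1]
  sin_eq := h.2.2.2.2.2

/-- Both sines in the numerator are nonpositive, not both zero, and the one in the denominator is
negative. -/
lemma fracConst_pos {α p μ ν : ℝ} (hα1 : 1 < α) (hα2 : α < 2)
    (h : AbelParams p (2 - α) μ ν) : 0 < fracConst α μ ν := by
  have h1 : Real.sin (Real.pi * α) < 0 := by
    rw [← Real.sin_sub_two_pi, show Real.pi * α - 2 * Real.pi = Real.pi * (α - 2) by ring]
    exact AbelParams.sin_neg (by linarith) (by linarith)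
  have h2 {t : ℝ} (ht : -1 < t) (ht0 : t ≤ 0) : Real.sin (Real.pi * t) ≤ 0 := by
    rcases ht0.eq_or_lt with rfl | h0
    · simp
    · exact (AbelParams.sin_neg ht h0).le
  refine div_pos_of_neg_of_neg ?_ h1
  rcases h.μ_nonpos.eq_or_lt with h0 | h0
  · have := AbelParams.sin_neg h.neg_one_lt_right (by linarith [h.add_eq])
    linarith [h2 h.neg_one_lt_left h.μ_nonpos]
  · have := AbelParams.sin_neg h.neg_one_lt_left h0
    linarith [h2 h.neg_one_lt_right h.ν_nonpos]

section Correspondence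

variable {α p μ ν : ℝ}

lemma weakDeriv_ae_eq {w : ℝ → ℝ} {g : L2Lam} (hw : MemH1 w) (e : w =ᵐ[lamMeasure] prim g) :
    weakDeriv w =ᵐ[lamMeasure] g :=
  HasWeakDeriv.ae_unique (memLp_weakDeriv hw) (Lp.memLp g) (hasWeakDeriv_weakDeriv hw)
    ((hasWeakDeriv_prim (integrable_L2 g)).congr e.symm EventuallyEq.rfl)

lemma memH1_of_ae_eq_prim {w : ℝ → ℝ} {g : L2Lam} (e : w =ᵐ[lamMeasure] prim g) : MemH1 w :=
  ⟨(memLp_prim 2 g).ae_eq e.symm, g, Lp.memLp g,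
    (hasWeakDeriv_prim (integrable_L2 g)).congr e.symm EventuallyEq.rfl⟩

lemma toH10_eq {w : ℝ → ℝ} {g : zeroMean} (hw : MemH1 w) (hb : ZeroBoundary w)
    (e : w =ᵐ[lamMeasure] prim (g : L2Lam)) : toH10 w hw hb = primH10 g := by
  refine Subtype.ext (congrArg (WithLp.toLp 2) (Prod.ext (Lp.ext ?_) (Lp.ext ?_)))
  · exact hw.1.coeFn_toLp.trans (e.trans (coeFn_primLp 2 g.1).symm)
  · exact (memLp_weakDeriv hw).coeFn_toLp.trans (weakDeriv_ae_eq hw e)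

/-- `H_RL^{α-1,0}(Λ)` is parametrized by `L²` functions with mean value zero, through the solution
operator `V` of the equation `I_p^{2-α} u = prim g`. -/
lemma exists_fracInt_inverse (hα1 : 1 < α) (hα2 : α < 2) (h : AbelParams p (2 - α) μ ν) :
    ∃ V : L2Lam →L[ℝ] L1Lam,
      (∀ g : L2Lam, twoSidedFracInt α p μ ν (2 - α) (V g) =ᵐ[lamMeasure] prim g ∧
        0 ≤ primPairing (V g) g) ∧
      ∀ v : L1Lam, MemHRL0 α p μ ν v → ∃ g : zeroMean, v = V g := by
  obtain ⟨U, hU⟩ := exists_abelOp_inverse h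
  set κ := fracConst α μ ν / Real.Gamma (2 - α) with hκ
  have hκ0 : 0 < κ := div_pos (fracConst_pos hα1 hα2 h) (Real.Gamma_pos_of_pos h.σ_pos)
  have hI (v : L1Lam) : twoSidedFracInt α p μ ν (2 - α) v =ᵐ[lamMeasure]
      fun x => κ * abelOp p (2 - α) v x :=
    twoSidedFracInt_ae_eq h.σ_pos h.σ_lt_one α p μ ν (integrable_L1 v)
  have hV (g : L2Lam) : abelOp p (2 - α) ((κ⁻¹ • U) g) =ᵐ[lamMeasure]
      fun x => κ⁻¹ * prim g x := by
    rw [_root_.smul_apply, abelOp_congr p (2 - α) (Lp.coeFn_smul κ⁻¹ (U g))]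
    filter_upwards [(hU g).1] with x hx
    rw [← hx]
    exact abelOp_const_mul p (2 - α) κ⁻¹ (U g) x
  refine ⟨κ⁻¹ • U, fun g => ⟨?_, ?_⟩, fun v hv => ?_⟩
  · filter_upwards [hI ((κ⁻¹ • U) g), hV g] with x h1 h2
    rw [h1, h2, mul_inv_cancel_left₀ hκ0.ne']
  · rw [_root_.smul_apply, map_smul, _root_.smul_apply, smul_eq_mul]
    exact mul_nonneg (inv_pos.2 hκ0).le (hU g).2
  · obtain ⟨h1, h2⟩ := ae_eq_prim_of_hasWeakDeriv hv.1.1 (memLp_weakDeriv hv.1)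
      (hasWeakDeriv_weakDeriv hv.1) hv.2
    set g : L2Lam := (memLp_weakDeriv hv.1).toLp _ with hg
    have hgc : g =ᵐ[lamMeasure] weakDeriv (twoSidedFracInt α p μ ν (2 - α) v) :=
      (memLp_weakDeriv hv.1).coeFn_toLp
    refine ⟨⟨g, mem_zeroMean.2 ((integral_congr_ae hgc).trans h2)⟩, abelOp_injective h ?_⟩
    filter_upwards [hI v, h1, hV g, ae_restrict_mem measurableSet_Ioo] with x a b c hx
    have h3 := prim_congr hgc (Ioo_subset_Icc_self hx)
    rw [c, h3, ← b, a, inv_mul_cancel_left₀ hκ0.ne']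

lemma memHRL0_of_ae_eq_prim {u : L1Lam} {g : zeroMean}
    (e : twoSidedFracInt α p μ ν (2 - α) u =ᵐ[lamMeasure] prim (g : L2Lam)) :
    MemHRL0 α p μ ν u :=
  ⟨memH1_of_ae_eq_prim e,
    (zeroBoundary_prim (integrable_L2 g.1) (mem_zeroMean.1 g.2)).congr e.symm⟩

/-- The bilinear form in terms of the weak derivatives `g`, `k` of the fractional integrals. -/
lemma bilinA_eq {c : ℝ} {u v : L1Lam} {g k : L2Lam}
    (eu : twoSidedFracInt α p μ ν (2 - α) u =ᵐ[lamMeasure] prim g)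
    (ev : twoSidedFracInt α p μ ν (2 - α) v =ᵐ[lamMeasure] prim k) :
    bilinA α p μ ν c u v = c * primPairing u k + inner ℝ g k := by
  rw [bilinA, primPairing_apply, inner_eq_integral]
  congr 1
  · congr 1
    refine integral_congr_ae ?_
    filter_upwards [ev] with x hx
    rw [hx]
  · refine integral_congr_ae ?_
    filter_upwards [weakDeriv_ae_eq (memH1_of_ae_eq_prim eu) eu,
      weakDeriv_ae_eq (memH1_of_ae_eq_prim ev) ev] with x h1 h2
    rw [twoSidedFracDeriv, twoSidedFracDeriv, h1, h2]

lemma normHRL_le {u : L1Lam} {g : L2Lam}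
    (e : twoSidedFracInt α p μ ν (2 - α) u =ᵐ[lamMeasure] prim g) :
    normHRL α p μ ν u ≤ (‖primLp 2‖ + 1) * ‖g‖ := by
  have h1 : (eLpNorm (twoSidedFracInt α p μ ν (2 - α) u) 2 lamMeasure).toReal =
      ‖primLp 2 g‖ := by
    rw [Lp.norm_def, eLpNorm_congr_ae (e.trans (coeFn_primLp 2 g).symm)]
  have h2 : (eLpNorm (twoSidedFracDeriv α p μ ν u) 2 lamMeasure).toReal = ‖g‖ := by
    rw [Lp.norm_def, twoSidedFracDeriv,
      eLpNorm_congr_ae (weakDeriv_ae_eq (memH1_of_ae_eq_prim e) e)]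
  have h3 := (primLp 2).le_opNorm g
  rw [normHRL, h1, h2]
  refine Real.sqrt_le_iff.2 ⟨by positivity, ?_⟩
  have h4 := norm_nonneg (primLp 2 g)
  have h5 := norm_nonneg g
  calc ‖primLp 2 g‖ ^ 2 + ‖g‖ ^ 2 ≤ (‖primLp 2 g‖ + ‖g‖) ^ 2 := by nlinarith
    _ ≤ ((‖primLp 2‖ + 1) * ‖g‖) ^ 2 := pow_le_pow_left₀ (by positivity) (by linarith) 2

end Correspondence

end

end TwoSidedRL

open TwoSidedRL in
theorem theorem3p1 (α p μ ν c : ℝ) (hα1 : 1 < α) (hα2 : α < 2) (hp0 : 0 ≤ p) (hp1 : p ≤ 1)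
    (hμν : TwoSidedRL.AdmissibleExponents α p μ ν) (hc : 0 ≤ c) :
    ∃ C : ℝ, 0 < C ∧ ∀ f : TwoSidedRL.Hneg1,
      ∃ u : Lp ℝ 1 TwoSidedRL.lamMeasure,
        TwoSidedRL.IsWeakSolution α p μ ν c f u ∧
        TwoSidedRL.normHRL α p μ ν u ≤ C * ‖f‖ ∧
        ∀ u' : Lp ℝ 1 TwoSidedRL.lamMeasure,
          TwoSidedRL.IsWeakSolution α p μ ν c f u' → u' = u := by
  obtain ⟨V, hV, hsurj⟩ := exists_fracInt_inverse hα1 hα2 (hμν.abelParams hα1 hα2 hp0 hp1)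
  -- With `u = V g` and `v = V k` the weak problem becomes `B g k = F k` on `zeroMean`.
  let B : zeroMean →L[ℝ] zeroMean →L[ℝ] ℝ :=
    c • primPairing.bilinearComp (V ∘L zeroMean.subtypeL) zeroMean.subtypeL +
      (innerₗ zeroMean).mkContinuous₂ 1 fun g k => by
        rw [one_mul]
        exact norm_inner_le_norm g k
  have hB (g k : zeroMean) : B g k = c * primPairing (V g) k + inner ℝ (g : L2Lam) k := rfl
  have hBself (g : zeroMean) : ‖g‖ ^ 2 ≤ B g g := by
    rw [hB, real_inner_self_eq_norm_sq]
    have := mul_nonneg hc (hV g).2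
    exact le_add_of_nonneg_left this
  have hcoer : IsCoercive B := ⟨1, one_pos, fun g => by
    rw [one_mul, ← sq]
    exact hBself g⟩
  have hA (g k : zeroMean) : bilinA α p μ ν c (V g) (V k) = B g k :=
    bilinA_eq (hV g).1 (hV k).1
  refine ⟨(‖primLp 2‖ + 1) * (‖primH10‖ + 1), by positivity, fun f => ?_⟩
  set F : StrongDual ℝ zeroMean := f ∘L primH10
  set g := hcoer.continuousLinearEquivOfBilin.symm ((InnerProductSpace.toDual ℝ zeroMean).symm F)
    with hg
  have hgF (k : zeroMean) : B g k = F k := by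
    rw [← hcoer.continuousLinearEquivOfBilin_apply, hg, ContinuousLinearEquiv.apply_symm_apply,
      InnerProductSpace.toDual_symm_apply]
  have hsol (g' : zeroMean) : IsWeakSolution α p μ ν c f (V g') ↔ ∀ k, B g' k = F k := by
    constructor
    · intro h k
      have h1 := h.2 (V k) (memHRL0_of_ae_eq_prim (hV k).1)
      exact ((hA g' k).symm.trans h1).trans (congrArg f (toH10_eq _ _ (hV k).1))
    · refine fun h => ⟨memHRL0_of_ae_eq_prim (hV g').1, fun v hv => ?_⟩
      obtain ⟨k, rfl⟩ := hsurj v hv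
      exact ((hA g' k).trans (h k)).trans (congrArg f (toH10_eq _ _ (hV k).1)).symm
  refine ⟨V g, (hsol g).2 hgF, ?_, fun u' hu' => ?_⟩
  · have h1 := hBself g
    rw [hgF] at h1
    have h2 : F g ≤ ‖f‖ * (‖primH10‖ * ‖g‖) :=
      (le_abs_self _).trans ((f.le_opNorm _).trans
        (mul_le_mul_of_nonneg_left (primH10.le_opNorm g) (norm_nonneg f)))
    have h3 : ‖g‖ ≤ (‖primH10‖ + 1) * ‖f‖ := by
      rcases (norm_nonneg g).eq_or_lt with h0 | h0
      · rw [← h0]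
        positivity
      · have : ‖g‖ ≤ ‖primH10‖ * ‖f‖ := le_of_mul_le_mul_right (by nlinarith) h0
        linarith [norm_nonneg f]
    calc normHRL α p μ ν (V g) ≤ (‖primLp 2‖ + 1) * ‖(g : L2Lam)‖ := normHRL_le (hV g).1
      _ ≤ (‖primLp 2‖ + 1) * ((‖primH10‖ + 1) * ‖f‖) :=
        mul_le_mul_of_nonneg_left h3 (by positivity)
      _ = _ := by ring
  · obtain ⟨g', rfl⟩ := hsurj u' hu'.1
    have h1 := (hsol g').1 hu'
    have h2 (k : zeroMean) : B (g' - g) k = 0 := by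
      rw [map_sub B]
      change B g' k - B g k = 0
      rw [h1, hgF, sub_self]
    have h3 := hBself (g' - g)
    rw [h2] at h3
    have h4 : g' - g = 0 := by
      rw [← norm_eq_zero]
      exact pow_eq_zero_iff two_ne_zero |>.1 (le_antisymm h3 (sq_nonneg _))
    rw [sub_eq_zero.1 h4]
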